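/- **Theorem (Gaussian factorization backward error).** Let $d\ge 2$, $k\ge 1$, $n=dk$, let $M_0,\dots,M_{d-1}\in\mathbb C^{k\times k}$ with $M_0$ upper triangular, and let $S\in\mathbb C^{n\times n}$ be the block companion matrix with identity blocks on the block subdiagonal, last block column $-M_0,\dots,-M_{d-1}$, and zeros elsewhere. Let $S=\mathcal Q^kR_1\cdots R_k$ be its Gaussian factorization: $\mathcal Q$ is the cyclic downshift matrix ($\mathcal Qe_i=e_{i+1}$, $\mathcal Qe_n=e_1$), and $R_j$ is upper triangular and equal to the identity except for a "spike" in column $n+1-j$. Norms are Frobenius norms. *Storage.* A core transformation is an identity matrix with a (numerically) unitary $2\times2$ active part inserted in rows and columns $i,i+1$. The factor $\mathcal Q^k$ is stored as $k$ descending sequences of core transformations with active part $\left[\begin{smallmatrix}0&1\\1&0\end{smallmatrix}\right]$. The factor $R_j$, with spike $x$ in column $\ell$, is stored by the $(n+1)\times(n+1)$ core sequences $\mathcal C=C_1\cdots C_n$, with $\mathcal C\,(x^T,-1)^T=\alpha e_1$ and $C_i$ having active part $F=\left[\begin{smallmatrix}0&1\\1&0\end{smallmatrix}\right]$ for $i>\ell$,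 and $\mathcal B=B_1\cdots B_n$, where $B_\ell=C_\ell F$ and $B_i=C_i$ for $i\ne\ell$. A pair $(\mathcal C,\mathcal B)$ represents the leading $n\times n$ block of $\mathcal C^*(\mathcal B+e_1y^T)$, where the rank-one part is recovered from the unitary part by $y^T=-\rho^{-1}e_{n+1}^T\mathcal C^*\mathcal B$, $\rho=e_{n+1}^T\mathcal C^*e_1$. *Computation.* Starting from this storage (whose $C_i$, $i\le\ell$, are computed in floating point), $N$ operations are performed on the factored form, each one being: a turnover or a fusion of core transformations, the interchange of two neighbouring ones acting on disjoint rows, replacing one whose entry $(2,1)$ is at most $u$ in modulus by its diagonal part, passing one from one side of some $R_j$ to the other (by a turnover with $\mathcal B$ and a turnover with $\mathcal C^*$), multiplying the matrix on the left by $G^*$ or on the right by $G$ for an arbitrary core transformation $G$ that is unitary up to $\kappa u$, or cancelling the leftmost or the rightmost core transformation by an equivalence transformation. Turnovers (QR factorization of the $3\times3$ product by plane reflectors), fusions (product of the $2\times2$ active parts), reflectors and the restoration of unitarity of computed active parts are carried out in real floating point arithmetic in which every computed $+,-,\times,/,\sqrt{\ }$ is the exact result $t$ replaced by $\mathrm{rd}(t)$,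 where $|\mathrm{rd}(t)-t|\le u|t|$. Let $\hat U$ and $\hat V$ be the products of the (computed) core transformations applied by the equivalence transformations on the left and on the right, so that the computation approximates $\hat U^*S\hat V$, and let $\hat S$ be the product of the matrices represented by the final computed factors. *Claim.* For every $\kappa$ there are $K>0$ and $a\in\mathbb N$, depending on $\kappa$ only, such that the following holds for all $d,k,N,S,u>0$, all such roundings $\mathrm{rd}$ and all such computations. Put $\gamma=K\,(dk)^a\,(N+1)$, and assume $\gamma\|S\|u\le 1$ (so that higher order terms in $u$ are negligible). Then there are unitary matrices $U,V$ with $\|U-\hat U\|\le\gamma u$, $\|V-\hat V\|\le\gamma u$, and a matrix $\delta S$, such that $$\hat S=U^*(S+\delta S)V,\qquad \|\delta S\|\le\gamma\,\|S\|^2u .$$ -/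

import Mathlib

open scoped Matrix

attribute [local instance] Matrix.frobeniusNormedAddCommGroup

noncomputable section

namespace CoreChasing

/-! ### Floating point arithmetic -/

/-- The standard model of floating point arithmetic with unit round-off `u`: the computed result of
a basic real operation (`+`, `-`, `*`, `/`, `sqrt`) is `rd` of the exact result. -/
def IsRounding (u : ℝ) (rd : ℝ → ℝ) : Prop :=
  ∀ x : ℝ, |rd x - x| ≤ u * |x|

/-- Floating point sum of complex numbers. -/
def flAdd (rd : ℝ → ℝ) (z w : ℂ) : ℂ :=
  ⟨rd (z.re + w.re), rd (z.im + w.im)⟩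

/-- Floating point product of complex numbers, by the usual real formulas. -/
def flMul (rd : ℝ → ℝ) (z w : ℂ) : ℂ :=
  ⟨rd (rd (z.re * w.re) - rd (z.im * w.im)), rd (rd (z.re * w.im) + rd (z.im * w.re))⟩

/-- Floating point quotient of a complex number by a real number. -/
def flDivReal (rd : ℝ → ℝ) (z : ℂ) (r : ℝ) : ℂ :=
  ⟨rd (z.re / r), rd (z.im / r)⟩

/-- Floating point value of `|z|²`. -/
def flNormSq (rd : ℝ → ℝ) (z : ℂ) : ℝ :=
  rd (rd (z.re * z.re) + rd (z.im * z.im))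

/-- Floating point value of `√(|a|² + |b|²)`. -/
def flHypot (rd : ℝ → ℝ) (a b : ℂ) : ℝ :=
  rd (Real.sqrt (rd (flNormSq rd a + flNormSq rd b)))

/-- Floating point matrix product (recursive summation of rounded products). -/
def flMatMul (rd : ℝ → ℝ) {m : ℕ} (A B : Matrix (Fin m) (Fin m) ℂ) :
    Matrix (Fin m) (Fin m) ℂ :=
  fun i j => (List.finRange m).foldl (fun acc l => flAdd rd acc (flMul rd (A i l) (B l j))) 0

/-! ### Core transformations -/

/-- The (stored) active part of a core transformation. -/
abbrev Core := Matrix (Fin 2) (Fin 2) ℂ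

/-- The core transformation acting on rows and columns `i`, `i + 1` (counted from `0`): the
identity matrix of size `m` with the active part `A` inserted on the diagonal. -/
def coreAt (m i : ℕ) (A : Core) : Matrix (Fin m) (Fin m) ℂ := fun p q =>
  if p.val = i ∧ q.val = i then A 0 0
  else if p.val = i ∧ q.val = i + 1 then A 0 1
  else if p.val = i + 1 ∧ q.val = i then A 1 0
  else if p.val = i + 1 ∧ q.val = i + 1 then A 1 1
  else if p = q then 1 else 0

/-- The counteridentity. -/
def flip2 : Core := !![0, 1; 1, 0]

/-- A stored core is unitary up to `ε` (in the Frobenius norm). -/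
def NearUnitary (ε : ℝ) (G : Core) : Prop :=
  ∃ G₀ ∈ Matrix.unitaryGroup (Fin 2) ℂ, ‖G - G₀‖ ≤ ε

/-- The computed core `G`, in exact arithmetic the unitary (reflector) `[[c, s̄], [s, -c̄]]` with
`c = a / r`, `s = b / r`, `r = √(|a|² + |b|²)`, so that `Gᴴ (a, b)ᵀ = (r, 0)ᵀ`; it is the identity
if `r = 0`. -/
def flGivens (rd : ℝ → ℝ) (a b : ℂ) : Core :=
  let r := flHypot rd a b
  if r = 0 then 1
  else
    let c := flDivReal rd a r
    let s := flDivReal rd b r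
    !![c, star s; s, -star c]

/-- Restoring unitarity of a computed core `X` to working precision: the first column of `X` is
normalized to `(c, s)`, the second column is replaced by `φ (s̄, -c̄)`, where `φ` is the normalized
inner product of `(s̄, -c̄)` with the second column of `X`. A unitary `X` is left unchanged in exact
arithmetic. -/
def flRenorm (rd : ℝ → ℝ) (X : Core) : Core :=
  let P := flGivens rd (X 0 0) (X 1 0)
  let w := flMatMul rd Pᴴ X 1 1
  let r := flHypot rd w 0
  let φ : ℂ := if r = 0 then 1 else flDivReal rd w r
  !![P 0 0, flMul rd φ (P 0 1); P 1 0, flMul rd φ (P 1 1)]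

/-- Computed fusion of two core transformations acting on the same rows. -/
def flFuse (rd : ℝ → ℝ) (A B : Core) : Core :=
  flRenorm rd (flMatMul rd A B)

/-- Computed turnover `A_i B_{i+1} D_i = F_{i+1} G_i H_{i+1}`; the result is `(F, G, H)`. It is
the QR factorization of the `3 × 3` product: `F` annihilates its entry `(3,1)`, then `G`
annihilates the entry `(2,1)`, and what remains is `1 ⊕ H`. -/
def flTurnDown (rd : ℝ → ℝ) (A B D : Core) : Core × Core × Core :=
  let M := flMatMul rd (flMatMul rd (coreAt 3 0 A) (coreAt 3 1 B)) (coreAt 3 0 D)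
  let F := flGivens rd (M 1 0) (M 2 0)
  let M₁ := flMatMul rd (coreAt 3 1 F)ᴴ M
  let G := flGivens rd (M₁ 0 0) (M₁ 1 0)
  let M₂ := flMatMul rd (coreAt 3 0 G)ᴴ M₁
  (F, G, flRenorm rd !![M₂ 1 1, M₂ 1 2; M₂ 2 1, M₂ 2 2])

/-- The active part after reversing the order of the rows and of the columns. -/
def reverse (A : Core) : Core := !![A 1 1, A 1 0; A 0 1, A 0 0]

/-- Computed turnover `A_{i+1} B_i D_{i+1} = F_i G_{i+1} H_i`; the result is `(F, G, H)`. It is the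
other turnover with the order of rows and columns reversed. -/
def flTurnUp (rd : ℝ → ℝ) (A B D : Core) : Core × Core × Core :=
  let T := flTurnDown rd (reverse A) (reverse B) (reverse D)
  (reverse T.1, reverse T.2.1, reverse T.2.2)

/-! ### Factored storage of an identity-plus-spike matrix -/

/-- The product `C_0 C_1 ⋯ C_{n-1}` of core transformations of size `n + 1`. -/
def descending (n : ℕ) (C : ℕ → Core) : Matrix (Fin (n + 1)) (Fin (n + 1)) ℂ :=
  ((List.range n).map fun i => coreAt (n + 1) i (C i)).prod

/-- The `n × n` matrix `Pᵀ 𝒞ᴴ (ℬ + e₁ yᵀ) P` represented by the stored sequences `C` and `B`, where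
the rank-one part is rebuilt from the unitary part: with `ρ = e_{n+1}ᵀ 𝒞ᴴ e₁`,
`yᵀ = -ρ⁻¹ e_{n+1}ᵀ 𝒞ᴴ ℬ`. -/
def represented (n : ℕ) (C B : ℕ → Core) : Matrix (Fin n) (Fin n) ℂ :=
  let CH := (descending n C)ᴴ
  let Z := CH * descending n B
  let ρ := CH (Fin.last n) 0
  let y : Fin (n + 1) → ℂ := fun q => -ρ⁻¹ * Z (Fin.last n) q
  fun p q => Z p.castSucc q.castSucc + CH p.castSucc 0 * y q.castSucc

/-- The computed norms of the tails of the extended spike `(x_0, …, x_ℓ, -1)`: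
`spikeTail m` belongs to the last `m + 1` entries (the last entry itself for `m = 0`). -/
def spikeTail (rd : ℝ → ℝ) (x : ℕ → ℂ) (l : ℕ) : ℕ → ℂ
  | 0 => -1
  | m + 1 => (flHypot rd (x (l - m)) (spikeTail rd x l m) : ℂ)

/-- The computed core transformations with `C_0 ⋯ C_{n-1} (x_0, …, x_ℓ, 0, …, 0, -1)ᵀ = α e₁`. -/
def initC (rd : ℝ → ℝ) (x : ℕ → ℂ) (l : ℕ) : ℕ → Core := fun p =>
  if p ≤ l then (flGivens rd (x p) (spikeTail rd x l (l - p)))ᴴ else flip2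

/-- The core transformations with `B_0 ⋯ B_{n-1} = C_0 ⋯ C_{n-1} Y`, where `Y` interchanges the
columns `ℓ` and `n`. The product with `flip2` only interchanges two columns. -/
def initB (rd : ℝ → ℝ) (x : ℕ → ℂ) (l : ℕ) : ℕ → Core := fun p =>
  if p = l then initC rd x l p * flip2 else initC rd x l p

/-! ### The factored matrix and the operations on it -/

/-- The data of a computation on a product
`𝒬₀ R_1 𝒬₁ R_2 𝒬₂ ⋯ R_k 𝒬_k` of size `n`: each `𝒬_j` is a product of core transformations (stored
as pairs of a row index and an active part), each `R_j` is stored as a pair of sequences of core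
transformations. The matrices `U`, `V` are a record of the product of the core transformations
applied so far in the equivalence transformation. -/
structure Conf (n k : ℕ) where
  word : Fin (k + 1) → List (ℕ × Core)
  C : Fin k → ℕ → Core
  B : Fin k → ℕ → Core
  U : Matrix (Fin n) (Fin n) ℂ
  V : Matrix (Fin n) (Fin n) ℂ

/-- Replace the sequence `𝒬_j`. -/
def Conf.setWord {n k : ℕ} (s : Conf n k) (j : Fin (k + 1)) (w : List (ℕ × Core)) : Conf n k :=
  { s with word := Function.update s.word j w }

/-- Replace the entries `i`, `i + 1` of the sequences that represent `R_j`. -/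
def Conf.setFactor {n k : ℕ} (s : Conf n k) (j : Fin k) (i : ℕ) (C₀ C₁ B₀ B₁ : Core) :
    Conf n k :=
  { s with
    C := Function.update s.C j (Function.update (Function.update (s.C j) i C₀) (i + 1) C₁)
    B := Function.update s.B j (Function.update (Function.update (s.B j) i B₀) (i + 1) B₁) }

/-- The product of a list of core transformations. -/
def wordMat (n : ℕ) (w : List (ℕ × Core)) : Matrix (Fin n) (Fin n) ℂ :=
  (w.map fun c => coreAt n c.1 c.2).prod

/-- The matrix represented by the stored factors. -/
def Conf.value {n k : ℕ} (s : Conf n k) : Matrix (Fin n) (Fin n) ℂ :=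
  wordMat n (s.word 0) *
    (List.ofFn fun j : Fin k =>
      represented n (s.C j) (s.B j) * wordMat n (s.word j.succ)).prod

/-- One operation of the core chasing algorithm, in floating point. The core transformations that
are brought in from outside (from a shift or from the second matrix of a pencil) are arbitrary, and
unitary up to `κ u`. -/
inductive FlStep {n k : ℕ} (rd : ℝ → ℝ) (u κ : ℝ) : Conf n k → Conf n k → Prop
  /-- Two neighbouring core transformations that act on disjoint rows are interchanged. -/
  | swap (s : Conf n k) (j : Fin (k + 1)) (l r : List (ℕ × Core)) (i i' : ℕ) (A A' : Core)
      (hi : i + 1 < i' ∨ i' + 1 < i) (h : s.word j = l ++ (i, A) :: (i', A') :: r) :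
      FlStep rd u κ s (s.setWord j (l ++ (i', A') :: (i, A) :: r))
  /-- Fusion. -/
  | fuse (s : Conf n k) (j : Fin (k + 1)) (l r : List (ℕ × Core)) (i : ℕ) (A A' : Core)
      (h : s.word j = l ++ (i, A) :: (i, A') :: r) :
      FlStep rd u κ s (s.setWord j (l ++ (i, flFuse rd A A') :: r))
  /-- Turnover. -/
  | turnDown (s : Conf n k) (j : Fin (k + 1)) (l r : List (ℕ × Core)) (i : ℕ) (A B D : Core)
      (h : s.word j = l ++ (i, A) :: (i + 1, B) :: (i, D) :: r)
      (F G H : Core) (hT : flTurnDown rd A B D = (F, G, H)) :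
      FlStep rd u κ s (s.setWord j (l ++ (i + 1, F) :: (i, G) :: (i + 1, H) :: r))
  /-- Turnover. -/
  | turnUp (s : Conf n k) (j : Fin (k + 1)) (l r : List (ℕ × Core)) (i : ℕ) (A B D : Core)
      (h : s.word j = l ++ (i + 1, A) :: (i, B) :: (i + 1, D) :: r)
      (F G H : Core) (hT : flTurnUp rd A B D = (F, G, H)) :
      FlStep rd u κ s (s.setWord j (l ++ (i, F) :: (i + 1, G) :: (i, H) :: r))
  /-- Deflation: an almost diagonal core transformation is made diagonal. -/
  | deflate (s : Conf n k) (j : Fin (k + 1)) (l r : List (ℕ × Core)) (i : ℕ) (A : Core)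
      (hA : ‖A 1 0‖ ≤ u) (h : s.word j = l ++ (i, A) :: r) :
      FlStep rd u κ s (s.setWord j (l ++ (i, !![A 0 0, 0; 0, A 1 1]) :: r))
  /-- Pass-through from right to left: the first core transformation to the right of a triangular
  factor is moved to its left, by a turnover with `ℬ` and a turnover with `𝒞ᴴ`. -/
  | passLeft (s : Conf n k) (j : Fin k) (r : List (ℕ × Core)) (i : ℕ) (G : Core)
      (h : s.word j.succ = (i, G) :: r)
      (W B₀ B₁ : Core) (hB : flTurnDown rd (s.B j i) (s.B j (i + 1)) G = (W, B₀, B₁))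
      (G' D₁ D₀ : Core) (hC : flTurnUp rd (s.C j (i + 1))ᴴ (s.C j i)ᴴ W = (G', D₁, D₀)) :
      FlStep rd u κ s (((s.setWord j.succ r).setWord j.castSucc
        (s.word j.castSucc ++ [(i, G')])).setFactor j i D₀ᴴ D₁ᴴ B₀ B₁)
  /-- Pass-through from left to right. -/
  | passRight (s : Conf n k) (j : Fin k) (l : List (ℕ × Core)) (i : ℕ) (G : Core)
      (h : s.word j.castSucc = l ++ [(i, G)])
      (D₁ D₀ W : Core) (hC : flTurnDown rd G (s.C j (i + 1))ᴴ (s.C j i)ᴴ = (D₁, D₀, W))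
      (B₀ B₁ G' : Core) (hB : flTurnUp rd W (s.B j i) (s.B j (i + 1)) = (B₀, B₁, G')) :
      FlStep rd u κ s (((s.setWord j.castSucc l).setWord j.succ
        ((i, G') :: s.word j.succ)).setFactor j i D₀ᴴ D₁ᴴ B₀ B₁)
  /-- The matrix is multiplied on the left by `Gᴴ`. -/
  | mulLeft (s : Conf n k) (i : ℕ) (G : Core) (hi : i + 1 < n) (hG : NearUnitary (κ * u) G) :
      FlStep rd u κ s
        { s.setWord 0 ((i, Gᴴ) :: s.word 0) with U := s.U * coreAt n i G }
  /-- The leftmost core transformation is removed by an equivalence transformation. -/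
  | cancelLeft (s : Conf n k) (r : List (ℕ × Core)) (i : ℕ) (G : Core)
      (h : s.word 0 = (i, G) :: r) :
      FlStep rd u κ s { s.setWord 0 r with U := s.U * coreAt n i G }
  /-- The matrix is multiplied on the right by `G`. -/
  | mulRight (s : Conf n k) (i : ℕ) (G : Core) (hi : i + 1 < n) (hG : NearUnitary (κ * u) G) :
      FlStep rd u κ s
        { s.setWord (Fin.last k) (s.word (Fin.last k) ++ [(i, G)]) with
          V := s.V * coreAt n i G }
  /-- The rightmost core transformation is removed by an equivalence transformation. -/
  | cancelRight (s : Conf n k) (l : List (ℕ × Core)) (i : ℕ) (G : Core)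
      (h : s.word (Fin.last k) = l ++ [(i, G)]) :
      FlStep rd u κ s
        { s.setWord (Fin.last k) l with V := s.V * coreAt n i Gᴴ }

/-- `FlRun rd u κ N s s'`: a computation of `N` operations leads from `s` to `s'`. -/
inductive FlRun {n k : ℕ} (rd : ℝ → ℝ) (u κ : ℝ) : ℕ → Conf n k → Conf n k → Prop
  | refl (s : Conf n k) : FlRun rd u κ 0 s s
  | step {N : ℕ} {s t t' : Conf n k} (h : FlRun rd u κ N s t) (h' : FlStep rd u κ t t') :
      FlRun rd u κ (N + 1) s t'

/-! ### The block companion matrix and its Gaussian factorization -/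

/-- The block companion matrix with identity blocks on the block subdiagonal and last block column
`-M_0, …, -M_{d-1}`. -/
def blockCompanion {d k : ℕ} (M : Fin d → Matrix (Fin k) (Fin k) ℂ) :
    Matrix (Fin (d * k)) (Fin (d * k)) ℂ := fun p q =>
  let p' := finProdFinEquiv.symm p
  let q' := finProdFinEquiv.symm q
  if q'.1.val + 1 = d then -M p'.1 p'.2 q'.2
  else if p'.1.val = q'.1.val + 1 ∧ p'.2 = q'.2 then 1 else 0

/-- The cyclic downshift matrix `𝒬`. -/
def cyclicShift (n : ℕ) : Matrix (Fin n) (Fin n) ℂ := fun p q =>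
  if p.val = (q.val + 1) % n then 1 else 0

/-- `R` is upper triangular and of identity-plus-spike form, with the spike in column `l`
(counted from `0`). -/
def IsSpike {n : ℕ} (l : ℕ) (R : Matrix (Fin n) (Fin n) ℂ) : Prop :=
  R.BlockTriangular id ∧ ∀ p q : Fin n, q.val ≠ l → R p q = (1 : Matrix (Fin n) (Fin n) ℂ) p q

/-- `S = 𝒬^k R_1 ⋯ R_k`, each `R_j` upper triangular of identity-plus-spike form with the spike in
column `n + 1 - j` (columns and `j` counted from `1`). -/
structure IsGaussianFactorization {n k : ℕ} (S : Matrix (Fin n) (Fin n) ℂ)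
    (R : Fin k → Matrix (Fin n) (Fin n) ℂ) : Prop where
  eq_prod : S = cyclicShift n ^ k * (List.ofFn R).prod
  spike : ∀ j : Fin k, IsSpike (n - 1 - j.val) (R j)

/-- The spike of `R`, that is its column `l`, as a sequence. -/
def spikeOf {n : ℕ} (R : Matrix (Fin n) (Fin n) ℂ) (l : ℕ) : ℕ → ℂ := fun p =>
  if h : p < n ∧ l < n then R ⟨p, h.1⟩ ⟨l, h.2⟩ else 0

/-- The stored Gaussian factorization with which the computation starts: `𝒬^k` as `k` descending
sequences of counteridentities, and the computed structured storage of `R_1, …, R_k`. -/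
def initConf {n k : ℕ} (rd : ℝ → ℝ) (R : Fin k → Matrix (Fin n) (Fin n) ℂ) : Conf n k where
  word := fun j =>
    if j = 0 then
      (List.replicate k ((List.range (n - 1)).map fun i => (i, flip2))).flatten
    else []
  C := fun j => initC rd (spikeOf (R j) (n - 1 - j.val)) (n - 1 - j.val)
  B := fun j => initB rd (spikeOf (R j) (n - 1 - j.val)) (n - 1 - j.val)
  U := 1
  V := 1

end CoreChasing

end

/-!
A computation on the factored form is followed by unitary companions: every stored core
transformation `A` has an exactly unitary core transformation `A₀` at distance `O(u)`
(`Shadow`), which is chosen anew whenever an operation computes a new core. Fusions and turnovers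
renormalize what they compute, so the distance from the companions does not grow with the number of
operations, and each operation changes a product of companions by `O(u)` only (`flFuse_spec`,
`flTurnDown_spec`, `flTurnUp_spec`); deflation, which does not renormalize, changes a core only once
(`Shadow.deflate`). Since products of unitary matrices do not amplify errors, these changes add up.

To compare the current factors with the initial ones, the operations that move core transformations
through the product are recorded as gauges. With `R_j` standing between `𝒬_j` and `𝒬_{j+1}`, there
are unitary `T_j`, `L_j`, `W_j` such that, up to the accumulated error,
`𝒬_j' = T_jᴴ 𝒬_j L_j`, `𝒞_j' = W_jᴴ 𝒞_j (L_j ⊕ 1)` and `ℬ_j' = W_jᴴ ℬ_j (T_{j+1} ⊕ 1)`, where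
primes mark the current factors and `W_j` fixes the first unit vector (`Tracks`, `FlRun.tracks`).
The matrix represented by `(𝒞_j', ℬ_j')`, including its implicit rank-one part, is transformed
covariantly (`repMat_gauge`), so the inner gauges cancel in the product and `U = T_0`, `V = L_k`
remain (`Tracks.exists_value_eq`). The represented product is therefore `Uᴴ P V`, where `P` is a
product of factors whose *stored* data are perturbations of size `ε = O(u)` of the exact initial
data.

It remains to see that `P` differs from `S` by `O(‖S‖² u)` only. The representation divides by
`ρ`, whose modulus is `1 / α` with `α` at most `‖x‖ + 1` for the spike `x`, hence bounds of the
single factors would give higher powers of `‖S‖`. But the perturbation of a factor with spike `x`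
in column `l` is structured (`IsPerturbedSpike`, `repMat_isPerturbedSpike`): it is
`E + g e_lᵀ + x f + t x e_lᵀ` with `E`, `f` of size `ε` and `g`, `t` of size `‖S‖ ε`. Spikes lie in
the columns `n - 1, n - 2, …` and vanish below their own column, so the factors to the left of a
factor fix its spike `x`, and row `l` of the product of the factors to its right is `e_lᵀ`, up to
perturbations (`norm_perturbed_prod_sub_le`). Thus a part that starts with `x` is not amplified from
the left, a part that ends with `e_lᵀ` is not amplified from the right, and each of the four parts
contributes `O(‖S‖² ε)`. For the same reason all spikes are columns of the product of the triangular
factors (`prefixProd_mul_unitCol`) and so have norm at most `‖S‖`.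
-/

namespace CoreChasing

/-! ### The Frobenius norm -/

section Frobenius

variable {l m n : Type*} [Fintype l] [Fintype m] [Fintype n]

theorem frobenius_sq (A : Matrix m n ℂ) : ‖A‖ ^ 2 = ∑ i, ∑ j, ‖A i j‖ ^ 2 := by
  rw [Matrix.frobenius_norm_def, ← Real.sqrt_eq_rpow, Real.sq_sqrt (by positivity)]
  simp

theorem norm_entry_le (A : Matrix m n ℂ) (i : m) (j : n) : ‖A i j‖ ≤ ‖A‖ := by
  refine le_of_sq_le_sq ?_ (norm_nonneg _)
  rw [frobenius_sq]
  calc ‖A i j‖ ^ 2 ≤ ∑ j, ‖A i j‖ ^ 2 :=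
        Finset.single_le_sum (f := fun j => ‖A i j‖ ^ 2) (fun _ _ => by positivity)
          (Finset.mem_univ j)
    _ ≤ _ := Finset.single_le_sum (f := fun i => ∑ j, ‖A i j‖ ^ 2) (fun _ _ => by positivity)
          (Finset.mem_univ i)

theorem norm_le_sum_entries (A : Matrix m n ℂ) : ‖A‖ ≤ ∑ i, ∑ j, ‖A i j‖ := by
  refine le_of_sq_le_sq ?_ (by positivity)
  rw [frobenius_sq, ← Finset.sum_product', ← Finset.sum_product']
  exact Finset.sum_sq_le_sq_sum_of_nonneg fun _ _ => norm_nonneg _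

theorem norm_le_of_entries {a b : ℕ} (A : Matrix (Fin a) (Fin b) ℂ) {e : ℝ}
    (h : ∀ i j, ‖A i j‖ ≤ e) : ‖A‖ ≤ a * b * e := by
  refine (norm_le_sum_entries A).trans ?_
  calc ∑ i, ∑ j, ‖A i j‖ ≤ ∑ _i : Fin a, ∑ _j : Fin b, e :=
        Finset.sum_le_sum fun i _ => Finset.sum_le_sum fun j _ => h i j
    _ = a * b * e := by simp [mul_assoc]

theorem norm_entry_sub_le (A B : Matrix m n ℂ) (i : m) (j : n) : ‖A i j - B i j‖ ≤ ‖A - B‖ :=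
  norm_entry_le (A - B) i j

theorem frobenius_sq_eq_trace (A : Matrix m n ℂ) : ((‖A‖ ^ 2 : ℝ) : ℂ) = (Aᴴ * A).trace := by
  rw [frobenius_sq, Finset.sum_comm]
  simp [Matrix.trace, Matrix.mul_apply, Complex.conj_mul']

theorem norm_isometry_mul [DecidableEq m] {Q : Matrix l m ℂ} (hQ : Qᴴ * Q = 1)
    (A : Matrix m n ℂ) : ‖Q * A‖ = ‖A‖ := by
  have h : ‖Q * A‖ ^ 2 = ‖A‖ ^ 2 := by
    have : ((‖Q * A‖ ^ 2 : ℝ) : ℂ) = ((‖A‖ ^ 2 : ℝ) : ℂ) := by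
      rw [frobenius_sq_eq_trace, frobenius_sq_eq_trace, Matrix.conjTranspose_mul, Matrix.mul_assoc,
        ← Matrix.mul_assoc Qᴴ, hQ, Matrix.one_mul]
    exact_mod_cast this
  exact (sq_eq_sq₀ (norm_nonneg _) (norm_nonneg _)).1 h

theorem norm_mul_coisometry [DecidableEq n] {Q : Matrix n l ℂ} (hQ : Q * Qᴴ = 1)
    (A : Matrix m n ℂ) : ‖A * Q‖ = ‖A‖ := by
  rw [← Matrix.frobenius_norm_conjTranspose (A * Q), Matrix.conjTranspose_mul,
    norm_isometry_mul (by simpa using hQ), Matrix.frobenius_norm_conjTranspose]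

theorem norm_unitary_mul [DecidableEq m] {Q : Matrix m m ℂ} (hQ : Q ∈ Matrix.unitaryGroup m ℂ)
    (A : Matrix m n ℂ) : ‖Q * A‖ = ‖A‖ :=
  norm_isometry_mul (Matrix.mem_unitaryGroup_iff'.1 hQ) A

theorem norm_mul_unitary [DecidableEq n] {Q : Matrix n n ℂ} (hQ : Q ∈ Matrix.unitaryGroup n ℂ)
    (A : Matrix m n ℂ) : ‖A * Q‖ = ‖A‖ :=
  norm_mul_coisometry (Matrix.mem_unitaryGroup_iff.1 hQ) A

theorem conjTranspose_mem_unitary [DecidableEq m] {Q : Matrix m m ℂ}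
    (hQ : Q ∈ Matrix.unitaryGroup m ℂ) : Qᴴ ∈ Matrix.unitaryGroup m ℂ :=
  Unitary.star_mem hQ

theorem norm_conjTranspose_sub (A B : Matrix m n ℂ) : ‖Aᴴ - Bᴴ‖ = ‖A - B‖ := by
  rw [← Matrix.conjTranspose_sub, Matrix.frobenius_norm_conjTranspose]

theorem norm_entry_le_one [DecidableEq m] {Q : Matrix m m ℂ} (hQ : Q ∈ Matrix.unitaryGroup m ℂ)
    (i j : m) : ‖Q i j‖ ≤ 1 := entry_norm_bound_of_unitary hQ i j

theorem unitary_col_sum [DecidableEq m] {Q : Matrix m m ℂ} (hQ : Q ∈ Matrix.unitaryGroup m ℂ)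
    (j : m) : ∑ i, ‖Q i j‖ ^ 2 = 1 := by
  have h := congrFun (congrFun (Matrix.mem_unitaryGroup_iff'.1 hQ) j) j
  rw [Matrix.star_eq_conjTranspose, Matrix.mul_apply, Matrix.one_apply_eq] at h
  simp only [Matrix.conjTranspose_apply, RCLike.star_def, Complex.conj_mul'] at h
  exact_mod_cast h

theorem unitary_row_sum [DecidableEq m] {Q : Matrix m m ℂ} (hQ : Q ∈ Matrix.unitaryGroup m ℂ)
    (i : m) : ∑ j, ‖Q i j‖ ^ 2 = 1 := by
  have := unitary_col_sum (conjTranspose_mem_unitary hQ) i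
  simpa using this

end Frobenius

/-! ### Elementary floating point operations -/

section Scalar

variable {u : ℝ} {rd : ℝ → ℝ}

theorem isRounding_id : IsRounding 0 id := fun x => by simp

/-- Two roundings in a row, in the form in which relative errors are propagated below. -/
theorem IsRounding.abs_rd_sub_le (h : IsRounding u rd) (hu : 0 ≤ u) {x y e : ℝ}
    (hx : |x - y| ≤ e) : |rd x - y| ≤ u * |y| + (1 + u) * e := by
  have h1 := h x
  have h2 : |x| ≤ |y| + e := by
    have := abs_sub_abs_le_abs_sub x y
    linarith
  have h3 : |rd x - y| ≤ |rd x - x| + |x - y| := abs_sub_le _ _ _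
  nlinarith [mul_le_mul_of_nonneg_left h2 hu]

theorem norm_flAdd_sub_le (h : IsRounding u rd) (hu : 0 ≤ u) (z w : ℂ) :
    ‖flAdd rd z w - (z + w)‖ ≤ 2 * u * ‖z + w‖ := by
  refine (Complex.norm_le_abs_re_add_abs_im _).trans ?_
  have h1 := h (z.re + w.re)
  have h2 := h (z.im + w.im)
  have h3 := Complex.abs_re_le_norm (z + w)
  have h4 := Complex.abs_im_le_norm (z + w)
  simp only [flAdd, Complex.sub_re, Complex.sub_im, Complex.add_re, Complex.add_im] at *
  nlinarith [mul_le_mul_of_nonneg_left h3 hu, mul_le_mul_of_nonneg_left h4 hu]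

theorem abs_mul_add_abs_mul_le (z w : ℂ) :
    |z.re * w.re| + |z.im * w.im| ≤ ‖z‖ * ‖w‖ ∧ |z.re * w.im| + |z.im * w.re| ≤ ‖z‖ * ‖w‖ := by
  have hz : ‖z‖ ^ 2 = |z.re| ^ 2 + |z.im| ^ 2 := by
    rw [Complex.sq_norm, Complex.normSq_apply, sq_abs, sq_abs]; ring
  have hw : ‖w‖ ^ 2 = |w.re| ^ 2 + |w.im| ^ 2 := by
    rw [Complex.sq_norm, Complex.normSq_apply, sq_abs, sq_abs]; ring
  simp only [abs_mul]
  constructor <;> refine le_of_sq_le_sq ?_ (by positivity) <;> rw [mul_pow, hz, hw]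
  · nlinarith [sq_nonneg (|z.re| * |w.im| - |z.im| * |w.re|)]
  · nlinarith [sq_nonneg (|z.re| * |w.re| - |z.im| * |w.im|)]

theorem norm_flMul_sub_le (h : IsRounding u rd) (hu : 0 ≤ u) (hu1 : u ≤ 1) (z w : ℂ) :
    ‖flMul rd z w - z * w‖ ≤ 6 * u * (‖z‖ * ‖w‖) := by
  refine (Complex.norm_le_abs_re_add_abs_im _).trans ?_
  obtain ⟨h1, h2⟩ := abs_mul_add_abs_mul_le z w
  have key : ∀ a b : ℝ, ∀ s : ℝ, |s| = 1 →
      |rd (rd a + s * rd b) - (a + s * b)| ≤ 3 * u * (|a| + |b|) := by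
    intro a b s hs
    have e : |(rd a + s * rd b) - (a + s * b)| ≤ u * (|a| + |b|) := by
      have : (rd a + s * rd b) - (a + s * b) = (rd a - a) + s * (rd b - b) := by ring
      rw [this]
      refine (abs_add_le _ _).trans ?_
      rw [abs_mul, hs, one_mul]
      linarith [h a, h b]
    have e2 := h.abs_rd_sub_le hu e
    have e3 : |a + s * b| ≤ |a| + |b| := by
      refine (abs_add_le _ _).trans ?_
      rw [abs_mul, hs, one_mul]
    have : 0 ≤ |a| + |b| := by positivity
    nlinarith [mul_le_mul_of_nonneg_left e3 hu, mul_nonneg hu this,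
      mul_nonneg (mul_nonneg hu (sub_nonneg.2 hu1)) this]
  have k1 := key (z.re * w.re) (z.im * w.im) (-1) (by simp)
  have k2 := key (z.re * w.im) (z.im * w.re) 1 (by simp)
  simp only [neg_mul, one_mul, ← sub_eq_add_neg] at k1 k2
  simp only [flMul, Complex.sub_re, Complex.sub_im, Complex.mul_re, Complex.mul_im]
  nlinarith [mul_le_mul_of_nonneg_left h1 hu, mul_le_mul_of_nonneg_left h2 hu]

theorem norm_flDivReal_sub_le (h : IsRounding u rd) (hu : 0 ≤ u) (z : ℂ) (r : ℝ) :
    ‖flDivReal rd z r - z / r‖ ≤ 2 * u * ‖z / r‖ := by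
  refine (Complex.norm_le_abs_re_add_abs_im _).trans ?_
  have h1 := h (z.re / r)
  have h2 := h (z.im / r)
  have h3 := Complex.abs_re_le_norm (z / r)
  have h4 := Complex.abs_im_le_norm (z / r)
  simp only [flDivReal, Complex.sub_re, Complex.sub_im, Complex.div_ofReal_re,
    Complex.div_ofReal_im] at *
  nlinarith [mul_le_mul_of_nonneg_left h3 hu, mul_le_mul_of_nonneg_left h4 hu]

theorem flNormSq_nonneg_and_le (h : IsRounding u rd) (hu : 0 ≤ u) (hu1 : u ≤ 1) (z : ℂ) :
    |flNormSq rd z - ‖z‖ ^ 2| ≤ 3 * u * ‖z‖ ^ 2 := by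
  have hz : ‖z‖ ^ 2 = z.re * z.re + z.im * z.im := by
    rw [Complex.sq_norm, Complex.normSq_apply]
  have e : |(rd (z.re * z.re) + rd (z.im * z.im)) - ‖z‖ ^ 2| ≤ u * ‖z‖ ^ 2 := by
    rw [hz]
    have : (rd (z.re * z.re) + rd (z.im * z.im)) - (z.re * z.re + z.im * z.im)
      = (rd (z.re * z.re) - z.re * z.re) + (rd (z.im * z.im) - z.im * z.im) := by ring
    rw [this]
    refine (abs_add_le _ _).trans ?_
    have h1 := h (z.re * z.re)
    have h2 := h (z.im * z.im)
    rw [abs_of_nonneg (mul_self_nonneg z.re)] at h1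
    rw [abs_of_nonneg (mul_self_nonneg z.im)] at h2
    linarith
  have e2 := h.abs_rd_sub_le hu e
  rw [abs_of_nonneg (sq_nonneg ‖z‖)] at e2
  unfold flNormSq
  have : 0 ≤ ‖z‖ ^ 2 := by positivity
  nlinarith [mul_nonneg hu this, mul_nonneg (mul_nonneg hu (sub_nonneg.2 hu1)) this]

/-- The exact length `√(|a|² + |b|²)`. -/
noncomputable def hypot (a b : ℂ) : ℝ := Real.sqrt (‖a‖ ^ 2 + ‖b‖ ^ 2)

theorem hypot_nonneg (a b : ℂ) : 0 ≤ hypot a b := Real.sqrt_nonneg _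

theorem hypot_sq (a b : ℂ) : hypot a b ^ 2 = ‖a‖ ^ 2 + ‖b‖ ^ 2 := Real.sq_sqrt (by positivity)

theorem norm_le_hypot_left (a b : ℂ) : ‖a‖ ≤ hypot a b :=
  Real.le_sqrt_of_sq_le (by nlinarith [sq_nonneg ‖b‖])

theorem norm_le_hypot_right (a b : ℂ) : ‖b‖ ≤ hypot a b :=
  Real.le_sqrt_of_sq_le (by nlinarith [sq_nonneg ‖a‖])

theorem hypot_eq_zero {a b : ℂ} : hypot a b = 0 ↔ a = 0 ∧ b = 0 := by
  constructor
  · intro h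
    have h1 := norm_le_hypot_left a b
    have h2 := norm_le_hypot_right a b
    rw [h] at h1 h2
    exact ⟨norm_le_zero_iff.1 h1, norm_le_zero_iff.1 h2⟩
  · rintro ⟨rfl, rfl⟩
    simp [hypot]

/-- `hypot` is a norm, hence Lipschitz in its second argument. -/
theorem abs_hypot_sub_le (a b b' : ℂ) : |hypot a b' - hypot a b| ≤ ‖b' - b‖ := by
  have key : ∀ b b' : ℂ, hypot a b' ≤ hypot a b + ‖b' - b‖ := by
    intro b b'
    refine Real.sqrt_le_iff.2 ⟨by positivity [hypot_nonneg a b], ?_⟩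
    have h1 : ‖b'‖ ≤ ‖b‖ + ‖b' - b‖ := by simpa using norm_add_le b (b' - b)
    have h2 := norm_le_hypot_right a b
    nlinarith [hypot_sq a b, norm_nonneg b, norm_nonneg (b' - b), norm_nonneg b']
  rw [abs_le]
  have := key b' b
  rw [norm_sub_rev] at this
  constructor <;> linarith [key b b']

theorem abs_flHypot_sub_le (h : IsRounding u rd) (hu : 0 ≤ u) (hu1 : u ≤ 1 / 1000) (a b : ℂ) :
    |flHypot rd a b - hypot a b| ≤ 10 * u * hypot a b := by
  have ha := flNormSq_nonneg_and_le h hu (by linarith) a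
  have hb := flNormSq_nonneg_and_le h hu (by linarith) b
  set s := ‖a‖ ^ 2 + ‖b‖ ^ 2 with hs
  have hs0 : 0 ≤ s := by positivity
  have e : |(flNormSq rd a + flNormSq rd b) - s| ≤ 3 * u * s := by
    have : (flNormSq rd a + flNormSq rd b) - s
      = (flNormSq rd a - ‖a‖ ^ 2) + (flNormSq rd b - ‖b‖ ^ 2) := by rw [hs]; ring
    rw [this]
    refine (abs_add_le _ _).trans ?_
    rw [hs]; linarith
  have e2 := h.abs_rd_sub_le hu e
  rw [abs_of_nonneg hs0] at e2
  set t := rd (flNormSq rd a + flNormSq rd b) with ht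
  have e3 : |t - s| ≤ 5 * u * s := by nlinarith [mul_nonneg hu hs0]
  have hq : hypot a b = Real.sqrt s := rfl
  have ht0 : 0 ≤ t := by
    have := (abs_le.1 e3).1
    nlinarith
  have e4 : |Real.sqrt t - hypot a b| ≤ 5 * u * hypot a b := by
    rw [hq]
    have h1 : (Real.sqrt t - Real.sqrt s) * (Real.sqrt t + Real.sqrt s) = t - s := by
      have := Real.sq_sqrt ht0
      have := Real.sq_sqrt hs0
      nlinarith
    rcases hs0.eq_or_lt with h0 | h0
    · rw [← h0] at e3 ⊢
      have : t = 0 := by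
        have := abs_le.1 e3
        linarith
      simp [this]
    · have hp : 0 < Real.sqrt s := Real.sqrt_pos.2 h0
      have hp' := Real.sqrt_nonneg t
      have h2 : |Real.sqrt t - Real.sqrt s| * (Real.sqrt t + Real.sqrt s) = |t - s| := by
        rw [← h1, abs_mul, abs_of_pos (by linarith : 0 < Real.sqrt t + Real.sqrt s)]
      have h3 : |Real.sqrt t - Real.sqrt s| * Real.sqrt s ≤ 5 * u * Real.sqrt s * Real.sqrt s := by
        have : |Real.sqrt t - Real.sqrt s| * Real.sqrt s
            ≤ |Real.sqrt t - Real.sqrt s| * (Real.sqrt t + Real.sqrt s) := by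
          gcongr; linarith
        have := Real.mul_self_sqrt hs0
        nlinarith
      exact le_of_mul_le_mul_right h3 hp
  have e5 := h.abs_rd_sub_le hu e4
  rw [abs_of_nonneg (hypot_nonneg a b)] at e5
  unfold flHypot
  rw [← ht]
  nlinarith [mul_nonneg hu (hypot_nonneg a b)]

theorem flHypot_eq_zero (h : IsRounding u rd) (hu : 0 ≤ u) (hu1 : u ≤ 1 / 1000) {a b : ℂ} :
    flHypot rd a b = 0 ↔ hypot a b = 0 := by
  have h1 := abs_flHypot_sub_le h hu hu1 a b
  have h0 := hypot_nonneg a b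
  constructor <;> intro h2
  · rw [h2, zero_sub, abs_neg, abs_of_nonneg h0] at h1
    nlinarith
  · rw [h2] at h1
    simpa using h1

theorem flHypot_id (a b : ℂ) : flHypot id a b = hypot a b := by
  have := abs_flHypot_sub_le isRounding_id le_rfl (by norm_num) a b
  simpa [sub_eq_zero] using this

/-- A computed quotient `a / r`, where `r` has the relative error `e` with respect to the exact
denominator `t ≥ |a|`. -/
theorem norm_flDivReal_sub_div_le (h : IsRounding u rd) (hu : 0 ≤ u) {a : ℂ} {r t e : ℝ}
    (ht : 0 < t) (hat : ‖a‖ ≤ t) (hr : |r - t| ≤ e * t) (he : e ≤ 1 / 10) :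
    ‖flDivReal rd a r - a / t‖ ≤ 3 * u + 2 * e := by
  have hr' := abs_le.1 hr
  have hr0 : 0 < r := by nlinarith
  have he0 : 0 ≤ e := by
    have := (abs_nonneg _).trans hr
    by_contra hc
    nlinarith
  have h1 := norm_flDivReal_sub_le h hu a r
  have h2 : ‖a / (r : ℂ)‖ ≤ 10 / 9 := by
    rw [norm_div, Complex.norm_real, Real.norm_eq_abs, abs_of_pos hr0, div_le_iff₀ hr0]
    nlinarith
  have h3 : ‖a / (r : ℂ) - a / t‖ ≤ 2 * e := by
    have hrc : (r : ℂ) ≠ 0 := by exact_mod_cast hr0.ne'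
    have htc : (t : ℂ) ≠ 0 := by exact_mod_cast ht.ne'
    have : a / (r : ℂ) - a / t = (a / r) * (((t - r : ℝ) : ℂ) / t) := by
      push_cast; field_simp
    rw [this, norm_mul]
    have h4 : ‖(((t - r : ℝ) : ℂ) / t)‖ ≤ e := by
      rw [norm_div, Complex.norm_real, Complex.norm_real, Real.norm_eq_abs, Real.norm_eq_abs,
        abs_of_pos ht, div_le_iff₀ ht, abs_sub_comm]
      exact hr
    nlinarith [mul_le_mul h2 h4 (norm_nonneg _) (by norm_num)]
  have h5 : flDivReal rd a r - a / t = (flDivReal rd a r - a / r) + (a / r - a / t) := by ring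
  rw [h5]
  refine (norm_add_le _ _).trans ?_
  nlinarith [mul_le_mul_of_nonneg_left h2 hu]

end Scalar

/-! ### Diagonal blocks -/

/-- The `n × m` matrix whose columns are the unit vectors `e_i, …, e_{i+m-1}`. -/
def incl (n i m : ℕ) : Matrix (Fin n) (Fin m) ℂ := fun p q => if p.val = i + q.val then 1 else 0

/-- The identity matrix of size `n` with the block `X` inserted on the diagonal, starting in
row `i`. -/
def blockAt (n i : ℕ) {m : ℕ} (X : Matrix (Fin m) (Fin m) ℂ) : Matrix (Fin n) (Fin n) ℂ :=
  1 + incl n i m * (X - 1) * (incl n i m)ᴴ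

section Block

variable {n i m : ℕ}

theorem mul_incl_apply {a : Type*} (h : i + m ≤ n) (Z : Matrix a (Fin n) ℂ) (p : a) (q : Fin m) :
    (Z * incl n i m) p q = Z p ⟨i + q, by omega⟩ := by
  rw [Matrix.mul_apply, Finset.sum_eq_single ⟨i + q, by omega⟩]
  · simp [incl]
  · intro b _ hb
    have : b.val ≠ i + q.val := fun hc => hb (Fin.ext hc)
    simp [incl, this]
  · simp

theorem incl_conj_mul_apply {a : Type*} (h : i + m ≤ n) (Z : Matrix (Fin n) a ℂ) (p : Fin m)
    (q : a) : ((incl n i m)ᴴ * Z) p q = Z ⟨i + p, by omega⟩ q := by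
  have := mul_incl_apply h Zᴴ q p
  have h2 : ((incl n i m)ᴴ * Z) p q = star ((Zᴴ * incl n i m) q p) := by
    rw [← Matrix.conjTranspose_apply, Matrix.conjTranspose_mul, Matrix.conjTranspose_conjTranspose]
  rw [h2, this]
  simp

theorem incl_conj_mul_incl (h : i + m ≤ n) : (incl n i m)ᴴ * incl n i m = 1 := by
  ext p q
  rw [incl_conj_mul_apply h, incl, Matrix.one_apply]
  simp [Fin.ext_iff]

theorem incl_conj_mul_incl_of_disjoint {j m' : ℕ} (h : i + m ≤ j ∨ j + m' ≤ i) :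
    (incl n i m)ᴴ * incl n j m' = 0 := by
  ext p q
  rw [Matrix.mul_apply]
  refine Finset.sum_eq_zero fun r _ => ?_
  simp only [Matrix.conjTranspose_apply, incl]
  split_ifs <;> simp
  omega

theorem incl_mul_incl {a b c d : ℕ} (h : c + d ≤ b) :
    incl n a b * incl b c d = incl n (a + c) d := by
  ext p q
  rw [mul_incl_apply h]
  simp [incl, add_assoc]

theorem blockAt_one : blockAt n i (1 : Matrix (Fin m) (Fin m) ℂ) = 1 := by simp [blockAt]

theorem blockAt_mul (h : i + m ≤ n) (X Y : Matrix (Fin m) (Fin m) ℂ) :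
    blockAt n i X * blockAt n i Y = blockAt n i (X * Y) := by
  have hE := incl_conj_mul_incl h
  unfold blockAt
  set E := incl n i m
  have : E * (X - 1) * Eᴴ * (E * (Y - 1) * Eᴴ) = E * ((X - 1) * (Y - 1)) * Eᴴ := by
    calc _ = E * (X - 1) * (Eᴴ * E) * (Y - 1) * Eᴴ := by simp only [Matrix.mul_assoc]
      _ = _ := by rw [hE]; simp only [Matrix.mul_assoc, Matrix.one_mul]
  rw [add_mul, mul_add, mul_add, this, one_mul, mul_one, one_mul]
  have h2 : X * Y - 1 = (X - 1) + (Y - 1) + (X - 1) * (Y - 1) := by noncomm_ring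
  rw [h2, Matrix.mul_add, Matrix.mul_add, Matrix.add_mul, Matrix.add_mul]
  abel

theorem blockAt_conjTranspose (X : Matrix (Fin m) (Fin m) ℂ) :
    (blockAt n i X)ᴴ = blockAt n i Xᴴ := by
  simp [blockAt, Matrix.mul_assoc]

theorem blockAt_unitary (h : i + m ≤ n) {X : Matrix (Fin m) (Fin m) ℂ}
    (hX : X ∈ Matrix.unitaryGroup (Fin m) ℂ) : blockAt n i X ∈ Matrix.unitaryGroup (Fin n) ℂ := by
  rw [Matrix.mem_unitaryGroup_iff, Matrix.star_eq_conjTranspose, blockAt_conjTranspose,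
    blockAt_mul h, ← Matrix.star_eq_conjTranspose, Matrix.mem_unitaryGroup_iff.1 hX, blockAt_one]

theorem norm_blockAt_sub (h : i + m ≤ n) (X Y : Matrix (Fin m) (Fin m) ℂ) :
    ‖blockAt n i X - blockAt n i Y‖ = ‖X - Y‖ := by
  have h1 : blockAt n i X - blockAt n i Y = incl n i m * (X - Y) * (incl n i m)ᴴ := by
    have : X - Y = (X - 1) - (Y - 1) := by abel
    rw [this, Matrix.mul_sub, Matrix.sub_mul, blockAt, blockAt]
    abel
  rw [h1, norm_mul_coisometry (by simpa using incl_conj_mul_incl h),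
    norm_isometry_mul (incl_conj_mul_incl h)]

theorem blockAt_blockAt {a b c d : ℕ} (h : c + d ≤ b) (X : Matrix (Fin d) (Fin d) ℂ) :
    blockAt n a (blockAt b c X) = blockAt n (a + c) X := by
  unfold blockAt
  rw [add_sub_cancel_left, ← incl_mul_incl h, Matrix.conjTranspose_mul]
  simp only [Matrix.mul_assoc]

theorem blockAt_mul_incl (h : i + m ≤ n) (X : Matrix (Fin m) (Fin m) ℂ) :
    blockAt n i X * incl n i m = incl n i m * X := by
  rw [blockAt, Matrix.add_mul, Matrix.one_mul, Matrix.mul_assoc, incl_conj_mul_incl h,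
    Matrix.mul_one, Matrix.mul_sub, Matrix.mul_one]
  abel

theorem blockAt_mul_incl_of_disjoint {j m' : ℕ} (h : i + m ≤ j ∨ j + m' ≤ i)
    (X : Matrix (Fin m) (Fin m) ℂ) : blockAt n i X * incl n j m' = incl n j m' := by
  rw [blockAt, Matrix.add_mul, Matrix.one_mul, Matrix.mul_assoc, incl_conj_mul_incl_of_disjoint h,
    Matrix.mul_zero, add_zero]

theorem blockAt_commute {j m' : ℕ} (h : i + m ≤ j ∨ j + m' ≤ i) (X : Matrix (Fin m) (Fin m) ℂ)
    (Y : Matrix (Fin m') (Fin m') ℂ) : Commute (blockAt n i X) (blockAt n j Y) := by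
  have h1 := incl_conj_mul_incl_of_disjoint (n := n) h
  have h2 := incl_conj_mul_incl_of_disjoint (n := n) h.symm
  refine Commute.add_left (Commute.one_left _) (Commute.add_right (Commute.one_right _) ?_)
  have key : ∀ {a b : ℕ} (E : Matrix (Fin n) (Fin a) ℂ) (F : Matrix (Fin n) (Fin b) ℂ)
      (A : Matrix (Fin a) (Fin a) ℂ) (B : Matrix (Fin b) (Fin b) ℂ),
      Eᴴ * F = 0 → E * A * Eᴴ * (F * B * Fᴴ) = 0 := by
    intro a b E F A B h
    rw [Matrix.mul_assoc (E * A), Matrix.mul_assoc F, ← Matrix.mul_assoc Eᴴ, h]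
    simp
  exact (key _ _ _ _ h1).trans (key _ _ _ _ h2).symm

theorem coreAt_eq_blockAt (A : Core) : coreAt n i A = blockAt n i A := by
  ext p q
  simp only [coreAt, blockAt, incl, Matrix.add_apply, Matrix.mul_apply, Fin.sum_univ_two,
    Matrix.sub_apply, Matrix.conjTranspose_apply, Matrix.one_apply, Fin.ext_iff]
  by_cases h1 : p.val = i <;> by_cases h2 : p.val = i + 1 <;> by_cases h3 : q.val = i <;>
    by_cases h4 : q.val = i + 1 <;> simp [h1, h2, h3, h4]

theorem coreAt_mul (h : i + 1 < n) (A B : Core) :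
    coreAt n i A * coreAt n i B = coreAt n i (A * B) := by
  simp only [coreAt_eq_blockAt]
  exact blockAt_mul (by omega) A B

theorem coreAt_conjTranspose (A : Core) : (coreAt n i A)ᴴ = coreAt n i Aᴴ := by
  simp only [coreAt_eq_blockAt]
  exact blockAt_conjTranspose A

theorem coreAt_unitary (h : i + 1 < n) {A : Core} (hA : A ∈ Matrix.unitaryGroup (Fin 2) ℂ) :
    coreAt n i A ∈ Matrix.unitaryGroup (Fin n) ℂ := by
  rw [coreAt_eq_blockAt]
  exact blockAt_unitary (by omega) hA

theorem norm_coreAt_sub (h : i + 1 < n) (A B : Core) :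
    ‖coreAt n i A - coreAt n i B‖ = ‖A - B‖ := by
  simp only [coreAt_eq_blockAt]
  exact norm_blockAt_sub (by omega) A B

theorem coreAt_commute {j : ℕ} (h : i + 1 < j ∨ j + 1 < i) (A B : Core) :
    Commute (coreAt n i A) (coreAt n j B) := by
  simp only [coreAt_eq_blockAt]
  exact blockAt_commute (by omega) A B

theorem coreAt_eq_blockAt_three_zero (A : Core) :
    coreAt n i A = blockAt n i (coreAt 3 0 A) := by
  rw [coreAt_eq_blockAt, coreAt_eq_blockAt, blockAt_blockAt (by norm_num), add_zero]

theorem coreAt_eq_blockAt_three_one (A : Core) :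
    coreAt n (i + 1) A = blockAt n i (coreAt 3 1 A) := by
  rw [coreAt_eq_blockAt, coreAt_eq_blockAt, blockAt_blockAt (by norm_num)]

/-- The error of a turnover is that of its `3 × 3` version. -/
theorem norm_turn_down_eq (h : i + 2 < n) (A B D F G H : Core) :
    ‖coreAt n (i + 1) F * coreAt n i G * coreAt n (i + 1) H
        - coreAt n i A * coreAt n (i + 1) B * coreAt n i D‖
      = ‖coreAt 3 1 F * coreAt 3 0 G * coreAt 3 1 H
        - coreAt 3 0 A * coreAt 3 1 B * coreAt 3 0 D‖ := by
  simp only [coreAt_eq_blockAt_three_zero (n := n) (i := i),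
    coreAt_eq_blockAt_three_one (n := n) (i := i)]
  rw [blockAt_mul (by omega), blockAt_mul (by omega), blockAt_mul (by omega),
    blockAt_mul (by omega), norm_blockAt_sub (by omega)]

theorem norm_turn_up_eq (h : i + 2 < n) (A B D F G H : Core) :
    ‖coreAt n i F * coreAt n (i + 1) G * coreAt n i H
        - coreAt n (i + 1) A * coreAt n i B * coreAt n (i + 1) D‖
      = ‖coreAt 3 0 F * coreAt 3 1 G * coreAt 3 0 H
        - coreAt 3 1 A * coreAt 3 0 B * coreAt 3 1 D‖ := by
  rw [norm_sub_rev, norm_turn_down_eq h, norm_sub_rev]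

end Block

/-! ### The stored form of a triangular factor -/

theorem descending_split {n i : ℕ} (h : i + 1 < n) (C : ℕ → Core) :
    descending n C =
      ((List.range i).map fun p => coreAt (n + 1) p (C p)).prod *
        (coreAt (n + 1) i (C i) * coreAt (n + 1) (i + 1) (C (i + 1))) *
        ((List.range' (i + 2) (n - i - 2)).map fun p => coreAt (n + 1) p (C p)).prod := by
  have h1 : List.range n = List.range i ++ (i :: (i + 1) :: List.range' (i + 2) (n - i - 2)) := by
    have : n = i + ((n - i - 2) + 1 + 1) := by omega
    conv_lhs => rw [this, List.range_eq_range', ← List.range'_append_1, ← List.range_eq_range',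
      zero_add, List.range'_succ, List.range'_succ]
  rw [descending, h1]
  simp [mul_assoc]

theorem listProd_unitary {n : ℕ} {l : List (Matrix (Fin n) (Fin n) ℂ)}
    (h : ∀ A ∈ l, A ∈ Matrix.unitaryGroup (Fin n) ℂ) :
    l.prod ∈ Matrix.unitaryGroup (Fin n) ℂ := Submonoid.list_prod_mem _ h

theorem descending_unitary {n : ℕ} {C : ℕ → Core}
    (hC : ∀ i, C i ∈ Matrix.unitaryGroup (Fin 2) ℂ) :
    descending n C ∈ Matrix.unitaryGroup (Fin (n + 1)) ℂ := by
  refine listProd_unitary fun A hA => ?_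
  obtain ⟨i, hi, rfl⟩ := List.mem_map.1 hA
  exact coreAt_unitary (by simpa using hi) (hC i)

/-- The matrix `Pᵀ (Z + c yᵀ) P`, `Z = 𝒞ᴴ ℬ`, `c = 𝒞ᴴ e₁`, as a function of the matrices
`Cs = 𝒞ᴴ` and `B = ℬ`. -/
noncomputable def repMat (n : ℕ) (Cs B : Matrix (Fin (n + 1)) (Fin (n + 1)) ℂ) :
    Matrix (Fin n) (Fin n) ℂ :=
  (incl (n + 1) 0 n)ᴴ * (Cs * B) * incl (n + 1) 0 n +
    (-(((incl (n + 1) n 1)ᴴ * (Cs * incl (n + 1) 0 1)) 0 0)⁻¹) •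
      (((incl (n + 1) 0 n)ᴴ * (Cs * incl (n + 1) 0 1)) *
        ((incl (n + 1) n 1)ᴴ * (Cs * B) * incl (n + 1) 0 n))

theorem mul_apply_fin_one {a b : Type*} (X : Matrix a (Fin 1) ℂ) (Y : Matrix (Fin 1) b ℂ) (p : a)
    (q : b) : (X * Y) p q = X p 0 * Y 0 q := by simp [Matrix.mul_apply]

theorem represented_eq_repMat (n : ℕ) (C B : ℕ → Core) :
    represented n C B = repMat n (descending n C)ᴴ (descending n B) := by
  ext p q
  simp only [represented, repMat, Matrix.add_apply, Matrix.smul_apply, smul_eq_mul]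
  rw [mul_incl_apply (by omega), incl_conj_mul_apply (by omega), incl_conj_mul_apply (by omega),
    mul_incl_apply (by omega), mul_apply_fin_one, incl_conj_mul_apply (by omega),
    mul_incl_apply (by omega), mul_incl_apply (by omega), incl_conj_mul_apply (by omega)]
  have h1 : ∀ r : Fin n, (⟨0 + r.val, by omega⟩ : Fin (n + 1)) = r.castSucc :=
    fun r => Fin.ext (by simp)
  have h2 : (⟨n + (0 : Fin 1).val, by simp⟩ : Fin (n + 1)) = Fin.last n := Fin.ext (by simp)
  have h3 : (⟨0 + (0 : Fin 1).val, by simp⟩ : Fin (n + 1)) = 0 := Fin.ext (by simp)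
  rw [h1, h1, h2, h3]
  ring

/-- The represented matrix depends on the stored matrices only up to the transformations that a
pass-through performs: a transformation `W` between `𝒞ᴴ` and `ℬ` that fixes `e₁` has no effect, and
transformations that fix `e_{n+1}` on the outside act on the represented matrix itself. -/
theorem repMat_gauge {n : ℕ} (L T : Matrix (Fin n) (Fin n) ℂ)
    {W : Matrix (Fin (n + 1)) (Fin (n + 1)) ℂ} (hW : W * Wᴴ = 1)
    (hW1 : W * incl (n + 1) 0 1 = incl (n + 1) 0 1) (Cs B : Matrix (Fin (n + 1)) (Fin (n + 1)) ℂ) :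
    repMat n ((blockAt (n + 1) 0 L)ᴴ * Cs * W) (Wᴴ * B * blockAt (n + 1) 0 T)
      = Lᴴ * repMat n Cs B * T := by
  unfold repMat
  set P := incl (n + 1) 0 n
  set e := incl (n + 1) 0 1
  set f := incl (n + 1) n 1
  have a1 : Pᴴ * (blockAt (n + 1) 0 L)ᴴ = Lᴴ * Pᴴ := by
    rw [← Matrix.conjTranspose_mul, blockAt_mul_incl (by omega), Matrix.conjTranspose_mul]
  have a2 : fᴴ * (blockAt (n + 1) 0 L)ᴴ = fᴴ := by
    rw [← Matrix.conjTranspose_mul, blockAt_mul_incl_of_disjoint (by omega)]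
  have a3 : blockAt (n + 1) 0 T * P = P * T := blockAt_mul_incl (by omega) _
  have z : (blockAt (n + 1) 0 L)ᴴ * Cs * W * (Wᴴ * B * blockAt (n + 1) 0 T)
      = (blockAt (n + 1) 0 L)ᴴ * (Cs * B) * blockAt (n + 1) 0 T := by
    calc _ = (blockAt (n + 1) 0 L)ᴴ * Cs * (W * Wᴴ) * B * blockAt (n + 1) 0 T := by
          simp only [Matrix.mul_assoc]
      _ = _ := by rw [hW]; simp only [Matrix.mul_assoc, Matrix.one_mul]
  have c : (blockAt (n + 1) 0 L)ᴴ * Cs * W * e = (blockAt (n + 1) 0 L)ᴴ * (Cs * e) := by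
    rw [Matrix.mul_assoc, hW1, Matrix.mul_assoc]
  rw [z, c]
  have b1 : Pᴴ * ((blockAt (n + 1) 0 L)ᴴ * (Cs * B) * blockAt (n + 1) 0 T) * P
      = Lᴴ * (Pᴴ * (Cs * B) * P) * T := by
    rw [Matrix.mul_assoc Pᴴ, Matrix.mul_assoc _ _ P, a3, ← Matrix.mul_assoc Pᴴ,
      ← Matrix.mul_assoc Pᴴ, a1]
    simp only [Matrix.mul_assoc]
  have b2 : fᴴ * ((blockAt (n + 1) 0 L)ᴴ * (Cs * B) * blockAt (n + 1) 0 T) * P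
      = (fᴴ * (Cs * B) * P) * T := by
    rw [Matrix.mul_assoc fᴴ, Matrix.mul_assoc _ _ P, a3, ← Matrix.mul_assoc fᴴ,
      ← Matrix.mul_assoc fᴴ, a2]
    simp only [Matrix.mul_assoc]
  have b3 : Pᴴ * ((blockAt (n + 1) 0 L)ᴴ * (Cs * e)) = Lᴴ * (Pᴴ * (Cs * e)) := by
    rw [← Matrix.mul_assoc, a1, Matrix.mul_assoc]
  have b4 : fᴴ * ((blockAt (n + 1) 0 L)ᴴ * (Cs * e)) = fᴴ * (Cs * e) := by
    rw [← Matrix.mul_assoc, a2]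
  rw [b1, b2, b3, b4, Matrix.mul_add, Matrix.add_mul, Matrix.mul_smul, Matrix.smul_mul]
  simp only [Matrix.mul_assoc]

/-! ### Floating point matrix products -/

section MatMul

variable {u : ℝ} {rd : ℝ → ℝ}

theorem norm_sub_le_sub_add {E : Type*} [SeminormedAddCommGroup E] (a b c : E) :
    ‖a - c‖ ≤ ‖a - b‖ + ‖b - c‖ := norm_sub_le_norm_sub_add_norm_sub a b c

theorem norm_flAdd_flMul_sub_le (h : IsRounding u rd) (hu : 0 ≤ u) (hu1 : u ≤ 1 / 1000)
    {acc s z w : ℂ} {e : ℝ} (he : e ≤ 1) (hs : ‖s‖ ≤ 8) (ha : ‖acc - s‖ ≤ e) (hz : ‖z‖ ≤ 2)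
    (hw : ‖w‖ ≤ 2) : ‖flAdd rd acc (flMul rd z w) - (s + z * w)‖ ≤ e + 60 * u := by
  have h1 := norm_flMul_sub_le h hu (by linarith) z w
  have h2 : ‖z‖ * ‖w‖ ≤ 4 := by nlinarith [norm_nonneg z, norm_nonneg w]
  have h3 : ‖acc + flMul rd z w - (s + z * w)‖ ≤ e + 24 * u := by
    have : acc + flMul rd z w - (s + z * w) = (acc - s) + (flMul rd z w - z * w) := by ring
    rw [this]
    refine (norm_add_le _ _).trans ?_
    nlinarith
  have h4 : ‖acc + flMul rd z w‖ ≤ 18 := by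
    have : ‖s + z * w‖ ≤ 12 := (norm_add_le _ _).trans (by rw [norm_mul]; linarith)
    have := norm_sub_norm_le (acc + flMul rd z w) (s + z * w)
    linarith
  have h5 := norm_flAdd_sub_le h hu acc (flMul rd z w)
  refine (norm_sub_le_sub_add _ (acc + flMul rd z w) _).trans ?_
  nlinarith

theorem norm_flMatMul_three_sub_le (h : IsRounding u rd) (hu : 0 ≤ u) (hu1 : u ≤ 1 / 1000)
    {A B : Matrix (Fin 3) (Fin 3) ℂ} (hA : ∀ i j, ‖A i j‖ ≤ 2) (hB : ∀ i j, ‖B i j‖ ≤ 2) :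
    ‖flMatMul rd A B - A * B‖ ≤ 1700 * u := by
  have key : ∀ i j, ‖(flMatMul rd A B - A * B) i j‖ ≤ 180 * u := by
    intro i j
    have b : ∀ l, ‖A i l * B l j‖ ≤ 4 := fun l => by
      rw [norm_mul]
      nlinarith [hA i l, hB l j, norm_nonneg (A i l), norm_nonneg (B l j)]
    have s1 := norm_flAdd_flMul_sub_le h hu hu1 (acc := 0) (s := 0) (e := 0) (by norm_num)
      (by simp) (by simp) (hA i 0) (hB 0 j)
    have s2 := norm_flAdd_flMul_sub_le h hu hu1 (by linarith)
      (by rw [zero_add]; linarith [b 0]) s1 (hA i 1) (hB 1 j)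
    have s3 := norm_flAdd_flMul_sub_le h hu hu1 (by linarith)
      (by rw [zero_add]; exact (norm_add_le _ _).trans (by linarith [b 0, b 1])) s2
      (hA i 2) (hB 2 j)
    simp only [zero_add] at s3
    rw [Matrix.sub_apply, Matrix.mul_apply, Fin.sum_univ_three]
    refine le_trans (le_of_eq ?_) (s3.trans (by linarith))
    simp [flMatMul, List.finRange_succ]
  refine (norm_le_of_entries _ key).trans ?_
  norm_num
  linarith

theorem norm_flMatMul_two_sub_le (h : IsRounding u rd) (hu : 0 ≤ u) (hu1 : u ≤ 1 / 1000)
    {A B : Matrix (Fin 2) (Fin 2) ℂ} (hA : ∀ i j, ‖A i j‖ ≤ 2) (hB : ∀ i j, ‖B i j‖ ≤ 2) :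
    ‖flMatMul rd A B - A * B‖ ≤ 1700 * u := by
  have key : ∀ i j, ‖(flMatMul rd A B - A * B) i j‖ ≤ 180 * u := by
    intro i j
    have b : ∀ l, ‖A i l * B l j‖ ≤ 4 := fun l => by
      rw [norm_mul]
      nlinarith [hA i l, hB l j, norm_nonneg (A i l), norm_nonneg (B l j)]
    have s1 := norm_flAdd_flMul_sub_le h hu hu1 (acc := 0) (s := 0) (e := 0) (by norm_num)
      (by simp) (by simp) (hA i 0) (hB 0 j)
    have s2 := norm_flAdd_flMul_sub_le h hu hu1 (by linarith)
      (by rw [zero_add]; linarith [b 0]) s1 (hA i 1) (hB 1 j)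
    simp only [zero_add] at s2
    rw [Matrix.sub_apply, Matrix.mul_apply, Fin.sum_univ_two]
    refine le_trans (le_of_eq ?_) (s2.trans (by linarith))
    simp [flMatMul, List.finRange_succ]
  refine (norm_le_of_entries _ key).trans ?_
  norm_num
  linarith

/-- The product of perturbed unitary matrices. -/
theorem norm_mul_sub_mul_le {n : ℕ} {A A₀ B B₀ : Matrix (Fin n) (Fin n) ℂ} {e e' : ℝ}
    (hA₀ : A₀ ∈ Matrix.unitaryGroup (Fin n) ℂ) (hB₀ : B₀ ∈ Matrix.unitaryGroup (Fin n) ℂ)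
    (hA : ‖A - A₀‖ ≤ e) (hB : ‖B - B₀‖ ≤ e') : ‖A * B - A₀ * B₀‖ ≤ e + e' + e * e' := by
  have : A * B - A₀ * B₀ = (A - A₀) * B₀ + A₀ * (B - B₀) + (A - A₀) * (B - B₀) := by noncomm_ring
  rw [this]
  refine (norm_add₃_le).trans ?_
  rw [norm_mul_unitary hB₀, norm_unitary_mul hA₀]
  have h1 := Matrix.frobenius_norm_mul (A - A₀) (B - B₀)
  have h2 := mul_le_mul hA hB (norm_nonneg _) ((norm_nonneg _).trans hA)
  linarith

theorem norm_entry_le_two {n : ℕ} {A A₀ : Matrix (Fin n) (Fin n) ℂ} {e : ℝ}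
    (hA₀ : A₀ ∈ Matrix.unitaryGroup (Fin n) ℂ) (hA : ‖A - A₀‖ ≤ e) (he : e ≤ 1) (i j : Fin n) :
    ‖A i j‖ ≤ 2 := by
  have h1 := norm_entry_sub_le A A₀ i j
  have h2 := norm_entry_le_one hA₀ i j
  have h3 := norm_sub_norm_le (A i j) (A₀ i j)
  linarith

theorem norm_flMatMul_three_sub_mul_le (h : IsRounding u rd) (hu : 0 ≤ u) (hu1 : u ≤ 1 / 1000)
    {A A₀ B B₀ : Matrix (Fin 3) (Fin 3) ℂ} {e e' : ℝ}
    (hA₀ : A₀ ∈ Matrix.unitaryGroup (Fin 3) ℂ) (hB₀ : B₀ ∈ Matrix.unitaryGroup (Fin 3) ℂ)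
    (hA : ‖A - A₀‖ ≤ e) (hB : ‖B - B₀‖ ≤ e') (he : e ≤ 1) (he' : e' ≤ 1) :
    ‖flMatMul rd A B - A₀ * B₀‖ ≤ 2 * (e + e') + 1700 * u := by
  refine (norm_sub_le_sub_add _ (A * B) _).trans ?_
  have h1 := norm_flMatMul_three_sub_le h hu hu1 (norm_entry_le_two hA₀ hA he)
    (norm_entry_le_two hB₀ hB he')
  have h2 := norm_mul_sub_mul_le hA₀ hB₀ hA hB
  have h3 := (norm_nonneg _).trans hA
  have h4 := (norm_nonneg _).trans hB
  nlinarith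

theorem norm_flMatMul_two_sub_mul_le (h : IsRounding u rd) (hu : 0 ≤ u) (hu1 : u ≤ 1 / 1000)
    {A A₀ B B₀ : Matrix (Fin 2) (Fin 2) ℂ} {e e' : ℝ}
    (hA₀ : A₀ ∈ Matrix.unitaryGroup (Fin 2) ℂ) (hB₀ : B₀ ∈ Matrix.unitaryGroup (Fin 2) ℂ)
    (hA : ‖A - A₀‖ ≤ e) (hB : ‖B - B₀‖ ≤ e') (he : e ≤ 1) (he' : e' ≤ 1) :
    ‖flMatMul rd A B - A₀ * B₀‖ ≤ 2 * (e + e') + 1700 * u := by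
  refine (norm_sub_le_sub_add _ (A * B) _).trans ?_
  have h1 := norm_flMatMul_two_sub_le h hu hu1 (norm_entry_le_two hA₀ hA he)
    (norm_entry_le_two hB₀ hB he')
  have h2 := norm_mul_sub_mul_le hA₀ hB₀ hA hB
  have h3 := (norm_nonneg _).trans hA
  have h4 := (norm_nonneg _).trans hB
  nlinarith

/-! ### Reflectors and the restoration of unitarity -/

/-- The exact reflector whose adjoint maps `(a, b)` to `(√(|a|² + |b|²), 0)`. -/
noncomputable def givens (a b : ℂ) : Core :=
  if hypot a b = 0 then 1
  else !![a / hypot a b, star (b / hypot a b); b / hypot a b, -star (a / hypot a b)]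

theorem unitary_of_cs {c s : ℂ} (h : c * star c + s * star s = 1) :
    !![c, star s; s, -star c] ∈ Matrix.unitaryGroup (Fin 2) ℂ := by
  rw [Matrix.mem_unitaryGroup_iff]
  ext i j
  fin_cases i <;> fin_cases j <;>
    simp [Matrix.mul_apply, Fin.sum_univ_two] at h ⊢ <;> first | linear_combination h | ring

theorem div_hypot_mul {a b : ℂ} (h : hypot a b ≠ 0) :
    (a / hypot a b) * star (a / hypot a b) + (b / hypot a b) * star (b / hypot a b) = 1 := by
  have h1 : (hypot a b : ℂ) ≠ 0 := by exact_mod_cast h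
  have h2 : (hypot a b : ℂ) ^ 2 = a * star a + b * star b := by
    have := hypot_sq a b
    simp only [RCLike.star_def, Complex.mul_conj']
    exact_mod_cast this
  simp only [star_div₀, RCLike.star_def, Complex.conj_ofReal] at h2 ⊢
  field_simp
  linear_combination -h2

theorem givens_unitary (a b : ℂ) : givens a b ∈ Matrix.unitaryGroup (Fin 2) ℂ := by
  unfold givens
  split_ifs with h
  · exact one_mem _
  · exact unitary_of_cs (div_hypot_mul h)

theorem givens_conj_zero (a b : ℂ) :
    (givens a b)ᴴ 0 0 * a + (givens a b)ᴴ 0 1 * b = hypot a b := by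
  unfold givens
  split_ifs with h
  · obtain ⟨rfl, rfl⟩ := hypot_eq_zero.1 h
    simp [h]
  · have h1 : (hypot a b : ℂ) ≠ 0 := by exact_mod_cast h
    have := div_hypot_mul h
    simp only [Matrix.conjTranspose_apply, Matrix.of_apply, Matrix.cons_val', Matrix.cons_val_zero,
      Matrix.cons_val_one, Matrix.cons_val_fin_one]
    field_simp at this ⊢
    linear_combination this

theorem givens_conj_one (a b : ℂ) :
    (givens a b)ᴴ 1 0 * a + (givens a b)ᴴ 1 1 * b = 0 := by
  unfold givens
  split_ifs with h
  · obtain ⟨rfl, rfl⟩ := hypot_eq_zero.1 h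
    simp
  · simp
    ring

theorem norm_flGivens_sub_le (h : IsRounding u rd) (hu : 0 ≤ u) (hu1 : u ≤ 1 / 1000) (a b : ℂ) :
    ‖flGivens rd a b - givens a b‖ ≤ 100 * u := by
  unfold flGivens givens
  by_cases h0 : hypot a b = 0
  · simp only [(flHypot_eq_zero h hu hu1).2 h0, h0, if_true, sub_self, norm_zero]
    positivity
  · have h0' : flHypot rd a b ≠ 0 := fun hc => h0 ((flHypot_eq_zero h hu hu1).1 hc)
    have hp : 0 < hypot a b := lt_of_le_of_ne (hypot_nonneg a b) (Ne.symm h0)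
    simp only [h0, h0', if_false]
    have hr := abs_flHypot_sub_le h hu hu1 a b
    have ha := norm_flDivReal_sub_div_le h hu hp (norm_le_hypot_left a b) hr (by linarith)
    have hb := norm_flDivReal_sub_div_le h hu hp (norm_le_hypot_right a b) hr (by linarith)
    refine (norm_le_of_entries _ (e := 23 * u) ?_).trans (by norm_num; linarith)
    intro i j
    fin_cases i <;> fin_cases j
    · simpa using ha.trans (by linarith)
    · have : ‖star (flDivReal rd b (flHypot rd a b)) - star (b / (hypot a b : ℂ))‖ ≤ 23 * u := by
        rw [← star_sub, norm_star]; linarith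
      simpa using this
    · simpa using hb.trans (by linarith)
    · have : ‖-star (flDivReal rd a (flHypot rd a b)) - -star (a / (hypot a b : ℂ))‖ ≤ 23 * u := by
        rw [← star_neg, ← star_neg, ← star_sub, norm_star, neg_sub_neg, norm_sub_rev]; linarith
      simpa using this

theorem abs_sub_one_le_of_gram {g b t e : ℝ} (hg : 0 ≤ g) (hb : 0 ≤ b) (ht : 0 ≤ t) (he0 : 0 ≤ e)
    (he : e ≤ 1 / 100) (h1 : |g * g - 1| ≤ e) (h2 : g * b ≤ e) (h3 : |b ^ 2 + t ^ 2 - 1| ≤ e) :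
    |1 - g| ≤ e ∧ b ≤ 2 * e ∧ |t - 1| ≤ 2 * e := by
  obtain ⟨g1, g2⟩ := abs_le.1 h1
  obtain ⟨g3, g4⟩ := abs_le.1 h3
  have hg2 : 1 / 2 ≤ g := by nlinarith
  have hb2 : b ≤ 2 * e := by nlinarith
  have hb3 : b ^ 2 ≤ e := by nlinarith
  refine ⟨?_, hb2, ?_⟩
  · rw [abs_le]; constructor <;> nlinarith
  · rw [abs_le]; constructor <;> nlinarith

/-- A computed core with restored unitarity is unitary up to a multiple of `u`, whatever it was
computed from; the unitary core is close to the given core if that was almost unitary. -/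
theorem flRenorm_spec (h : IsRounding u rd) (hu : 0 ≤ u) (hu1 : u ≤ 1 / 1000) (X : Core) :
    ∃ H ∈ Matrix.unitaryGroup (Fin 2) ℂ, ‖flRenorm rd X - H‖ ≤ 600 * u ∧
      ∀ e : ℝ, e ≤ 1 / 100 → ‖Xᴴ * X - 1‖ ≤ e → (∀ i j, ‖X i j‖ ≤ 2) →
        ‖H - X‖ ≤ 5000 * u + 8 * e := by
  set P := flGivens rd (X 0 0) (X 1 0) with hP
  set P₀ := givens (X 0 0) (X 1 0) with hP₀
  have hPP : ‖P - P₀‖ ≤ 100 * u := norm_flGivens_sub_le h hu hu1 _ _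
  have hP₀u : P₀ ∈ Matrix.unitaryGroup (Fin 2) ℂ := givens_unitary _ _
  set w := flMatMul rd Pᴴ X 1 1 with hw
  set r := flHypot rd w 0 with hr
  set φ : ℂ := if r = 0 then 1 else flDivReal rd w r with hφ
  set φ₀ : ℂ := if ‖w‖ = 0 then 1 else w / ‖w‖ with hφ₀
  have hhw : hypot w 0 = ‖w‖ := by simp [hypot]
  have hφ₀1 : ‖φ₀‖ = 1 := by
    rw [hφ₀]
    split_ifs with h0
    · simp
    · simp [h0]
  have hφφ : ‖φ - φ₀‖ ≤ 23 * u := by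
    rw [hφ, hφ₀]
    have hz := flHypot_eq_zero h hu hu1 (a := w) (b := 0)
    rw [hhw] at hz
    by_cases h0 : ‖w‖ = 0
    · rw [if_pos (hz.2 h0), if_pos h0]
      simpa using hu
    · rw [if_neg (fun hc => h0 (hz.1 hc)), if_neg h0]
      have hr' := abs_flHypot_sub_le h hu hu1 w 0
      rw [hhw] at hr'
      refine (norm_flDivReal_sub_div_le h hu (lt_of_le_of_ne (norm_nonneg w) (Ne.symm h0)) le_rfl
        hr' (by linarith)).trans (by linarith)
  have hPe : ∀ i j, ‖P i j - P₀ i j‖ ≤ 100 * u := fun i j => (norm_entry_sub_le P P₀ i j).trans hPP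
  have hP1 := norm_entry_le_one hP₀u
  have hfm : ∀ i j, ‖flMul rd φ (P i j) - φ₀ * P₀ i j‖ ≤ 140 * u := by
    intro i j
    have h1 := norm_flMul_sub_le h hu (by linarith) φ (P i j)
    have h2 : ‖φ‖ ≤ 11 / 10 := by
      have := norm_sub_norm_le φ φ₀
      linarith
    have h3 : ‖P i j‖ ≤ 11 / 10 := by
      have := norm_sub_norm_le (P i j) (P₀ i j)
      linarith [hP1 i j, hPe i j]
    have h4 : ‖φ * P i j - φ₀ * P₀ i j‖ ≤ 23 * u * (11 / 10) + 100 * u := by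
      have : φ * P i j - φ₀ * P₀ i j = (φ - φ₀) * P i j + φ₀ * (P i j - P₀ i j) := by ring
      rw [this]
      refine (norm_add_le _ _).trans ?_
      rw [norm_mul, norm_mul, hφ₀1, one_mul]
      exact add_le_add (mul_le_mul hφφ h3 (norm_nonneg _) (by linarith)) (hPe i j)
    have h5 : ‖φ‖ * ‖P i j‖ ≤ 11 / 10 * (11 / 10) :=
      mul_le_mul h2 h3 (norm_nonneg _) (by norm_num)
    refine (norm_sub_le_sub_add _ (φ * P i j) _).trans ?_
    nlinarith
  have hφ₀φ₀ : φ₀ * star φ₀ = 1 := by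
    rw [RCLike.star_def, Complex.mul_conj', hφ₀1]; simp
  have hDu : !![1, 0; 0, φ₀] ∈ Matrix.unitaryGroup (Fin 2) ℂ := by
    rw [Matrix.mem_unitaryGroup_iff]
    ext i j
    fin_cases i <;> fin_cases j <;> simp [Matrix.mul_apply, Fin.sum_univ_two]
    simpa using hφ₀φ₀
  refine ⟨P₀ * !![1, 0; 0, φ₀], mul_mem hP₀u hDu, ?_, ?_⟩
  · have hR : flRenorm rd X = !![P 0 0, flMul rd φ (P 0 1); P 1 0, flMul rd φ (P 1 1)] := rfl
    rw [hR]
    refine (norm_le_of_entries _ (e := 140 * u) ?_).trans (by norm_num; linarith)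
    intro i j
    fin_cases i <;> fin_cases j
    · simpa [Matrix.mul_apply, Fin.sum_univ_two] using (hPe 0 0).trans (by linarith)
    · simpa [Matrix.mul_apply, Fin.sum_univ_two, mul_comm φ₀] using hfm 0 1
    · simpa [Matrix.mul_apply, Fin.sum_univ_two] using (hPe 1 0).trans (by linarith)
    · simpa [Matrix.mul_apply, Fin.sum_univ_two, mul_comm φ₀] using hfm 1 1
  · intro e he hX hX2
    -- `T` is upper triangular with the Gram matrix of `X`, hence almost `diag (1, T 1 1)` with an
    -- almost unimodular entry `T 1 1`, and `φ₀` is the phase of the computed value `w` of `T 1 1`.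
    obtain ⟨T, hT⟩ : ∃ T, T = P₀ᴴ * X := ⟨_, rfl⟩
    have hPT : P₀ * T = X := by
      rw [hT, ← Matrix.mul_assoc, ← Matrix.star_eq_conjTranspose,
        Matrix.mem_unitaryGroup_iff.1 hP₀u, Matrix.one_mul]
    have hTT : Tᴴ * T = Xᴴ * X := by
      rw [← hPT, Matrix.conjTranspose_mul, Matrix.mul_assoc, ← Matrix.mul_assoc P₀ᴴ,
        ← Matrix.star_eq_conjTranspose P₀, Matrix.mem_unitaryGroup_iff'.1 hP₀u, Matrix.one_mul]
    have t10 : T 1 0 = 0 := by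
      rw [hT, Matrix.mul_apply, Fin.sum_univ_two]
      exact givens_conj_one _ _
    set g := hypot (X 0 0) (X 1 0) with hg
    have hg0 : 0 ≤ g := hypot_nonneg _ _
    have t00 : T 0 0 = g := by
      rw [hT, Matrix.mul_apply, Fin.sum_univ_two]
      exact givens_conj_zero _ _
    rw [← hTT] at hX
    have e00 := (norm_entry_le _ 0 0).trans hX
    have e01 := (norm_entry_le _ 0 1).trans hX
    have e11 := (norm_entry_le _ 1 1).trans hX
    simp only [Matrix.sub_apply, Matrix.mul_apply, Fin.sum_univ_two, Matrix.conjTranspose_apply,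
      t00, t10, RCLike.star_def, Complex.conj_ofReal, map_zero, zero_mul, add_zero,
      Matrix.one_apply_eq, Matrix.one_apply_ne (show (0 : Fin 2) ≠ 1 by decide), sub_zero,
      Complex.conj_mul'] at e00 e01 e11
    rw [norm_mul, Complex.norm_real, Real.norm_eq_abs, abs_of_nonneg hg0] at e01
    have e00' : |g * g - 1| ≤ e := by
      have : ((g * g - 1 : ℝ) : ℂ) = (‖(g : ℂ)‖ : ℂ) ^ 2 + (‖(0 : ℂ)‖ : ℂ) ^ 2 - 1 := by
        rw [Complex.norm_real, Real.norm_eq_abs, abs_of_nonneg hg0, norm_zero]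
        push_cast
        ring
      rwa [← this, Complex.norm_real] at e00
    have e11' : |‖T 0 1‖ ^ 2 + ‖T 1 1‖ ^ 2 - 1| ≤ e := by
      have : ((‖T 0 1‖ ^ 2 + ‖T 1 1‖ ^ 2 - 1 : ℝ) : ℂ)
        = (‖T 0 1‖ : ℂ) ^ 2 + (‖T 1 1‖ : ℂ) ^ 2 - 1 := by push_cast; ring
      rwa [← this, Complex.norm_real] at e11
    have he0 : 0 ≤ e := (norm_nonneg _).trans hX
    obtain ⟨hg1, hb, ht⟩ := abs_sub_one_le_of_gram hg0 (norm_nonneg _) (norm_nonneg _) he0 he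
      e00' e01 e11'
    have hww : ‖w - T 1 1‖ ≤ 2500 * u := by
      have h1 : ‖flMatMul rd Pᴴ X - Pᴴ * X‖ ≤ 1700 * u := by
        refine norm_flMatMul_two_sub_le h hu hu1 (fun i j => ?_) hX2
        rw [Matrix.conjTranspose_apply, norm_star]
        exact norm_entry_le_two hP₀u hPP (by linarith) j i
      have h2 : ‖Pᴴ * X - T‖ ≤ 800 * u := by
        rw [hT, ← Matrix.sub_mul]
        refine (Matrix.frobenius_norm_mul _ _).trans ?_
        rw [norm_conjTranspose_sub]
        have h3 : ‖X‖ ≤ 8 := (norm_le_of_entries X hX2).trans (by norm_num)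
        nlinarith [norm_nonneg X, norm_nonneg (P - P₀)]
      have h3 := norm_entry_sub_le (flMatMul rd Pᴴ X) T 1 1
      have h4 := norm_sub_le_sub_add (flMatMul rd Pᴴ X) (Pᴴ * X) T
      rw [hw]
      linarith
    have hφw : ‖φ₀ - w‖ = |‖w‖ - 1| := by
      rw [hφ₀]
      split_ifs with h0
      · rw [h0, norm_eq_zero.1 h0]; simp
      · have h0c : (‖w‖ : ℂ) ≠ 0 := by exact_mod_cast h0
        have : w / (‖w‖ : ℂ) - w = (w / ‖w‖) * ((1 - ‖w‖ : ℝ) : ℂ) := by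
          push_cast; field_simp
        rw [this, norm_mul, norm_div, Complex.norm_real, Complex.norm_real, norm_norm, div_self h0,
          one_mul, Real.norm_eq_abs, abs_sub_comm]
    have hφT : ‖φ₀ - T 1 1‖ ≤ 5000 * u + 2 * e := by
      have h1 := norm_sub_le_sub_add φ₀ w (T 1 1)
      have h2 : |‖w‖ - 1| ≤ |‖w‖ - ‖T 1 1‖| + |‖T 1 1‖ - 1| := abs_sub_le _ _ _
      have h3 := abs_norm_sub_norm_le w (T 1 1)
      linarith
    have hfin : P₀ * !![1, 0; 0, φ₀] - X = P₀ * (!![1, 0; 0, φ₀] - T) := by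
      rw [Matrix.mul_sub, hPT]
    rw [hfin, norm_unitary_mul hP₀u]
    refine (norm_le_sum_entries _).trans ?_
    simp only [Fin.sum_univ_two, Matrix.sub_apply, t00, t10]
    have : ‖(1 : ℂ) - g‖ = |1 - g| := by
      rw [← Complex.ofReal_one, ← Complex.ofReal_sub, Complex.norm_real, Real.norm_eq_abs]
    simp [this]
    linarith

end MatMul

/-! ### Backward errors of fusions and turnovers -/

section Turnover

variable {u e : ℝ} {rd : ℝ → ℝ}

theorem norm_gram_sub_one_le {n : ℕ} {M Q : Matrix (Fin n) (Fin n) ℂ} {δ : ℝ}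
    (hQ : Q ∈ Matrix.unitaryGroup (Fin n) ℂ) (h : ‖M - Q‖ ≤ δ) (hδ : δ ≤ 1) :
    ‖Mᴴ * M - 1‖ ≤ 3 * δ := by
  have h1 := norm_mul_sub_mul_le (conjTranspose_mem_unitary hQ) hQ
    ((norm_conjTranspose_sub M Q).trans_le h) h
  rw [← Matrix.star_eq_conjTranspose Q, Matrix.mem_unitaryGroup_iff'.1 hQ] at h1
  have := (norm_nonneg _).trans h
  nlinarith

/-- A fusion of almost unitary core transformations is computed with a small error, and yields a
core transformation that is unitary up to a multiple of `u`. -/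
theorem flFuse_spec (h : IsRounding u rd) (hu : 0 ≤ u) (hue : u ≤ e) (he : e ≤ 1 / 10 ^ 9)
    {A B A₀ B₀ : Core} (hA₀ : A₀ ∈ Matrix.unitaryGroup (Fin 2) ℂ)
    (hB₀ : B₀ ∈ Matrix.unitaryGroup (Fin 2) ℂ) (hA : ‖A - A₀‖ ≤ e) (hB : ‖B - B₀‖ ≤ e) :
    ∃ H ∈ Matrix.unitaryGroup (Fin 2) ℂ, ‖flFuse rd A B - H‖ ≤ 600 * u ∧
      ‖H - A₀ * B₀‖ ≤ 10 ^ 8 * e := by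
  norm_num at he
  obtain ⟨H, hH, h1, h2⟩ := flRenorm_spec h hu (by linarith) (flMatMul rd A B)
  refine ⟨H, hH, h1, ?_⟩
  have h3 := norm_flMatMul_two_sub_mul_le h hu (by linarith) hA₀ hB₀ hA hB (by linarith)
    (by linarith)
  have h4 : ‖flMatMul rd A B - A₀ * B₀‖ ≤ 1704 * e := by linarith
  have h5 := h2 (5200 * e) (by linarith)
    ((norm_gram_sub_one_le (mul_mem hA₀ hB₀) h4 (by linarith)).trans (by linarith))
    (norm_entry_le_two (mul_mem hA₀ hB₀) h4 (by linarith))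
  have h6 := norm_sub_le_sub_add H (flMatMul rd A B) (A₀ * B₀)
  norm_num
  linarith

/-- In a unitary matrix whose first column is almost `(1, 0, 0)`, the first row is almost
`(1, 0, 0)` as well. -/
theorem unitary_first_row {Q : Matrix (Fin 3) (Fin 3) ℂ} (hQ : Q ∈ Matrix.unitaryGroup (Fin 3) ℂ)
    {δ g : ℝ} (hδ : δ ≤ 1 / 10) (hg : 0 ≤ g) (h0 : ‖Q 0 0 - g‖ ≤ δ) (h1 : ‖Q 1 0‖ ≤ δ)
    (h2 : ‖Q 2 0‖ ≤ δ) : ‖Q 0 1‖ ≤ 2 * δ ∧ ‖Q 0 2‖ ≤ 2 * δ ∧ ‖Q 0 0 - 1‖ ≤ 4 * δ := by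
  have hc := unitary_col_sum hQ 0
  have hr := unitary_row_sum hQ 0
  simp only [Fin.sum_univ_three] at hc hr
  have hδ0 := (norm_nonneg _).trans h1
  have h1' : ‖Q 1 0‖ ^ 2 ≤ δ ^ 2 := pow_le_pow_left₀ (norm_nonneg _) h1 2
  have h2' : ‖Q 2 0‖ ^ 2 ≤ δ ^ 2 := pow_le_pow_left₀ (norm_nonneg _) h2 2
  refine ⟨?_, ?_, ?_⟩
  · refine le_of_sq_le_sq ?_ (by positivity)
    nlinarith [sq_nonneg ‖Q 0 2‖]
  · refine le_of_sq_le_sq ?_ (by positivity)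
    nlinarith [sq_nonneg ‖Q 0 1‖]
  · have h3 : ‖Q 0 0‖ ≤ 1 := norm_entry_le_one hQ 0 0
    have h4 : 1 - δ ≤ ‖Q 0 0‖ := by nlinarith [norm_nonneg (Q 0 0)]
    have h5 := abs_le.1 ((abs_norm_sub_norm_le (Q 0 0) (g : ℂ)).trans h0)
    rw [Complex.norm_real, Real.norm_eq_abs, abs_of_nonneg hg] at h5
    have h6 : ‖(g : ℂ) - 1‖ ≤ 2 * δ := by
      rw [← Complex.ofReal_one, ← Complex.ofReal_sub, Complex.norm_real, Real.norm_eq_abs, abs_le]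
      constructor <;> linarith [h5.1, h5.2]
    have := norm_sub_le_sub_add (Q 0 0) (g : ℂ) 1
    linarith

theorem norm_coreAt_three_sub_le {H : Core} {Q : Matrix (Fin 3) (Fin 3) ℂ} {c : ℝ}
    (h00 : ‖Q 0 0 - 1‖ ≤ c) (h01 : ‖Q 0 1‖ ≤ c) (h02 : ‖Q 0 2‖ ≤ c) (h10 : ‖Q 1 0‖ ≤ c)
    (h20 : ‖Q 2 0‖ ≤ c) (hH : ∀ i j : Fin 2, ‖H i j - Q i.succ j.succ‖ ≤ c) :
    ‖coreAt 3 1 H - Q‖ ≤ 9 * c := by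
  refine (norm_le_of_entries _ (e := c) ?_).trans (by norm_num)
  intro i j
  fin_cases i <;> fin_cases j
  · simpa [coreAt, norm_sub_rev] using h00
  · simpa [coreAt] using h01
  · simpa [coreAt] using h02
  · simpa [coreAt] using h10
  · simpa [coreAt] using hH 0 0
  · simpa [coreAt] using hH 0 1
  · simpa [coreAt] using h20
  · simpa [coreAt] using hH 1 0
  · simpa [coreAt] using hH 1 1

theorem gram_lower_block (M : Matrix (Fin 3) (Fin 3) ℂ) {X : Core}
    (hX : ∀ i j : Fin 2, X i j = M i.succ j.succ) (i j : Fin 2) :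
    (Xᴴ * X - 1) i j = (Mᴴ * M - 1) i.succ j.succ - star (M 0 i.succ) * M 0 j.succ := by
  simp only [Matrix.sub_apply, Matrix.mul_apply, Fin.sum_univ_succ (n := 2),
    Matrix.conjTranspose_apply, hX, Matrix.one_apply, Fin.succ_inj]
  ring

/-- The computed reflectors of a turnover reduce the first column of the product, so that the
product is almost of the form `1 ⊕ H`. -/
theorem flTurnDown_spec (h : IsRounding u rd) (hu : 0 ≤ u) (hue : u ≤ e) (he : e ≤ 1 / 10 ^ 9)
    {A B D A₀ B₀ D₀ : Core} (hA₀ : A₀ ∈ Matrix.unitaryGroup (Fin 2) ℂ)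
    (hB₀ : B₀ ∈ Matrix.unitaryGroup (Fin 2) ℂ) (hD₀ : D₀ ∈ Matrix.unitaryGroup (Fin 2) ℂ)
    (hA : ‖A - A₀‖ ≤ e) (hB : ‖B - B₀‖ ≤ e) (hD : ‖D - D₀‖ ≤ e) :
    ∃ F ∈ Matrix.unitaryGroup (Fin 2) ℂ, ∃ G ∈ Matrix.unitaryGroup (Fin 2) ℂ,
      ∃ H ∈ Matrix.unitaryGroup (Fin 2) ℂ, ‖(flTurnDown rd A B D).1 - F‖ ≤ 600 * u ∧
        ‖(flTurnDown rd A B D).2.1 - G‖ ≤ 600 * u ∧ ‖(flTurnDown rd A B D).2.2 - H‖ ≤ 600 * u ∧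
        ‖coreAt 3 1 F * coreAt 3 0 G * coreAt 3 1 H
          - coreAt 3 0 A₀ * coreAt 3 1 B₀ * coreAt 3 0 D₀‖ ≤ 10 ^ 8 * e := by
  norm_num at he
  have hu1 : u ≤ 1 / 1000 := by linarith
  have c0 : 0 + 1 < 3 := by norm_num
  have c1 : 1 + 1 < 3 := by norm_num
  set M := flMatMul rd (flMatMul rd (coreAt 3 0 A) (coreAt 3 1 B)) (coreAt 3 0 D) with hM
  set F := flGivens rd (M 1 0) (M 2 0) with hF
  set M₁ := flMatMul rd (coreAt 3 1 F)ᴴ M with hM₁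
  set G := flGivens rd (M₁ 0 0) (M₁ 1 0) with hG
  set M₂ := flMatMul rd (coreAt 3 0 G)ᴴ M₁ with hM₂
  set X : Core := !![M₂ 1 1, M₂ 1 2; M₂ 2 1, M₂ 2 2] with hX
  have hT : flTurnDown rd A B D = (F, G, flRenorm rd X) := rfl
  rw [hT]
  set F₀ := givens (M 1 0) (M 2 0)
  set G₀ := givens (M₁ 0 0) (M₁ 1 0)
  have hF₀ : F₀ ∈ Matrix.unitaryGroup (Fin 2) ℂ := givens_unitary _ _
  have hG₀ : G₀ ∈ Matrix.unitaryGroup (Fin 2) ℂ := givens_unitary _ _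
  have hFF : ‖F - F₀‖ ≤ 100 * u := norm_flGivens_sub_le h hu hu1 _ _
  have hGG : ‖G - G₀‖ ≤ 100 * u := norm_flGivens_sub_le h hu hu1 _ _
  obtain ⟨H₀, hH₀, hHH, hHX⟩ := flRenorm_spec h hu hu1 X
  refine ⟨F₀, hF₀, G₀, hG₀, H₀, hH₀, by linarith, by linarith, hHH, ?_⟩
  have uA := coreAt_unitary c0 hA₀
  have uB := coreAt_unitary c1 hB₀
  have uD := coreAt_unitary c0 hD₀
  have uF := conjTranspose_mem_unitary (coreAt_unitary c1 hF₀)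
  have uG := conjTranspose_mem_unitary (coreAt_unitary c0 hG₀)
  have uAB := mul_mem uA uB
  have uX := mul_mem uAB uD
  set X₀ := coreAt 3 0 A₀ * coreAt 3 1 B₀ * coreAt 3 0 D₀ with hX₀
  set X₁ := (coreAt 3 1 F₀)ᴴ * X₀ with hX₁
  have uX₁ : X₁ ∈ Matrix.unitaryGroup (Fin 3) ℂ := mul_mem uF uX
  set X₂ := (coreAt 3 0 G₀)ᴴ * X₁ with hX₂
  have uX₂ : X₂ ∈ Matrix.unitaryGroup (Fin 3) ℂ := mul_mem uG uX₁
  have b1 := norm_flMatMul_three_sub_mul_le h hu hu1 uA uB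
    ((norm_coreAt_sub c0 A A₀).trans_le hA) ((norm_coreAt_sub c1 B B₀).trans_le hB)
    (by linarith) (by linarith)
  have b2 : ‖M - X₀‖ ≤ 6000 * e := by
    have := norm_flMatMul_three_sub_mul_le h hu hu1 uAB uD
      b1 ((norm_coreAt_sub c0 D D₀).trans_le hD) (by linarith) (by linarith)
    linarith
  have b3 : ‖M₁ - X₁‖ ≤ 14000 * e := by
    have := norm_flMatMul_three_sub_mul_le h hu hu1 uF uX
      ((norm_conjTranspose_sub _ _).trans_le ((norm_coreAt_sub c1 F F₀).trans_le hFF)) b2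
      (by linarith) (by linarith)
    linarith
  have b4 : ‖M₂ - X₂‖ ≤ 30000 * e := by
    have := norm_flMatMul_three_sub_mul_le h hu hu1 uG uX₁
      ((norm_conjTranspose_sub _ _).trans_le ((norm_coreAt_sub c0 G G₀).trans_le hGG)) b3
      (by linarith) (by linarith)
    linarith
  -- The entries of the first column that the exact reflectors annihilate.
  have z1 : ((coreAt 3 1 F₀)ᴴ * M) 2 0 = 0 := by
    have := givens_conj_one (M 1 0) (M 2 0)
    rw [coreAt_conjTranspose, Matrix.mul_apply, Fin.sum_univ_three]
    simpa [coreAt] using this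
  have z2 : ((coreAt 3 0 G₀)ᴴ * M₁) 1 0 = 0 := by
    have := givens_conj_one (M₁ 0 0) (M₁ 1 0)
    rw [coreAt_conjTranspose, Matrix.mul_apply, Fin.sum_univ_three]
    simpa [coreAt] using this
  have z3 : ((coreAt 3 0 G₀)ᴴ * M₁) 0 0 = hypot (M₁ 0 0) (M₁ 1 0) := by
    have := givens_conj_zero (M₁ 0 0) (M₁ 1 0)
    rw [coreAt_conjTranspose, Matrix.mul_apply, Fin.sum_univ_three]
    simpa [coreAt] using this
  have z4 : X₂ 2 0 = X₁ 2 0 := by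
    rw [hX₂, coreAt_conjTranspose, Matrix.mul_apply, Fin.sum_univ_three]
    simp [coreAt]
  have d1 : ‖(coreAt 3 1 F₀)ᴴ * M - X₁‖ ≤ 6000 * e := by
    rw [hX₁, ← Matrix.mul_sub, norm_unitary_mul uF]; exact b2
  have d2 : ‖(coreAt 3 0 G₀)ᴴ * M₁ - X₂‖ ≤ 14000 * e := by
    rw [hX₂, ← Matrix.mul_sub, norm_unitary_mul uG]; exact b3
  have q20 : ‖X₂ 2 0‖ ≤ 14000 * e := by
    have := (norm_entry_sub_le _ _ 2 0).trans d1
    rw [z1, zero_sub, norm_neg] at this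
    rw [z4]; linarith
  have q10 : ‖X₂ 1 0‖ ≤ 14000 * e := by
    have := (norm_entry_sub_le _ _ 1 0).trans d2
    rwa [z2, zero_sub, norm_neg] at this
  have q00 : ‖X₂ 0 0 - hypot (M₁ 0 0) (M₁ 1 0)‖ ≤ 14000 * e := by
    have := (norm_entry_sub_le _ _ 0 0).trans d2
    rwa [z3, norm_sub_rev] at this
  obtain ⟨q01, q02, q00'⟩ := unitary_first_row uX₂ (by linarith) (hypot_nonneg _ _) q00 q10 q20
  have m01 : ‖M₂ 0 1‖ ≤ 58000 * e := by
    have h1 := (norm_entry_sub_le M₂ X₂ 0 1).trans b4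
    have h2 := norm_sub_norm_le (M₂ 0 1) (X₂ 0 1)
    linarith
  have m02 : ‖M₂ 0 2‖ ≤ 58000 * e := by
    have h1 := (norm_entry_sub_le M₂ X₂ 0 2).trans b4
    have h2 := norm_sub_norm_le (M₂ 0 2) (X₂ 0 2)
    linarith
  have hgram := norm_gram_sub_one_le uX₂ b4 (by linarith)
  have hXM : ∀ i j : Fin 2, X i j = M₂ i.succ j.succ := by
    intro i j
    fin_cases i <;> fin_cases j <;> rfl
  have hXX : ‖Xᴴ * X - 1‖ ≤ 600000 * e := by
    have key : ∀ i j : Fin 2, ‖(Xᴴ * X - 1) i j‖ ≤ 150000 * e := by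
      intro i j
      have h1 := gram_lower_block M₂ hXM i j
      have h2 : ∀ i : Fin 2, ‖M₂ 0 i.succ‖ ≤ 58000 * e := by
        intro i; fin_cases i
        · exact m01
        · exact m02
      rw [h1]
      refine (norm_sub_le _ _).trans ?_
      rw [norm_mul, norm_star]
      have h3 := (norm_entry_le _ i.succ j.succ).trans hgram
      have h4 := mul_le_mul (h2 i) (h2 j) (norm_nonneg _) ((norm_nonneg _).trans (h2 i))
      nlinarith
    refine (norm_le_of_entries _ key).trans ?_
    norm_num
    linarith
  have hX2 : ∀ i j, ‖X i j‖ ≤ 2 := by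
    intro i j
    rw [hXM]
    exact norm_entry_le_two uX₂ b4 (by linarith) _ _
  have hHX' := hHX _ (by linarith) hXX hX2
  -- The error is that of `F₀ G₀ (1 ⊕ H₀) = F₀ G₀ X₂`.
  have hfin : coreAt 3 1 F₀ * coreAt 3 0 G₀ * coreAt 3 1 H₀ - X₀
      = coreAt 3 1 F₀ * (coreAt 3 0 G₀ * (coreAt 3 1 H₀ - X₂)) := by
    have f1 := Matrix.mem_unitaryGroup_iff.1 (coreAt_unitary c1 hF₀)
    have f2 := Matrix.mem_unitaryGroup_iff.1 (coreAt_unitary c0 hG₀)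
    rw [Matrix.star_eq_conjTranspose] at f1 f2
    rw [Matrix.mul_sub, Matrix.mul_sub, hX₂, ← Matrix.mul_assoc (coreAt 3 0 G₀) _ X₁, f2,
      Matrix.one_mul, hX₁, ← Matrix.mul_assoc (coreAt 3 1 F₀) _ X₀, f1, Matrix.one_mul,
      Matrix.mul_assoc]
  rw [hfin, norm_unitary_mul (coreAt_unitary c1 hF₀), norm_unitary_mul (coreAt_unitary c0 hG₀)]
  have hblk : ∀ i j : Fin 2, ‖H₀ i j - X₂ i.succ j.succ‖ ≤ 6000000 * e := by
    intro i j
    have h1 := (norm_entry_sub_le H₀ X i j).trans hHX'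
    have h2 := (norm_entry_sub_le M₂ X₂ i.succ j.succ).trans b4
    rw [hXM] at h1
    have h4 := norm_sub_le_sub_add (H₀ i j) (M₂ i.succ j.succ) (X₂ i.succ j.succ)
    linarith
  refine (norm_coreAt_three_sub_le (c := 6000000 * e) ?_ ?_ ?_ ?_ ?_ hblk).trans
    (by norm_num; linarith) <;> linarith

theorem reverse_eq_submatrix (A : Core) : reverse A = A.submatrix Fin.rev Fin.rev := by
  ext i j
  fin_cases i <;> fin_cases j <;> rfl

theorem norm_submatrix_rev {n : ℕ} (A : Matrix (Fin n) (Fin n) ℂ) :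
    ‖A.submatrix Fin.rev Fin.rev‖ = ‖A‖ := by
  refine (sq_eq_sq₀ (norm_nonneg _) (norm_nonneg _)).1 ?_
  rw [frobenius_sq, frobenius_sq, ← Equiv.sum_comp Fin.revPerm (fun i => ∑ j, ‖A i j‖ ^ 2)]
  refine Finset.sum_congr rfl fun i _ => ?_
  rw [← Equiv.sum_comp Fin.revPerm (fun j => ‖A (Fin.revPerm i) j‖ ^ 2)]
  rfl

theorem norm_reverse_sub (A B : Core) : ‖reverse A - reverse B‖ = ‖A - B‖ := by
  rw [reverse_eq_submatrix, reverse_eq_submatrix, ← norm_submatrix_rev (A - B)]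
  rfl

theorem reverse_unitary {A : Core} (hA : A ∈ Matrix.unitaryGroup (Fin 2) ℂ) :
    reverse A ∈ Matrix.unitaryGroup (Fin 2) ℂ := by
  rw [reverse_eq_submatrix, Matrix.mem_unitaryGroup_iff, Matrix.star_eq_conjTranspose,
    Matrix.conjTranspose_submatrix]
  have := Matrix.submatrix_mul_equiv A Aᴴ Fin.rev Fin.revPerm Fin.rev
  rw [← Matrix.star_eq_conjTranspose A, Matrix.mem_unitaryGroup_iff.1 hA] at this
  exact this.trans (Matrix.submatrix_one_equiv Fin.revPerm)

theorem coreAt_three_submatrix_rev (A : Core) :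
    (coreAt 3 0 A).submatrix Fin.rev Fin.rev = coreAt 3 1 (reverse A) ∧
    (coreAt 3 1 A).submatrix Fin.rev Fin.rev = coreAt 3 0 (reverse A) := by
  constructor <;> ext i j <;> fin_cases i <;> fin_cases j <;> simp [coreAt, reverse]

theorem flTurnUp_spec (h : IsRounding u rd) (hu : 0 ≤ u) (hue : u ≤ e) (he : e ≤ 1 / 10 ^ 9)
    {A B D A₀ B₀ D₀ : Core} (hA₀ : A₀ ∈ Matrix.unitaryGroup (Fin 2) ℂ)
    (hB₀ : B₀ ∈ Matrix.unitaryGroup (Fin 2) ℂ) (hD₀ : D₀ ∈ Matrix.unitaryGroup (Fin 2) ℂ)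
    (hA : ‖A - A₀‖ ≤ e) (hB : ‖B - B₀‖ ≤ e) (hD : ‖D - D₀‖ ≤ e) :
    ∃ F ∈ Matrix.unitaryGroup (Fin 2) ℂ, ∃ G ∈ Matrix.unitaryGroup (Fin 2) ℂ,
      ∃ H ∈ Matrix.unitaryGroup (Fin 2) ℂ, ‖(flTurnUp rd A B D).1 - F‖ ≤ 600 * u ∧
        ‖(flTurnUp rd A B D).2.1 - G‖ ≤ 600 * u ∧ ‖(flTurnUp rd A B D).2.2 - H‖ ≤ 600 * u ∧
        ‖coreAt 3 0 F * coreAt 3 1 G * coreAt 3 0 H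
          - coreAt 3 1 A₀ * coreAt 3 0 B₀ * coreAt 3 1 D₀‖ ≤ 10 ^ 8 * e := by
  obtain ⟨F, hF, G, hG, H, hH, h1, h2, h3, h4⟩ := flTurnDown_spec h hu hue he
    (reverse_unitary hA₀) (reverse_unitary hB₀) (reverse_unitary hD₀)
    ((norm_reverse_sub A A₀).trans_le hA) ((norm_reverse_sub B B₀).trans_le hB)
    ((norm_reverse_sub D D₀).trans_le hD)
  refine ⟨reverse F, reverse_unitary hF, reverse G, reverse_unitary hG, reverse H,
    reverse_unitary hH, (norm_reverse_sub _ F).trans_le h1, (norm_reverse_sub _ G).trans_le h2,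
    (norm_reverse_sub _ H).trans_le h3, ?_⟩
  have key : ∀ A B D : Core, (coreAt 3 1 A * coreAt 3 0 B * coreAt 3 1 D).submatrix Fin.rev Fin.rev
      = coreAt 3 0 (reverse A) * coreAt 3 1 (reverse B) * coreAt 3 0 (reverse D) := by
    intro A B D
    rw [← (coreAt_three_submatrix_rev A).2, ← (coreAt_three_submatrix_rev B).1,
      ← (coreAt_three_submatrix_rev D).2]
    change _ = Matrix.submatrix _ Fin.rev (Fin.revPerm) * Matrix.submatrix _ Fin.revPerm Fin.revPerm
      * Matrix.submatrix _ Fin.revPerm Fin.rev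
    rw [Matrix.submatrix_mul_equiv, Matrix.submatrix_mul_equiv]
  have key' : (coreAt 3 0 (reverse A₀) * coreAt 3 1 (reverse B₀) *
      coreAt 3 0 (reverse D₀)).submatrix Fin.rev Fin.rev
      = coreAt 3 1 A₀ * coreAt 3 0 B₀ * coreAt 3 1 D₀ := by
    rw [← key]
    ext i j
    simp
  rw [← norm_submatrix_rev, Matrix.submatrix_sub, Pi.sub_apply, Pi.sub_apply, key, key'] at h4
  exact h4

end Turnover

/-! ### Exactly unitary companions of the stored core transformations -/

/-- `A₀` is a unitary companion of the stored core `A`. Deflation may be applied to a core again and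
again; the second alternative records that nothing changes from the second time on, so that the
distance stays bounded by `12 δ`. -/
structure Shadow (δ : ℝ) (A A₀ : Core) : Prop where
  unitary : A₀ ∈ Matrix.unitaryGroup (Fin 2) ℂ
  near : ‖A - A₀‖ ≤ 12 * δ
  sharp : ‖A - A₀‖ ≤ δ ∨ A 0 1 = 0 ∧ A 1 0 = 0

theorem Shadow.of_near {δ ε : ℝ} {A A₀ : Core} (hA₀ : A₀ ∈ Matrix.unitaryGroup (Fin 2) ℂ)
    (h : ‖A - A₀‖ ≤ ε) (hε : ε ≤ δ) : Shadow δ A A₀ where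
  unitary := hA₀
  near := by
    have := (norm_nonneg _).trans h
    linarith
  sharp := Or.inl (h.trans hε)

theorem Shadow.conjTranspose {δ : ℝ} {A A₀ : Core} (h : Shadow δ A A₀) : Shadow δ Aᴴ A₀ᴴ where
  unitary := conjTranspose_mem_unitary h.unitary
  near := (norm_conjTranspose_sub A A₀).trans_le h.near
  sharp := by
    rcases h.sharp with h1 | ⟨h1, h2⟩
    · exact Or.inl ((norm_conjTranspose_sub A A₀).trans_le h1)
    · exact Or.inr (by simp [h1, h2])

theorem exists_norm_one_near {z z₀ : ℂ} {δ c : ℝ} (hz : ‖z - z₀‖ ≤ δ) (hc : c ≤ 1 / 2)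
    (h : |‖z₀‖ - 1| ≤ c) :
    ∃ φ : ℂ, ‖φ‖ = 1 ∧ ‖z - φ‖ ≤ δ + c ∧ ‖φ - z₀‖ ≤ c := by
  have h0 : ‖z₀‖ ≠ 0 := by
    intro h0
    rw [h0] at h
    norm_num at h
    linarith
  have h1 : ‖z₀ / (‖z₀‖ : ℂ) - z₀‖ ≤ c := by
    have h0c : (‖z₀‖ : ℂ) ≠ 0 := by exact_mod_cast h0
    have : z₀ / (‖z₀‖ : ℂ) - z₀ = (z₀ / ‖z₀‖) * ((1 - ‖z₀‖ : ℝ) : ℂ) := by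
      push_cast; field_simp
    rw [this, norm_mul, norm_div, Complex.norm_real, Complex.norm_real, norm_norm, div_self h0,
      one_mul, Real.norm_eq_abs, abs_sub_comm]
    exact h
  refine ⟨z₀ / (‖z₀‖ : ℂ), by simp [h0], ?_, h1⟩
  have := norm_sub_le_sub_add z z₀ (z₀ / (‖z₀‖ : ℂ))
  rw [norm_sub_rev z₀] at this
  linarith

/-- Deflation moves the unitary companion by a multiple of `δ`. -/
theorem Shadow.deflate {δ u : ℝ} (hu : u ≤ δ) (hδ : δ ≤ 1 / 10 ^ 9) {A A₀ : Core}
    (h : Shadow δ A A₀) (hA : ‖A 1 0‖ ≤ u) :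
    ∃ A₁, Shadow δ !![A 0 0, 0; 0, A 1 1] A₁ ∧ ‖A₁ - A₀‖ ≤ 8 * δ := by
  norm_num at hδ
  rcases h.sharp with hs | ⟨h1, h2⟩
  -- The companion is almost diagonal; the phases of its diagonal entries form the new one.
  · have hδ0 : 0 ≤ δ := (norm_nonneg _).trans hs
    have e10 : ‖A₀ 1 0‖ ≤ 2 * δ := by
      have h1 := (norm_entry_sub_le A A₀ 1 0).trans hs
      have h2 := norm_sub_norm_le (A₀ 1 0) (A 1 0)
      rw [norm_sub_rev] at h2
      linarith
    have c0 := unitary_col_sum h.unitary 0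
    have r0 := unitary_row_sum h.unitary 0
    have r1 := unitary_row_sum h.unitary 1
    simp only [Fin.sum_univ_two] at c0 r0 r1
    have e01 : ‖A₀ 0 1‖ ≤ 2 * δ :=
      (le_of_sq_le_sq (by linarith) (norm_nonneg _)).trans e10
    have n00 : |‖A₀ 0 0‖ - 1| ≤ 2 * δ := by
      have := norm_nonneg (A₀ 0 0)
      have := norm_nonneg (A₀ 1 0)
      rw [abs_le]; constructor <;> nlinarith
    have n11 : |‖A₀ 1 1‖ - 1| ≤ 2 * δ := by
      have := norm_nonneg (A₀ 1 1)
      have := norm_nonneg (A₀ 1 0)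
      rw [abs_le]; constructor <;> nlinarith
    obtain ⟨φ, f1, f2, f3⟩ := exists_norm_one_near ((norm_entry_sub_le A A₀ 0 0).trans hs)
      (by linarith) n00
    obtain ⟨ψ, g1, g2, g3⟩ := exists_norm_one_near ((norm_entry_sub_le A A₀ 1 1).trans hs)
      (by linarith) n11
    refine ⟨!![φ, 0; 0, ψ], ⟨?_, ?_, Or.inr ⟨rfl, rfl⟩⟩, ?_⟩
    · rw [Matrix.mem_unitaryGroup_iff]
      have hf : φ * (starRingEnd ℂ) φ = 1 := by rw [Complex.mul_conj', f1]; simp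
      have hg : ψ * (starRingEnd ℂ) ψ = 1 := by rw [Complex.mul_conj', g1]; simp
      ext i j
      fin_cases i <;> fin_cases j <;> simp [Matrix.mul_apply, Fin.sum_univ_two, hf, hg]
    · refine (norm_le_of_entries _ (e := 3 * δ) ?_).trans (by norm_num; linarith)
      intro i j
      fin_cases i <;> fin_cases j
      · simpa using f2.trans (by linarith)
      · simpa using hδ0
      · simpa using hδ0
      · simpa using g2.trans (by linarith)
    · refine (norm_le_of_entries _ (e := 2 * δ) ?_).trans (by norm_num; linarith)
      intro i j
      fin_cases i <;> fin_cases j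
      · simpa using f3
      · simpa using e01
      · simpa using e10
      · simpa using g3
  -- A core that is already diagonal is left unchanged.
  · have hA' : !![A 0 0, 0; 0, A 1 1] = A := by
      ext i j
      fin_cases i <;> fin_cases j <;> simp [h1, h2]
    rw [hA']
    refine ⟨A₀, h, ?_⟩
    have := (norm_nonneg _).trans h.near
    simpa using by linarith

/-- A stored word of core transformations and its unitary companion. -/
def ShadowWord (δ : ℝ) (n : ℕ) : List (ℕ × Core) → List (ℕ × Core) → Prop :=
  List.Forall₂ fun c c₀ => c.1 = c₀.1 ∧ c.1 + 1 < n ∧ Shadow δ c.2 c₀.2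

theorem ShadowWord.append {δ : ℝ} {n : ℕ} {a b a₀ b₀ : List (ℕ × Core)} (h : ShadowWord δ n a a₀)
    (h' : ShadowWord δ n b b₀) : ShadowWord δ n (a ++ b) (a₀ ++ b₀) := by
  unfold ShadowWord at *
  induction h with
  | nil => exact h'
  | cons h1 _ ih => exact List.Forall₂.cons h1 ih

theorem ShadowWord.of_append {δ : ℝ} {n : ℕ} : ∀ {a b w : List (ℕ × Core)},
    ShadowWord δ n (a ++ b) w →
      ∃ a₀ b₀, w = a₀ ++ b₀ ∧ ShadowWord δ n a a₀ ∧ ShadowWord δ n b b₀ := by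
  intro a
  induction a with
  | nil => exact fun {b w} h => ⟨[], w, rfl, List.Forall₂.nil, h⟩
  | cons c a ih =>
    intro b w h
    obtain ⟨c₀, w', h1, h2, rfl⟩ := List.forall₂_cons_left_iff.1 h
    obtain ⟨a₀, b₀, rfl, h3, h4⟩ := ih h2
    exact ⟨c₀ :: a₀, b₀, rfl, List.Forall₂.cons h1 h3, h4⟩

theorem ShadowWord.of_cons {δ : ℝ} {n i : ℕ} {A : Core} {b w : List (ℕ × Core)}
    (h : ShadowWord δ n ((i, A) :: b) w) :
    ∃ A₀ b₀, w = (i, A₀) :: b₀ ∧ i + 1 < n ∧ Shadow δ A A₀ ∧ ShadowWord δ n b b₀ := by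
  obtain ⟨⟨i', A₀⟩, b₀, ⟨h1, h2, h3⟩, h4, rfl⟩ := List.forall₂_cons_left_iff.1 h
  simp only at h1 h2 h3
  exact ⟨A₀, b₀, by rw [h1], h2, h3, h4⟩

theorem ShadowWord.cons {δ : ℝ} {n i : ℕ} {A A₀ : Core} {b b₀ : List (ℕ × Core)} (hi : i + 1 < n)
    (h : Shadow δ A A₀) (hb : ShadowWord δ n b b₀) :
    ShadowWord δ n ((i, A) :: b) ((i, A₀) :: b₀) :=
  List.Forall₂.cons ⟨rfl, hi, h⟩ hb

theorem ShadowWord.nil {δ : ℝ} {n : ℕ} : ShadowWord δ n [] [] := List.Forall₂.nil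

theorem wordMat_append (n : ℕ) (a b : List (ℕ × Core)) :
    wordMat n (a ++ b) = wordMat n a * wordMat n b := by simp [wordMat]

theorem wordMat_cons (n i : ℕ) (A : Core) (b : List (ℕ × Core)) :
    wordMat n ((i, A) :: b) = coreAt n i A * wordMat n b := by simp [wordMat]

theorem wordMat_nil (n : ℕ) : wordMat n [] = 1 := by simp [wordMat]

theorem ShadowWord.unitary {δ : ℝ} {n : ℕ} {w w₀ : List (ℕ × Core)} (h : ShadowWord δ n w w₀) :
    wordMat n w₀ ∈ Matrix.unitaryGroup (Fin n) ℂ := by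
  unfold ShadowWord at h
  induction h with
  | nil => rw [wordMat_nil]; exact one_mem _
  | cons h1 _ ih =>
    rw [wordMat, List.map_cons, List.prod_cons]
    exact mul_mem (coreAt_unitary (h1.1 ▸ h1.2.1) h1.2.2.unitary) ih

/-- Changing a middle part of a word of unitary core transformations. -/
theorem norm_wordMat_replace {δ : ℝ} {n : ℕ} {l r l₀ r₀ m m' : List (ℕ × Core)}
    (hl : ShadowWord δ n l l₀) (hr : ShadowWord δ n r r₀) :
    ‖wordMat n (l₀ ++ (m' ++ r₀)) - wordMat n (l₀ ++ (m ++ r₀))‖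
      = ‖wordMat n m' - wordMat n m‖ := by
  simp only [wordMat_append]
  rw [← Matrix.mul_sub, norm_unitary_mul hl.unitary, ← Matrix.sub_mul, norm_mul_unitary hr.unitary]

/-! ### Pass-through operations on the sequences of a triangular factor -/

theorem descending_update {n i : ℕ} (h : i + 1 < n) (C : ℕ → Core) (X Y : Core) :
    descending n (Function.update (Function.update C i X) (i + 1) Y) =
      ((List.range i).map fun p => coreAt (n + 1) p (C p)).prod *
        (coreAt (n + 1) i X * coreAt (n + 1) (i + 1) Y) *
        ((List.range' (i + 2) (n - i - 2)).map fun p => coreAt (n + 1) p (C p)).prod := by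
  rw [descending_split h]
  have h1 : (List.range i).map (fun p => coreAt (n + 1) p
      (Function.update (Function.update C i X) (i + 1) Y p))
      = (List.range i).map fun p => coreAt (n + 1) p (C p) := by
    refine List.map_congr_left fun p hp => ?_
    have := List.mem_range.1 hp
    rw [Function.update_of_ne (by omega), Function.update_of_ne (by omega)]
  have h2 : (List.range' (i + 2) (n - i - 2)).map (fun p => coreAt (n + 1) p
      (Function.update (Function.update C i X) (i + 1) Y p))
      = (List.range' (i + 2) (n - i - 2)).map fun p => coreAt (n + 1) p (C p) := by
    refine List.map_congr_left fun p hp => ?_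
    have := List.mem_range'_1.1 hp
    rw [Function.update_of_ne (by omega), Function.update_of_ne (by omega)]
  rw [h1, h2, Function.update_self, Function.update_of_ne (by omega), Function.update_self]

theorem conjugate_pass {n : ℕ} {w g pre post x y c c' : Matrix (Fin n) (Fin n) ℂ}
    (hw : w * wᴴ = 1) (hpre : w * pre = pre * w) (hpost : g * post = post * g) :
    w * (pre * (x * y) * post - wᴴ * (pre * (c * c') * post) * g)
      = pre * (w * x * y - c * c' * g) * post := by
  rw [Matrix.mul_sub, Matrix.mul_sub, Matrix.sub_mul]
  congr 1
  · simp only [← Matrix.mul_assoc]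
    rw [hpre]
  · calc w * (wᴴ * (pre * (c * c') * post) * g) = (w * wᴴ) * (pre * (c * c') * (post * g)) := by
          simp only [Matrix.mul_assoc]
      _ = _ := by rw [hw, Matrix.one_mul, ← hpost]; simp only [Matrix.mul_assoc]

/-- A turnover with the entries `i`, `i + 1` of a descending sequence moves a core transformation
through the whole sequence, with the same error. -/
theorem norm_descending_pass {n i : ℕ} (h : i + 1 < n) {C : ℕ → Core}
    (hC : ∀ p, C p ∈ Matrix.unitaryGroup (Fin 2) ℂ) {W X Y G : Core}
    (hW : W ∈ Matrix.unitaryGroup (Fin 2) ℂ) {η : ℝ}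
    (herr : ‖coreAt (n + 1) (i + 1) W * coreAt (n + 1) i X * coreAt (n + 1) (i + 1) Y
      - coreAt (n + 1) i (C i) * coreAt (n + 1) (i + 1) (C (i + 1)) * coreAt (n + 1) i G‖ ≤ η) :
    ‖descending n (Function.update (Function.update C i X) (i + 1) Y)
      - (coreAt (n + 1) (i + 1) W)ᴴ * descending n C * coreAt (n + 1) i G‖ ≤ η := by
  rw [descending_update h, descending_split h C]
  set pre := ((List.range i).map fun p => coreAt (n + 1) p (C p)).prod with hpre
  set post := ((List.range' (i + 2) (n - i - 2)).map fun p => coreAt (n + 1) p (C p)).prod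
    with hpost
  have upre : pre ∈ Matrix.unitaryGroup (Fin (n + 1)) ℂ := by
    refine listProd_unitary fun A hA => ?_
    obtain ⟨p, hp, rfl⟩ := List.mem_map.1 hA
    have := List.mem_range.1 hp
    exact coreAt_unitary (by omega) (hC p)
  have upost : post ∈ Matrix.unitaryGroup (Fin (n + 1)) ℂ := by
    refine listProd_unitary fun A hA => ?_
    obtain ⟨p, hp, rfl⟩ := List.mem_map.1 hA
    have := List.mem_range'_1.1 hp
    exact coreAt_unitary (by omega) (hC p)
  have cpre : coreAt (n + 1) (i + 1) W * pre = pre * coreAt (n + 1) (i + 1) W := by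
    refine Commute.list_prod_right _ _ fun A hA => ?_
    obtain ⟨p, hp, rfl⟩ := List.mem_map.1 hA
    have := List.mem_range.1 hp
    exact coreAt_commute (by omega) _ _
  have cpost : coreAt (n + 1) i G * post = post * coreAt (n + 1) i G := by
    refine Commute.list_prod_right _ _ fun A hA => ?_
    obtain ⟨p, hp, rfl⟩ := List.mem_map.1 hA
    have := List.mem_range'_1.1 hp
    exact coreAt_commute (by omega) _ _
  have uW := coreAt_unitary (n := n + 1) (i := i + 1) (by omega) hW
  have hWW := Matrix.mem_unitaryGroup_iff.1 uW
  rw [Matrix.star_eq_conjTranspose] at hWW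
  rw [← norm_unitary_mul uW, conjugate_pass hWW cpre cpost, norm_mul_unitary upost,
    norm_unitary_mul upre]
  exact herr

/-! ### The computation up to exact unitary transformations -/

/-- Exactly unitary data that accompany a stored configuration: companions `word`, `C`, `B` of all
stored core transformations, and the accumulated unitary transformations. The transformation `T j`
acts on the left of the word `𝒬_j` (for `j = 0` from outside, otherwise from the factor to its
left), `L j` acts on its right (for `j = k` from outside, otherwise from the factor to its right),
and `W j` acts between `𝒞ᴴ` and `ℬ` in the factor number `j`. -/
structure Companion (n k : ℕ) where
  word : Fin (k + 1) → List (ℕ × Core)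
  C : Fin k → ℕ → Core
  B : Fin k → ℕ → Core
  T : Fin (k + 1) → Matrix (Fin n) (Fin n) ℂ
  L : Fin (k + 1) → Matrix (Fin n) (Fin n) ℂ
  W : Fin k → Matrix (Fin (n + 1)) (Fin (n + 1)) ℂ

/-- The companion data describe the configuration `s` relative to the matrices `Q`, `C₀`, `B₀`, with
errors `e` and `f` in the words and the sequences of the factors, and `p` in the record of the
equivalence transformation. -/
structure Tracks {n k : ℕ} (δ e f p : ℝ) (Q : Fin (k + 1) → Matrix (Fin n) (Fin n) ℂ)
    (C₀ B₀ : Fin k → Matrix (Fin (n + 1)) (Fin (n + 1)) ℂ) (s : Conf n k) (X : Companion n k) :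
    Prop where
  word : ∀ j, ShadowWord δ n (s.word j) (X.word j)
  C : ∀ j i, Shadow δ (s.C j i) (X.C j i)
  B : ∀ j i, Shadow δ (s.B j i) (X.B j i)
  T_unitary : ∀ j, X.T j ∈ Matrix.unitaryGroup (Fin n) ℂ
  L_unitary : ∀ j, X.L j ∈ Matrix.unitaryGroup (Fin n) ℂ
  W_unitary : ∀ j, X.W j ∈ Matrix.unitaryGroup (Fin (n + 1)) ℂ
  W_fix : ∀ j, X.W j * incl (n + 1) 0 1 = incl (n + 1) 0 1
  word_err : ∀ j, ‖wordMat n (X.word j) - (X.T j)ᴴ * Q j * X.L j‖ ≤ e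
  C_err : ∀ j, ‖descending n (X.C j) - (X.W j)ᴴ * C₀ j * blockAt (n + 1) 0 (X.L j.castSucc)‖ ≤ f
  B_err : ∀ j, ‖descending n (X.B j) - (X.W j)ᴴ * B₀ j * blockAt (n + 1) 0 (X.T j.succ)‖ ≤ f
  U_err : ‖s.U - X.T 0‖ ≤ p
  V_err : ‖s.V - X.L (Fin.last k)‖ ≤ p

section Step

variable {n k : ℕ} {δ e f p η : ℝ} {Q : Fin (k + 1) → Matrix (Fin n) (Fin n) ℂ}
  {C₀ B₀ : Fin k → Matrix (Fin (n + 1)) (Fin (n + 1)) ℂ} {s : Conf n k} {X : Companion n k}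

theorem Tracks.mono {e' f' p' : ℝ} (h : Tracks δ e f p Q C₀ B₀ s X) (he : e ≤ e') (hf : f ≤ f')
    (hp : p ≤ p') : Tracks δ e' f' p' Q C₀ B₀ s X :=
  { h with
    word_err := fun j => (h.word_err j).trans he
    C_err := fun j => (h.C_err j).trans hf
    B_err := fun j => (h.B_err j).trans hf
    U_err := h.U_err.trans hp
    V_err := h.V_err.trans hp }

/-- An operation inside one of the words. -/
theorem Tracks.setWord (h : Tracks δ e f p Q C₀ B₀ s X) (hη : 0 ≤ η) (j : Fin (k + 1))
    {w w₀ : List (ℕ × Core)} (hw : ShadowWord δ n w w₀)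
    (herr : ‖wordMat n w₀ - wordMat n (X.word j)‖ ≤ η) :
    ∃ Y, Tracks δ (e + η) (f + η) p Q C₀ B₀ (s.setWord j w) Y := by
  refine ⟨{ X with word := Function.update X.word j w₀ }, ?_⟩
  refine { h with
    word := fun i => ?_
    word_err := fun i => ?_
    C_err := fun i => (h.C_err i).trans (by linarith)
    B_err := fun i => (h.B_err i).trans (by linarith) }
  · rcases eq_or_ne i j with rfl | hij
    · simpa [Conf.setWord] using hw
    · simpa [Conf.setWord, hij] using h.word i
  · rcases eq_or_ne i j with rfl | hij
    · have := h.word_err i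
      simp only [Function.update_self]
      refine (norm_sub_le_sub_add _ (wordMat n (X.word i)) _).trans ?_
      linarith
    · simpa [hij] using (h.word_err i).trans (by linarith)

theorem norm_mul_sub_le_of_unitary {m : ℕ} {A A₀ G : Matrix (Fin m) (Fin m) ℂ}
    (hG : G ∈ Matrix.unitaryGroup (Fin m) ℂ) {c : ℝ} (h : ‖A - A₀‖ ≤ c) :
    ‖A * G - A₀ * G‖ ≤ c := by
  rw [← Matrix.sub_mul, norm_mul_unitary hG]; exact h

theorem norm_unitary_mul_sub_le {m : ℕ} {A A₀ G : Matrix (Fin m) (Fin m) ℂ}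
    (hG : G ∈ Matrix.unitaryGroup (Fin m) ℂ) {c : ℝ} (h : ‖A - A₀‖ ≤ c) :
    ‖G * A - G * A₀‖ ≤ c := by
  rw [← Matrix.mul_sub, norm_unitary_mul hG]; exact h

/-- A transformation from the left of the whole product. -/
theorem Tracks.left (h : Tracks δ e f p Q C₀ B₀ s X) {w w₀ : List (ℕ × Core)}
    (hw : ShadowWord δ n w w₀) {i : ℕ} (hi : i + 1 < n) {G G₀ : Core} (hG : Shadow δ G G₀)
    (herr : wordMat n w₀ = (coreAt n i G₀)ᴴ * wordMat n (X.word 0)) :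
    ∃ Y, Tracks δ e f (p + 12 * δ + p * (12 * δ)) Q C₀ B₀
      { s.setWord 0 w with U := s.U * coreAt n i G } Y := by
  have hGu := coreAt_unitary hi hG.unitary
  have hp : 0 ≤ p := (norm_nonneg _).trans h.U_err
  have hδ : 0 ≤ 12 * δ := (norm_nonneg _).trans hG.near
  refine ⟨{ X with
    word := Function.update X.word 0 w₀
    T := Function.update X.T 0 (X.T 0 * coreAt n i G₀) }, ?_⟩
  refine { h with
    word := fun j => ?_
    T_unitary := fun j => ?_
    word_err := fun j => ?_
    B_err := fun j => ?_
    U_err := ?_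
    V_err := h.V_err.trans (by nlinarith) }
  · rcases eq_or_ne j 0 with rfl | hj
    · simpa [Conf.setWord] using hw
    · simpa [Conf.setWord, hj] using h.word j
  · rcases eq_or_ne j 0 with rfl | hj
    · simpa using mul_mem (h.T_unitary 0) hGu
    · simpa [hj] using h.T_unitary j
  · rcases eq_or_ne j 0 with rfl | hj
    · simp only [Function.update_self, herr, Matrix.conjTranspose_mul, Matrix.mul_assoc]
      have := norm_unitary_mul_sub_le (conjTranspose_mem_unitary hGu) (h.word_err 0)
      simpa only [Matrix.mul_assoc] using this
    · simpa [hj] using h.word_err j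
  · simpa [Fin.succ_ne_zero] using h.B_err j
  · simp only [Function.update_self]
    exact norm_mul_sub_mul_le (h.T_unitary 0) hGu h.U_err
      ((norm_coreAt_sub hi G G₀).trans_le hG.near)

/-- A transformation from the right of the whole product. -/
theorem Tracks.right (h : Tracks δ e f p Q C₀ B₀ s X) {w w₀ : List (ℕ × Core)}
    (hw : ShadowWord δ n w w₀) {i : ℕ} (hi : i + 1 < n) {G G₀ : Core} (hG : Shadow δ G G₀)
    (herr : wordMat n w₀ = wordMat n (X.word (Fin.last k)) * coreAt n i G₀) :
    ∃ Y, Tracks δ e f (p + 12 * δ + p * (12 * δ)) Q C₀ B₀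
      { s.setWord (Fin.last k) w with V := s.V * coreAt n i G } Y := by
  have hGu := coreAt_unitary hi hG.unitary
  have hp : 0 ≤ p := (norm_nonneg _).trans h.U_err
  have hδ : 0 ≤ 12 * δ := (norm_nonneg _).trans hG.near
  refine ⟨{ X with
    word := Function.update X.word (Fin.last k) w₀
    L := Function.update X.L (Fin.last k) (X.L (Fin.last k) * coreAt n i G₀) }, ?_⟩
  refine { h with
    word := fun j => ?_
    L_unitary := fun j => ?_
    word_err := fun j => ?_
    C_err := fun j => ?_
    U_err := h.U_err.trans (by nlinarith)
    V_err := ?_ }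
  · rcases eq_or_ne j (Fin.last k) with rfl | hj
    · simpa [Conf.setWord] using hw
    · simpa [Conf.setWord, hj] using h.word j
  · rcases eq_or_ne j (Fin.last k) with rfl | hj
    · simpa using mul_mem (h.L_unitary (Fin.last k)) hGu
    · simpa [hj] using h.L_unitary j
  · rcases eq_or_ne j (Fin.last k) with rfl | hj
    · simp only [Function.update_self, herr, ← Matrix.mul_assoc]
      exact norm_mul_sub_le_of_unitary hGu (h.word_err _)
    · simpa [hj] using h.word_err j
  · simpa [(Fin.castSucc_lt_last j).ne] using h.C_err j
  · simp only [Function.update_self]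
    exact norm_mul_sub_mul_le (h.L_unitary _) hGu h.V_err
      ((norm_coreAt_sub hi G G₀).trans_le hG.near)

theorem norm_gauge_update_le {m : ℕ} {D D' W W' C E G : Matrix (Fin m) (Fin m) ℂ} {c c' : ℝ}
    (hW' : W' ∈ Matrix.unitaryGroup (Fin m) ℂ) (hG : G ∈ Matrix.unitaryGroup (Fin m) ℂ)
    (h : ‖D - Wᴴ * C * E‖ ≤ c) (h' : ‖D' - W'ᴴ * D * G‖ ≤ c') :
    ‖D' - (W * W')ᴴ * C * (E * G)‖ ≤ c + c' := by
  have h1 : ‖W'ᴴ * D * G - W'ᴴ * (Wᴴ * C * E) * G‖ ≤ c :=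
    norm_mul_sub_le_of_unitary hG (norm_unitary_mul_sub_le (conjTranspose_mem_unitary hW') h)
  have h2 : (W * W')ᴴ * C * (E * G) = W'ᴴ * (Wᴴ * C * E) * G := by
    rw [Matrix.conjTranspose_mul]; simp only [Matrix.mul_assoc]
  rw [h2]
  have := norm_sub_le_sub_add D' (W'ᴴ * D * G) (W'ᴴ * (Wᴴ * C * E) * G)
  linarith

/-- A core transformation passes through the factor number `j`: the transformation `G₁` is applied
on its left, `G₂` on its right, and `W` in its middle. -/
theorem Tracks.pass (h : Tracks δ e f p Q C₀ B₀ s X) (hη : 0 ≤ η) (j : Fin k)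
    {w₁ w₂ v₁ v₂ : List (ℕ × Core)} (hw₁ : ShadowWord δ n w₁ v₁) (hw₂ : ShadowWord δ n w₂ v₂)
    {i : ℕ} {c₀ c₁ b₀ b₁ c₀' c₁' b₀' b₁' : Core} (hc₀ : Shadow δ c₀ c₀') (hc₁ : Shadow δ c₁ c₁')
    (hb₀ : Shadow δ b₀ b₀') (hb₁ : Shadow δ b₁ b₁')
    {G₁ G₂ : Matrix (Fin n) (Fin n) ℂ} {W : Matrix (Fin (n + 1)) (Fin (n + 1)) ℂ}
    (hG₁ : G₁ ∈ Matrix.unitaryGroup (Fin n) ℂ) (hG₂ : G₂ ∈ Matrix.unitaryGroup (Fin n) ℂ)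
    (hW : W ∈ Matrix.unitaryGroup (Fin (n + 1)) ℂ)
    (hWfix : W * incl (n + 1) 0 1 = incl (n + 1) 0 1)
    (hv₁ : wordMat n v₁ = wordMat n (X.word j.castSucc) * G₁)
    (hv₂ : wordMat n v₂ = G₂ᴴ * wordMat n (X.word j.succ))
    (hC : ‖descending n (Function.update (Function.update (X.C j) i c₀') (i + 1) c₁')
      - Wᴴ * descending n (X.C j) * blockAt (n + 1) 0 G₁‖ ≤ η)
    (hB : ‖descending n (Function.update (Function.update (X.B j) i b₀') (i + 1) b₁')
      - Wᴴ * descending n (X.B j) * blockAt (n + 1) 0 G₂‖ ≤ η) :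
    ∃ Y, Tracks δ (e + η) (f + η) p Q C₀ B₀
      (((s.setWord j.succ w₂).setWord j.castSucc w₁).setFactor j i c₀ c₁ b₀ b₁) Y := by
  have hne : j.castSucc ≠ j.succ := Fin.castSucc_lt_succ.ne
  have hLext : ∀ A : Matrix (Fin n) (Fin n) ℂ, blockAt (n + 1) 0 (A * G₁)
      = blockAt (n + 1) 0 A * blockAt (n + 1) 0 G₁ := fun A => (blockAt_mul (by omega) _ _).symm
  have hText : ∀ A : Matrix (Fin n) (Fin n) ℂ, blockAt (n + 1) 0 (A * G₂)
      = blockAt (n + 1) 0 A * blockAt (n + 1) 0 G₂ := fun A => (blockAt_mul (by omega) _ _).symm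
  have uG₁ : blockAt (n + 1) 0 G₁ ∈ Matrix.unitaryGroup (Fin (n + 1)) ℂ :=
    blockAt_unitary (by omega) hG₁
  have uG₂ : blockAt (n + 1) 0 G₂ ∈ Matrix.unitaryGroup (Fin (n + 1)) ℂ :=
    blockAt_unitary (by omega) hG₂
  refine ⟨{
    word := Function.update (Function.update X.word j.succ v₂) j.castSucc v₁
    C := Function.update X.C j (Function.update (Function.update (X.C j) i c₀') (i + 1) c₁')
    B := Function.update X.B j (Function.update (Function.update (X.B j) i b₀') (i + 1) b₁')
    T := Function.update X.T j.succ (X.T j.succ * G₂)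
    L := Function.update X.L j.castSucc (X.L j.castSucc * G₁)
    W := Function.update X.W j (X.W j * W) }, ?_⟩
  refine {
    word := fun l => ?_
    C := fun l m => ?_
    B := fun l m => ?_
    T_unitary := fun l => ?_
    L_unitary := fun l => ?_
    W_unitary := fun l => ?_
    W_fix := fun l => ?_
    word_err := fun l => ?_
    C_err := fun l => ?_
    B_err := fun l => ?_
    U_err := ?_
    V_err := ?_ }
  · rcases eq_or_ne l j.castSucc with rfl | h1
    · simpa [Conf.setWord, Conf.setFactor] using hw₁
    · rcases eq_or_ne l j.succ with rfl | h2
      · simpa [Conf.setWord, Conf.setFactor, hne.symm] using hw₂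
      · simpa [Conf.setWord, Conf.setFactor, h1, h2] using h.word l
  · rcases eq_or_ne l j with rfl | h1
    · simp only [Conf.setWord, Conf.setFactor, Function.update_self]
      rcases eq_or_ne m (i + 1) with rfl | h2
      · simpa using hc₁
      · rcases eq_or_ne m i with rfl | h3
        · simpa using hc₀
        · simpa [h2, h3] using h.C l m
    · simpa [Conf.setWord, Conf.setFactor, h1] using h.C l m
  · rcases eq_or_ne l j with rfl | h1
    · simp only [Conf.setWord, Conf.setFactor, Function.update_self]
      rcases eq_or_ne m (i + 1) with rfl | h2
      · simpa using hb₁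
      · rcases eq_or_ne m i with rfl | h3
        · simpa using hb₀
        · simpa [h2, h3] using h.B l m
    · simpa [Conf.setWord, Conf.setFactor, h1] using h.B l m
  · rcases eq_or_ne l j.succ with rfl | h1
    · simpa using mul_mem (h.T_unitary _) hG₂
    · simpa [h1] using h.T_unitary l
  · rcases eq_or_ne l j.castSucc with rfl | h1
    · simpa using mul_mem (h.L_unitary _) hG₁
    · simpa [h1] using h.L_unitary l
  · rcases eq_or_ne l j with rfl | h1
    · simpa using mul_mem (h.W_unitary _) hW
    · simpa [h1] using h.W_unitary l
  · rcases eq_or_ne l j with rfl | h1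
    · simp only [Function.update_self, Matrix.mul_assoc, hWfix, h.W_fix]
    · simpa [h1] using h.W_fix l
  · have key : ∀ l, ‖wordMat n (X.word l) - (X.T l)ᴴ * Q l * X.L l‖ ≤ e + η :=
      fun l => (h.word_err l).trans (by linarith)
    rcases eq_or_ne l j.castSucc with rfl | h1
    · simp only [Function.update_self, Function.update_of_ne hne, hv₁, ← Matrix.mul_assoc]
      exact norm_mul_sub_le_of_unitary hG₁ (key _)
    · rcases eq_or_ne l j.succ with rfl | h2
      · simp only [Function.update_self, Function.update_of_ne hne.symm, hv₂,
          Matrix.conjTranspose_mul, Matrix.mul_assoc]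
        have := norm_unitary_mul_sub_le (conjTranspose_mem_unitary hG₂) (key j.succ)
        simpa only [Matrix.mul_assoc] using this
      · simpa [h1, h2] using key l
  · rcases eq_or_ne l j with rfl | h1
    · simp only [Function.update_self, hLext]
      exact norm_gauge_update_le hW uG₁ (h.C_err l) hC
    · have h2 : l.castSucc ≠ j.castSucc := fun hc => h1 (Fin.castSucc_injective _ hc)
      simp only [Function.update_of_ne h1, Function.update_of_ne h2]
      exact (h.C_err l).trans (by linarith)
  · rcases eq_or_ne l j with rfl | h1
    · simp only [Function.update_self, hText]
      exact norm_gauge_update_le hW uG₂ (h.B_err l) hB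
    · have h2 : l.succ ≠ j.succ := fun hc => h1 (Fin.succ_injective _ hc)
      simp only [Function.update_of_ne h1, Function.update_of_ne h2]
      exact (h.B_err l).trans (by linarith)
  · simpa [Conf.setWord, Conf.setFactor, (Fin.succ_ne_zero j).symm] using h.U_err
  · simpa [Conf.setWord, Conf.setFactor, (Fin.castSucc_lt_last j).ne'] using h.V_err

end Step

section

variable {n k : ℕ} {δ e f p u κ : ℝ} {rd : ℝ → ℝ} {Q : Fin (k + 1) → Matrix (Fin n) (Fin n) ℂ}
  {C₀ B₀ : Fin k → Matrix (Fin (n + 1)) (Fin (n + 1)) ℂ} {s s' : Conf n k} {X : Companion n k}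

theorem blockAt_coreAt {i : ℕ} (hi : i + 1 < n) (A : Core) :
    blockAt (n + 1) 0 (coreAt n i A) = coreAt (n + 1) i A := by
  rw [coreAt_eq_blockAt, coreAt_eq_blockAt, blockAt_blockAt (by omega), zero_add]

theorem coreAt_mul_incl_zero {m i : ℕ} (A : Core) :
    coreAt m (i + 1) A * incl m 0 1 = incl m 0 1 := by
  rw [coreAt_eq_blockAt, blockAt_mul_incl_of_disjoint (by omega)]

/-- Adjoint form of the error of a turnover with `𝒞ᴴ`. -/
theorem norm_turn_adjoint {m : ℕ} {x y z a b c : Matrix (Fin m) (Fin m) ℂ} {η : ℝ}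
    (hx : x ∈ Matrix.unitaryGroup (Fin m) ℂ) (hc : c ∈ Matrix.unitaryGroup (Fin m) ℂ)
    (h : ‖x * y * z - a * b * c‖ ≤ η) : ‖c * zᴴ * yᴴ - bᴴ * aᴴ * x‖ ≤ η := by
  have h1 := Matrix.mem_unitaryGroup_iff.1 hc
  have h2 := Matrix.mem_unitaryGroup_iff'.1 hx
  rw [Matrix.star_eq_conjTranspose] at h1 h2
  have h3 : c * zᴴ * yᴴ - bᴴ * aᴴ * x = c * (x * y * z - a * b * c)ᴴ * x := by
    simp only [Matrix.conjTranspose_sub, Matrix.conjTranspose_mul, Matrix.mul_sub, Matrix.sub_mul]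
    congr 1
    · simp only [Matrix.mul_assoc, h2, Matrix.mul_one]
    · simp only [← Matrix.mul_assoc, h1, Matrix.one_mul]
  rw [h3, norm_mul_unitary hx, norm_unitary_mul hc, Matrix.frobenius_norm_conjTranspose]
  exact h

theorem norm_turn_outer {m : ℕ} {x y z a b c : Matrix (Fin m) (Fin m) ℂ} {η : ℝ}
    (ha : a ∈ Matrix.unitaryGroup (Fin m) ℂ) (hz : z ∈ Matrix.unitaryGroup (Fin m) ℂ)
    (h : ‖x * y * z - a * b * c‖ ≤ η) : ‖aᴴ * x * y - b * c * zᴴ‖ ≤ η := by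
  have h1 := Matrix.mem_unitaryGroup_iff'.1 ha
  have h2 := Matrix.mem_unitaryGroup_iff.1 hz
  rw [Matrix.star_eq_conjTranspose] at h1 h2
  have h3 : aᴴ * x * y - b * c * zᴴ = aᴴ * (x * y * z - a * b * c) * zᴴ := by
    simp only [Matrix.mul_sub, Matrix.sub_mul]
    congr 1
    · simp only [Matrix.mul_assoc, h2, Matrix.mul_one]
    · simp only [← Matrix.mul_assoc, h1, Matrix.one_mul]
  rw [h3, norm_mul_unitary (conjTranspose_mem_unitary hz),
    norm_unitary_mul (conjTranspose_mem_unitary ha)]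
  exact h

/-- One floating point operation: the companion data are transformed exactly, up to errors that are
multiples of `δ` and do not depend on the past. -/
theorem FlStep.tracks (hrd : IsRounding u rd) (hu : 0 ≤ u) (hδu : 600 * u ≤ δ) (hκ : κ * u ≤ δ)
    (hδ : 12 * δ ≤ 1 / 10 ^ 9) (hs : FlStep rd u κ s s') (h : Tracks δ e f p Q C₀ B₀ s X) :
    ∃ Y, Tracks δ (e + 10 ^ 8 * (12 * δ)) (f + 10 ^ 8 * (12 * δ)) (p + 12 * δ + p * (12 * δ))
      Q C₀ B₀ s' Y := by
  have hp : 0 ≤ p := (norm_nonneg _).trans h.U_err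
  have hδ0 : 0 ≤ δ := by linarith
  have hη : 0 ≤ 10 ^ 8 * (12 * δ) := by positivity
  have hud : u ≤ 12 * δ := by linarith
  have hpp : p ≤ p + 12 * δ + p * (12 * δ) := by nlinarith
  have of_word : ∀ {t : Conf n k},
      (∃ Y, Tracks δ (e + 10 ^ 8 * (12 * δ)) (f + 10 ^ 8 * (12 * δ)) p Q C₀ B₀ t Y) →
      ∃ Y, Tracks δ (e + 10 ^ 8 * (12 * δ)) (f + 10 ^ 8 * (12 * δ)) (p + 12 * δ + p * (12 * δ))
        Q C₀ B₀ t Y := fun ⟨Y, hY⟩ => ⟨Y, hY.mono le_rfl le_rfl hpp⟩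
  have of_outer : ∀ {t : Conf n k},
      (∃ Y, Tracks δ e f (p + 12 * δ + p * (12 * δ)) Q C₀ B₀ t Y) →
      ∃ Y, Tracks δ (e + 10 ^ 8 * (12 * δ)) (f + 10 ^ 8 * (12 * δ)) (p + 12 * δ + p * (12 * δ))
        Q C₀ B₀ t Y := fun ⟨Y, hY⟩ => ⟨Y, hY.mono (by linarith) (by linarith) le_rfl⟩
  induction hs with
  | swap j l r i i' A A' hi hj =>
    refine of_word ?_
    have hw := h.word j
    rw [hj] at hw
    obtain ⟨l₀, m₀, h0, hl, hm⟩ := hw.of_append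
    obtain ⟨A₀, m₁, rfl, hiA, hA, hm1⟩ := hm.of_cons
    obtain ⟨A₁, r₀, rfl, hiA', hA', hr⟩ := hm1.of_cons
    refine h.setWord hη j (hl.append (.cons hiA' hA' (.cons hiA hA hr))) ?_
    have hc := (coreAt_commute (n := n) hi A₀ A₁).eq
    have : wordMat n (l₀ ++ (i', A₁) :: (i, A₀) :: r₀) = wordMat n (X.word j) := by
      rw [h0]
      simp only [wordMat_append, wordMat_cons]
      rw [← Matrix.mul_assoc (coreAt n i' A₁), ← hc, Matrix.mul_assoc]
    rw [this, sub_self, norm_zero]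
    exact hη
  | fuse j l r i A A' hj =>
    refine of_word ?_
    have hw := h.word j
    rw [hj] at hw
    obtain ⟨l₀, m₀, h0, hl, hm⟩ := hw.of_append
    obtain ⟨A₀, m₁, rfl, hi, hA, hm1⟩ := hm.of_cons
    obtain ⟨A₁, r₀, rfl, -, hA', hr⟩ := hm1.of_cons
    obtain ⟨H, hH, h1, h2⟩ := flFuse_spec hrd hu hud hδ hA.unitary hA'.unitary hA.near hA'.near
    refine h.setWord hη j (hl.append (.cons hi (.of_near hH h1 hδu) hr)) ?_
    rw [h0]
    refine (norm_wordMat_replace (m := [(i, A₀), (i, A₁)]) (m' := [(i, H)]) hl hr).trans_le ?_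
    simp only [wordMat_cons, wordMat_nil, Matrix.mul_one]
    rw [coreAt_mul hi, norm_coreAt_sub hi]
    exact h2
  | turnDown j l r i A B D hj F G H hT =>
    refine of_word ?_
    have hw := h.word j
    rw [hj] at hw
    obtain ⟨l₀, m₀, h0, hl, hm⟩ := hw.of_append
    obtain ⟨A₀, m₁, rfl, hi, hA, hm1⟩ := hm.of_cons
    obtain ⟨A₁, m₂, rfl, hi1, hB, hm2⟩ := hm1.of_cons
    obtain ⟨A₂, r₀, rfl, -, hD, hr⟩ := hm2.of_cons
    obtain ⟨F₀, hF, G₀, hG, H₀, hH, f1, f2, f3, herr⟩ := flTurnDown_spec hrd hu hud hδ hA.unitary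
      hB.unitary hD.unitary hA.near hB.near hD.near
    rw [hT] at f1 f2 f3
    refine h.setWord hη j (hl.append (.cons hi1 (.of_near hF f1 hδu) (.cons hi
      (.of_near hG f2 hδu) (.cons hi1 (.of_near hH f3 hδu) hr)))) ?_
    rw [h0]
    refine (norm_wordMat_replace (m := [(i, A₀), (i + 1, A₁), (i, A₂)])
      (m' := [(i + 1, F₀), (i, G₀), (i + 1, H₀)]) hl hr).trans_le ?_
    simp only [wordMat_cons, wordMat_nil, Matrix.mul_one, ← Matrix.mul_assoc]
    rw [norm_turn_down_eq (by omega)]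
    exact herr
  | turnUp j l r i A B D hj F G H hT =>
    refine of_word ?_
    have hw := h.word j
    rw [hj] at hw
    obtain ⟨l₀, m₀, h0, hl, hm⟩ := hw.of_append
    obtain ⟨A₀, m₁, rfl, hi1, hA, hm1⟩ := hm.of_cons
    obtain ⟨A₁, m₂, rfl, hi, hB, hm2⟩ := hm1.of_cons
    obtain ⟨A₂, r₀, rfl, -, hD, hr⟩ := hm2.of_cons
    obtain ⟨F₀, hF, G₀, hG, H₀, hH, f1, f2, f3, herr⟩ := flTurnUp_spec hrd hu hud hδ hA.unitary
      hB.unitary hD.unitary hA.near hB.near hD.near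
    rw [hT] at f1 f2 f3
    refine h.setWord hη j (hl.append (.cons hi (.of_near hF f1 hδu) (.cons hi1
      (.of_near hG f2 hδu) (.cons hi (.of_near hH f3 hδu) hr)))) ?_
    rw [h0]
    refine (norm_wordMat_replace (m := [(i + 1, A₀), (i, A₁), (i + 1, A₂)])
      (m' := [(i, F₀), (i + 1, G₀), (i, H₀)]) hl hr).trans_le ?_
    simp only [wordMat_cons, wordMat_nil, Matrix.mul_one, ← Matrix.mul_assoc]
    rw [norm_turn_up_eq (by omega)]
    exact herr
  | deflate j l r i A hA hj =>
    refine of_word ?_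
    have hw := h.word j
    rw [hj] at hw
    obtain ⟨l₀, m₀, h0, hl, hm⟩ := hw.of_append
    obtain ⟨A₀, r₀, rfl, hi, hA₀, hr⟩ := hm.of_cons
    obtain ⟨A₁, hA₁, h1⟩ := hA₀.deflate (by linarith) (by linarith) hA
    refine h.setWord hη j (hl.append (.cons hi hA₁ hr)) ?_
    rw [h0]
    refine (norm_wordMat_replace (m := [(i, A₀)]) (m' := [(i, A₁)]) hl hr).trans_le ?_
    simp only [wordMat_cons, wordMat_nil, Matrix.mul_one]
    rw [norm_coreAt_sub hi]
    linarith
  | passLeft j r i G hj W b₀ b₁ hB G' D₁ D₀ hC =>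
    refine of_word ?_
    have hw := h.word j.succ
    rw [hj] at hw
    obtain ⟨G₀, r₀, h0, hi, hG, hr⟩ := hw.of_cons
    obtain ⟨W₀, hW, b₀', hb₀, b₁', hb₁, f1, f2, f3, herrB⟩ := flTurnDown_spec hrd hu hud hδ
      (h.B j i).unitary (h.B j (i + 1)).unitary hG.unitary (h.B j i).near (h.B j (i + 1)).near
      hG.near
    rw [hB] at f1 f2 f3
    have sW : Shadow δ W W₀ := .of_near hW f1 hδu
    have sC := (h.C j i).conjTranspose
    have sC' := (h.C j (i + 1)).conjTranspose
    obtain ⟨G₁, hG₁, d₁, hd₁, d₀, hd₀, g1, g2, g3, herrC⟩ := flTurnUp_spec hrd hu hud hδ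
      sC'.unitary sC.unitary sW.unitary sC'.near sC.near sW.near
    rw [hC] at g1 g2 g3
    rw [← norm_turn_down_eq (n := n + 1) (i := i) (by omega)] at herrB
    rw [← norm_turn_up_eq (n := n + 1) (i := i) (by omega)] at herrC
    have herrC' := norm_turn_adjoint (coreAt_unitary (by omega) hG₁) (coreAt_unitary (by omega) hW)
      herrC
    simp only [coreAt_conjTranspose, Matrix.conjTranspose_conjTranspose] at herrC'
    have hi' : i + 1 < n + 1 := by omega
    refine h.pass hη j (w₁ := s.word j.castSucc ++ [(i, G')]) (w₂ := r)
      (v₁ := X.word j.castSucc ++ [(i, G₁)]) (v₂ := r₀)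
      (G₁ := coreAt n i G₁) (G₂ := coreAt n i G₀) (W := coreAt (n + 1) (i + 1) W₀)
      ((h.word j.castSucc).append (.cons hi (.of_near hG₁ g1 hδu) .nil)) hr
      (Shadow.of_near hd₀ g3 hδu).conjTranspose (Shadow.of_near hd₁ g2 hδu).conjTranspose
      (.of_near hb₀ f2 hδu) (.of_near hb₁ f3 hδu) (coreAt_unitary hi hG₁)
      (coreAt_unitary hi hG.unitary) (coreAt_unitary (by omega) hW) (coreAt_mul_incl_zero _)
      ?_ ?_ ?_ ?_
    · simp [wordMat_append, wordMat_cons, wordMat_nil]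
    · have := Matrix.mem_unitaryGroup_iff'.1 (coreAt_unitary hi hG.unitary)
      rw [h0, wordMat_cons, ← Matrix.mul_assoc, ← Matrix.star_eq_conjTranspose, this,
        Matrix.one_mul]
    · rw [blockAt_coreAt hi]
      exact norm_descending_pass hi (fun p => (h.C j p).unitary) hW herrC'
    · rw [blockAt_coreAt hi]
      exact norm_descending_pass hi (fun p => (h.B j p).unitary) hW herrB
  | passRight j l i G hj D₁ D₀ W hC b₀ b₁ G' hB =>
    refine of_word ?_
    have hw := h.word j.castSucc
    rw [hj] at hw
    obtain ⟨l₀, m₀, h0, hl, hm⟩ := hw.of_append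
    obtain ⟨G₀, m₁, rfl, hi, hG, hm1⟩ := hm.of_cons
    obtain rfl : m₁ = [] := List.forall₂_nil_left_iff.1 hm1
    have sC := (h.C j i).conjTranspose
    have sC' := (h.C j (i + 1)).conjTranspose
    obtain ⟨d₁, hd₁, d₀, hd₀, W₀, hW, g1, g2, g3, herrC⟩ := flTurnDown_spec hrd hu hud hδ
      hG.unitary sC'.unitary sC.unitary hG.near sC'.near sC.near
    rw [hC] at g1 g2 g3
    have sW : Shadow δ W W₀ := .of_near hW g3 hδu
    obtain ⟨b₀', hb₀, b₁', hb₁, G₁, hG₁, f1, f2, f3, herrB⟩ := flTurnUp_spec hrd hu hud hδ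
      sW.unitary (h.B j i).unitary (h.B j (i + 1)).unitary sW.near (h.B j i).near
      (h.B j (i + 1)).near
    rw [hB] at f1 f2 f3
    rw [← norm_turn_down_eq (n := n + 1) (i := i) (by omega)] at herrC
    rw [← norm_turn_up_eq (n := n + 1) (i := i) (by omega)] at herrB
    have hi' : i + 1 < n + 1 := by omega
    have uW' := conjTranspose_mem_unitary hW
    have herrC' : ‖coreAt (n + 1) (i + 1) W₀ᴴ * coreAt (n + 1) i d₀ᴴ * coreAt (n + 1) (i + 1) d₁ᴴ
        - coreAt (n + 1) i (X.C j i) * coreAt (n + 1) (i + 1) (X.C j (i + 1))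
          * coreAt (n + 1) i G₀ᴴ‖ ≤ 10 ^ 8 * (12 * δ) := by
      rw [← Matrix.frobenius_norm_conjTranspose] at herrC
      simpa only [Matrix.conjTranspose_sub, Matrix.conjTranspose_mul, coreAt_conjTranspose,
        Matrix.conjTranspose_conjTranspose, Matrix.mul_assoc] using herrC
    have herrB' := norm_turn_outer (coreAt_unitary (by omega) hW) (coreAt_unitary hi' hG₁) herrB
    simp only [coreAt_conjTranspose] at herrB'
    -- `Tracks.pass` updates the word to the right of the factor first.
    have hne : j.castSucc ≠ j.succ := Fin.castSucc_lt_succ.ne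
    have hcomm : (s.setWord j.castSucc l).setWord j.succ ((i, G') :: s.word j.succ)
        = (s.setWord j.succ ((i, G') :: s.word j.succ)).setWord j.castSucc l := by
      simp only [Conf.setWord, Function.update_comm hne]
    rw [hcomm]
    refine h.pass hη j (w₁ := l) (w₂ := (i, G') :: s.word j.succ)
      (v₁ := l₀) (v₂ := (i, G₁) :: X.word j.succ)
      (G₁ := coreAt n i G₀ᴴ) (G₂ := coreAt n i G₁ᴴ) (W := coreAt (n + 1) (i + 1) W₀ᴴ)
      hl (.cons hi (.of_near hG₁ f3 hδu) (h.word j.succ))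
      (Shadow.of_near hd₀ g2 hδu).conjTranspose (Shadow.of_near hd₁ g1 hδu).conjTranspose
      (.of_near hb₀ f1 hδu) (.of_near hb₁ f2 hδu)
      (coreAt_unitary hi (conjTranspose_mem_unitary hG.unitary))
      (coreAt_unitary hi (conjTranspose_mem_unitary hG₁)) (coreAt_unitary (by omega) uW')
      (coreAt_mul_incl_zero _) ?_ ?_ ?_ ?_
    · have := Matrix.mem_unitaryGroup_iff.1 (coreAt_unitary hi hG.unitary)
      rw [h0, wordMat_append, wordMat_cons, wordMat_nil, Matrix.mul_one, Matrix.mul_assoc,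
        ← coreAt_conjTranspose, ← Matrix.star_eq_conjTranspose, this, Matrix.mul_one]
    · rw [wordMat_cons, coreAt_conjTranspose, Matrix.conjTranspose_conjTranspose]
    · rw [blockAt_coreAt hi]
      exact norm_descending_pass hi (fun p => (h.C j p).unitary) uW' herrC'
    · rw [blockAt_coreAt hi]
      exact norm_descending_pass hi (fun p => (h.B j p).unitary) uW' herrB'
  | mulLeft i G hi hG =>
    obtain ⟨G₀, hG₀, hG'⟩ := hG
    have sG : Shadow δ G G₀ := .of_near hG₀ hG' hκ
    refine of_outer (h.left (.cons hi sG.conjTranspose (h.word 0)) hi sG ?_)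
    rw [wordMat_cons, coreAt_conjTranspose]
  | cancelLeft r i G hj =>
    have hw := h.word 0
    rw [hj] at hw
    obtain ⟨G₀, r₀, h0, hi, hG, hr⟩ := hw.of_cons
    refine of_outer (h.left hr hi hG ?_)
    have := Matrix.mem_unitaryGroup_iff'.1 (coreAt_unitary hi hG.unitary)
    rw [h0, wordMat_cons, ← Matrix.mul_assoc, ← Matrix.star_eq_conjTranspose, this, Matrix.one_mul]
  | mulRight i G hi hG =>
    obtain ⟨G₀, hG₀, hG'⟩ := hG
    have sG : Shadow δ G G₀ := .of_near hG₀ hG' hκ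
    refine of_outer (h.right ((h.word _).append (.cons hi sG .nil)) hi sG ?_)
    simp [wordMat_append, wordMat_cons, wordMat_nil]
  | cancelRight l i G hj =>
    have hw := h.word (Fin.last k)
    rw [hj] at hw
    obtain ⟨l₀, m₀, h0, hl, hm⟩ := hw.of_append
    obtain ⟨G₀, m₁, rfl, hi, hG, hm1⟩ := hm.of_cons
    obtain rfl : m₁ = [] := List.forall₂_nil_left_iff.1 hm1
    refine of_outer (h.right hl hi hG.conjTranspose ?_)
    have := Matrix.mem_unitaryGroup_iff.1 (coreAt_unitary hi hG.unitary)
    rw [h0, wordMat_append, wordMat_cons, wordMat_nil, Matrix.mul_one, Matrix.mul_assoc,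
      ← coreAt_conjTranspose, ← Matrix.star_eq_conjTranspose, this, Matrix.mul_one]

/-- The number of core transformations in a word grows by at most one in every operation. -/
theorem FlStep.length_le (hs : FlStep rd u κ s s') (j : Fin (k + 1)) :
    (s'.word j).length ≤ (s.word j).length + 1 := by
  have key : ∀ (t : Conf n k) (i j : Fin (k + 1)) (w : List (ℕ × Core)),
      w.length ≤ (t.word i).length + 1 → (t.word j).length ≤ (s.word j).length + 1 →
      t.word i = s.word i →
      ((t.setWord i w).word j).length ≤ (s.word j).length + 1 := by
    intro t i j w h1 h2 h3
    rcases eq_or_ne j i with rfl | hij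
    · rw [h3] at h1
      simpa [Conf.setWord] using h1
    · simpa [Conf.setWord, hij] using h2
  induction hs with
  | swap j' l r i i' A A' hi hj => exact key s _ _ _ (by simp [hj]) (by omega) rfl
  | fuse j' l r i A A' hj => exact key s _ _ _ (by simp [hj]; omega) (by omega) rfl
  | turnDown j' l r i A B D hj F G H hT => exact key s _ _ _ (by simp [hj]) (by omega) rfl
  | turnUp j' l r i A B D hj F G H hT => exact key s _ _ _ (by simp [hj]) (by omega) rfl
  | deflate j' l r i A hA hj => exact key s _ _ _ (by simp [hj]) (by omega) rfl
  | passLeft j' r i G hj W b₀ b₁ hB G' D₁ D₀ hC =>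
    have hne : j'.castSucc ≠ j'.succ := Fin.castSucc_lt_succ.ne
    exact key _ _ _ _ (by simp [Conf.setWord, hne])
      (key s _ _ _ (by simp [hj]; omega) (by omega) rfl) (by simp [Conf.setWord, hne])
  | passRight j' l i G hj D₁ D₀ W hC b₀ b₁ G' hB =>
    have hne : j'.castSucc ≠ j'.succ := Fin.castSucc_lt_succ.ne
    exact key _ _ _ _ (by simp [Conf.setWord, hne.symm])
      (key s _ _ _ (by simp [hj]; omega) (by omega) rfl) (by simp [Conf.setWord, hne.symm])
  | mulLeft i G hi hG => exact key s _ _ _ (by simp) (by omega) rfl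
  | cancelLeft r i G hj => exact key s _ _ _ (by simp [hj]; omega) (by omega) rfl
  | mulRight i G hi hG => exact key s _ _ _ (by simp) (by omega) rfl
  | cancelRight l i G hj => exact key s _ _ _ (by simp [hj]; omega) (by omega) rfl

/-- In a computation the errors grow linearly with the number of operations, and the distance of the
recorded transformations from unitary matrices at most as `(1 + 12 δ) ^ N`. -/
theorem FlRun.tracks (hrd : IsRounding u rd) (hu : 0 ≤ u) (hδu : 600 * u ≤ δ) (hκ : κ * u ≤ δ)
    (hδ : 12 * δ ≤ 1 / 10 ^ 9) {N : ℕ} (hs : FlRun rd u κ N s s')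
    (h : Tracks δ e f 0 Q C₀ B₀ s X) :
    ∃ Y, Tracks δ (e + N * (10 ^ 8 * (12 * δ))) (f + N * (10 ^ 8 * (12 * δ)))
      ((1 + 12 * δ) ^ N - 1) Q C₀ B₀ s' Y := by
  induction hs with
  | refl => exact ⟨X, by simpa using h⟩
  | step _ h' ih =>
    obtain ⟨Y, hY⟩ := ih h
    obtain ⟨Z, hZ⟩ := h'.tracks hrd hu hδu hκ hδ hY
    refine ⟨Z, hZ.mono ?_ ?_ ?_⟩
    · push_cast; linarith
    · push_cast; linarith
    · rw [pow_succ]; linarith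

theorem FlRun.length_le {N : ℕ} (hs : FlRun rd u κ N s s') (j : Fin (k + 1)) :
    (s'.word j).length ≤ (s.word j).length + N := by
  induction hs with
  | refl => simp
  | step _ h' ih =>
    have := h'.length_le j
    omega

end

/-! ### Perturbation of a product of spike matrices -/

section Perturbation

variable {n : ℕ}

/-- The unit column vector `e_l`. -/
abbrev unitCol (n l : ℕ) : Matrix (Fin n) (Fin 1) ℂ := incl n l 1

/-- The identity matrix with its column `l` replaced by `x`. -/
def spikeMat (n l : ℕ) (x : Matrix (Fin n) (Fin 1) ℂ) : Matrix (Fin n) (Fin n) ℂ :=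
  1 + (x - unitCol n l) * (unitCol n l)ᴴ

/-- A structured perturbation of the spike matrix with spike `x` in column `l`. Perturbations that
only affect column `l` may be larger, by the factor `σ`, than the unstructured one and than the one
whose columns are multiples of the spike. -/
def IsPerturbedSpike (σ η : ℝ) (n l : ℕ) (x : Matrix (Fin n) (Fin 1) ℂ)
    (R : Matrix (Fin n) (Fin n) ℂ) : Prop :=
  ∃ (E : Matrix (Fin n) (Fin n) ℂ) (g : Matrix (Fin n) (Fin 1) ℂ) (f : Matrix (Fin 1) (Fin n) ℂ)
    (t : Matrix (Fin 1) (Fin 1) ℂ), ‖E‖ ≤ η ∧ ‖g‖ ≤ σ * η ∧ ‖f‖ ≤ η ∧ ‖t‖ ≤ σ * η ∧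
    R = spikeMat n l x + (E + g * (unitCol n l)ᴴ + x * f + x * (t * (unitCol n l)ᴴ))

/-- The column vanishes in the rows `m, m + 1, …`. -/
def VanishesFrom (m : ℕ) (v : Matrix (Fin n) (Fin 1) ℂ) : Prop :=
  ∀ i, m ≤ i → i < n → (unitCol n i)ᴴ * v = 0

theorem norm_one_le (n : ℕ) (hn : 0 < n) : ‖(1 : Matrix (Fin n) (Fin n) ℂ)‖ ≤ n := by
  refine le_of_sq_le_sq ?_ (by positivity)
  rw [frobenius_sq]
  have : ∀ i j : Fin n, ‖(1 : Matrix (Fin n) (Fin n) ℂ) i j‖ ^ 2 = if i = j then 1 else 0 := by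
    intro i j
    rw [Matrix.one_apply]
    split_ifs <;> simp
  simp only [this, Finset.sum_ite_eq, Finset.mem_univ, if_true, Finset.sum_const,
    Finset.card_univ, Fintype.card_fin, nsmul_eq_mul, mul_one]
  have : (1 : ℝ) ≤ n := by exact_mod_cast hn
  nlinarith

theorem norm_mul_le_of_le {a b c : Type*} [Fintype a] [Fintype b] [Fintype c] {A : Matrix a b ℂ}
    {B : Matrix b c ℂ} {α β : ℝ} (hA : ‖A‖ ≤ α) (hB : ‖B‖ ≤ β) : ‖A * B‖ ≤ α * β :=
  (Matrix.frobenius_norm_mul A B).trans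
    (mul_le_mul hA hB (norm_nonneg _) ((norm_nonneg _).trans hA))

theorem norm_unitCol_le (l : ℕ) (hl : l < n) : ‖unitCol n l‖ ≤ 1 := by
  have h := norm_isometry_mul (incl_conj_mul_incl (n := n) (i := l) (m := 1) (by omega))
    (1 : Matrix (Fin 1) (Fin 1) ℂ)
  rw [Matrix.mul_one] at h
  rw [h]
  simpa using norm_one_le 1 one_pos

theorem norm_unitCol_conj_le (l : ℕ) (hl : l < n) : ‖(unitCol n l)ᴴ‖ ≤ 1 := by
  rw [Matrix.frobenius_norm_conjTranspose]
  exact norm_unitCol_le l hl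

theorem spikeMat_mul_of_vanishes {l : ℕ} {x : Matrix (Fin n) (Fin 1) ℂ}
    {v : Matrix (Fin n) (Fin 1) ℂ} (h : (unitCol n l)ᴴ * v = 0) : spikeMat n l x * v = v := by
  rw [spikeMat, Matrix.add_mul, Matrix.one_mul, Matrix.mul_assoc, h, Matrix.mul_zero, add_zero]

theorem unitCol_conj_mul_unitCol {i l : ℕ} (h : i ≠ l) : (unitCol n i)ᴴ * unitCol n l = 0 :=
  incl_conj_mul_incl_of_disjoint (by omega)

/-- The products of the spike matrices with spikes in the columns `n - 1, n - 2, …`. -/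
def prefixProd (R : ℕ → Matrix (Fin n) (Fin n) ℂ) : ℕ → Matrix (Fin n) (Fin n) ℂ
  | 0 => 1
  | j + 1 => prefixProd R j * R j

variable {k : ℕ} {x : ℕ → Matrix (Fin n) (Fin 1) ℂ} {R : ℕ → Matrix (Fin n) (Fin n) ℂ}

theorem prefixProd_mul_of_vanishes (hR : ∀ j, j < k → R j = spikeMat n (n - 1 - j) (x j))
    (hk : k ≤ n) :
    ∀ j, j ≤ k → ∀ v : Matrix (Fin n) (Fin 1) ℂ, VanishesFrom (n - j) v →
      prefixProd R j * v = v := by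
  intro j
  induction j with
  | zero => intro _ v _; simp [prefixProd]
  | succ j ih =>
    intro hj v hv
    rw [prefixProd, Matrix.mul_assoc, hR j (by omega),
      spikeMat_mul_of_vanishes (hv (n - 1 - j) (by omega) (by omega))]
    exact ih (by omega) v fun i hi hin => hv i (by omega) hin

theorem norm_prefixProd_le (hR : ∀ j, j < k → R j = spikeMat n (n - 1 - j) (x j)) (hk : k ≤ n)
    (hn : 0 < n) {σ : ℝ} (hσ : 1 ≤ σ) (hx : ∀ j, j < k → VanishesFrom (n - j) (x j))
    (hxn : ∀ j, j < k → ‖x j‖ ≤ σ) :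
    ∀ j, j ≤ k → ‖prefixProd R j‖ ≤ n + 2 * σ * j := by
  intro j
  induction j with
  | zero => intro _; simpa [prefixProd] using norm_one_le n hn
  | succ j ih =>
    intro hj
    have h1 := prefixProd_mul_of_vanishes hR hk j (by omega) _ (hx j (by omega))
    have h2 := prefixProd_mul_of_vanishes hR hk j (by omega) (unitCol n (n - 1 - j))
      fun i hi hin => unitCol_conj_mul_unitCol (by omega)
    have h3 : prefixProd R (j + 1) = prefixProd R j
        + (x j - unitCol n (n - 1 - j)) * (unitCol n (n - 1 - j))ᴴ := by
      rw [prefixProd, hR j (by omega), spikeMat, Matrix.mul_add, Matrix.mul_one,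
        ← Matrix.mul_assoc, Matrix.mul_sub, h1, h2]
    rw [h3]
    have h4 := norm_unitCol_le (n := n) (n - 1 - j) (by omega)
    have h5 : ‖x j - unitCol n (n - 1 - j)‖ ≤ 2 * σ := by
      refine (norm_sub_le _ _).trans ?_
      linarith [hxn j (by omega)]
    have h6 := norm_mul_le_of_le h5 (norm_unitCol_conj_le (n := n) (n - 1 - j) (by omega))
    refine (norm_add_le _ _).trans ?_
    have := ih (by omega)
    push_cast
    linarith

/-- The effect of one perturbed factor, on the whole product and on the rows below its spike. -/
theorem perturbed_step {σ η b r : ℝ} (hσ : 1 ≤ σ) (hη : 0 ≤ η) (hση : σ * η ≤ 1) {l : ℕ}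
    (hl : l < n) {x : Matrix (Fin n) (Fin 1) ℂ} (hx : ‖x‖ ≤ σ) (hxv : VanishesFrom (l + 1) x)
    {R T : Matrix (Fin n) (Fin n) ℂ} (hR : IsPerturbedSpike σ η n l x R) (hT : ‖T‖ ≤ b)
    (hr : ‖(unitCol n l)ᴴ * T‖ ≤ r) :
    ‖R * T‖ ≤ (1 + 2 * σ * η) * b + 4 * σ * r ∧
      ∀ i, l < i → i < n →
        ‖(unitCol n i)ᴴ * (R * T)‖ ≤ ‖(unitCol n i)ᴴ * T‖ + η * b + σ * η * r := by
  obtain ⟨E, g, f, t, hE, hg, hf, ht, rfl⟩ := hR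
  set e := unitCol n l with he
  have hb : 0 ≤ b := (norm_nonneg _).trans hT
  have hr0 : 0 ≤ r := (norm_nonneg _).trans hr
  have hexp : (spikeMat n l x + (E + g * eᴴ + x * f + x * (t * eᴴ))) * T
      = T + (x - e) * (eᴴ * T) + E * T + g * (eᴴ * T) + x * (f * T) + x * (t * (eᴴ * T)) := by
    simp only [spikeMat, Matrix.add_mul, Matrix.one_mul, Matrix.mul_assoc, ← he]
    abel
  have hn1 := norm_unitCol_le (n := n) l hl
  have k1 : ‖(x - e) * (eᴴ * T)‖ ≤ (σ + 1) * r := norm_mul_le_of_le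
    ((norm_sub_le _ _).trans (by linarith)) hr
  have k2 : ‖E * T‖ ≤ η * b := norm_mul_le_of_le hE hT
  have k3 : ‖g * (eᴴ * T)‖ ≤ σ * η * r := norm_mul_le_of_le hg hr
  have k4 : ‖x * (f * T)‖ ≤ σ * (η * b) := norm_mul_le_of_le hx (norm_mul_le_of_le hf hT)
  have k5 : ‖x * (t * (eᴴ * T))‖ ≤ σ * (σ * η * r) :=
    norm_mul_le_of_le hx (norm_mul_le_of_le ht hr)
  rw [hexp]
  constructor
  · have := norm_add_le (T + (x - e) * (eᴴ * T) + E * T + g * (eᴴ * T) + x * (f * T))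
      (x * (t * (eᴴ * T)))
    have := norm_add_le (T + (x - e) * (eᴴ * T) + E * T + g * (eᴴ * T)) (x * (f * T))
    have := norm_add_le (T + (x - e) * (eᴴ * T) + E * T) (g * (eᴴ * T))
    have := norm_add_le (T + (x - e) * (eᴴ * T)) (E * T)
    have := norm_add_le T ((x - e) * (eᴴ * T))
    have q1 : σ * η * r ≤ r := by nlinarith
    have q2 : σ * (σ * η * r) ≤ σ * r := by nlinarith
    have q3 : η * b ≤ σ * (η * b) := by nlinarith [mul_nonneg hη hb]
    have q4 : r ≤ σ * r := by nlinarith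
    nlinarith
  -- Below row `l`, the parts that start with `x` or `e_l` do not contribute.
  · intro i hi hin
    have z1 : (unitCol n i)ᴴ * x = 0 := hxv i (by omega) hin
    have z2 : (unitCol n i)ᴴ * e = 0 := unitCol_conj_mul_unitCol (by omega)
    have hui := norm_unitCol_conj_le (n := n) i hin
    have hexp2 : (unitCol n i)ᴴ * (T + (x - e) * (eᴴ * T) + E * T + g * (eᴴ * T) + x * (f * T)
        + x * (t * (eᴴ * T))) = (unitCol n i)ᴴ * T + (unitCol n i)ᴴ * (E * T)
          + (unitCol n i)ᴴ * (g * (eᴴ * T)) := by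
      simp only [Matrix.mul_add]
      rw [← Matrix.mul_assoc _ (x - e), Matrix.mul_sub, z1, z2, ← Matrix.mul_assoc _ x, z1,
        ← Matrix.mul_assoc _ x, z1]
      simp
    rw [hexp2]
    have m1 := norm_mul_le_of_le hui k2
    have m2 := norm_mul_le_of_le hui k3
    have := norm_add_le ((unitCol n i)ᴴ * T + (unitCol n i)ᴴ * (E * T))
      ((unitCol n i)ᴴ * (g * (eᴴ * T)))
    have := norm_add_le ((unitCol n i)ᴴ * T) ((unitCol n i)ᴴ * (E * T))
    linarith

/-- The products of the last perturbed factors stay bounded by a multiple of `n σ`, although the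
norms of all factors may be as large as `σ`; their rows that belong to the next spikes stay bounded
by `2`. -/
theorem perturbed_suffix_bounds {σ η : ℝ} (hσ : 1 ≤ σ) (hη : 0 ≤ η) (hn : 0 < n) (hk : k ≤ n)
    (hsmall : 100 * n ^ 2 * σ * η ≤ 1) (hx : ∀ j, j < k → VanishesFrom (n - j) (x j))
    (hxn : ∀ j, j < k → ‖x j‖ ≤ σ) {F T : ℕ → Matrix (Fin n) (Fin n) ℂ}
    (hR : ∀ j, j < k → IsPerturbedSpike σ η n (n - 1 - j) (x j) (R j))
    (hF : ∀ j, j < k → ‖F j - 1‖ ≤ η) (hTk : T k = 1)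
    (hT : ∀ j, j < k → T j = R j * (F j * T (j + 1))) :
    ∀ m j, j + m = k → ‖T j‖ ≤ n + 13 * σ * m ∧
      ∀ i, n - j ≤ i → i < n → ‖(unitCol n i)ᴴ * T j‖ ≤ 1 + m * (50 * n * σ * η) := by
  have hn1 : (1 : ℝ) ≤ n := by exact_mod_cast hn
  have hkn : (k : ℝ) ≤ n := by exact_mod_cast hk
  have hση0 : 0 ≤ σ * η := by positivity
  intro m
  induction m with
  | zero =>
    intro j hj
    obtain rfl : j = k := by omega
    rw [hTk]
    refine ⟨by simpa using norm_one_le n hn, fun i hi hin => ?_⟩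
    rw [Matrix.mul_one]
    simpa using norm_unitCol_conj_le (n := n) i hin
  | succ m ih =>
    intro j hj
    obtain ⟨h1, h2⟩ := ih (j + 1) (by omega)
    have hjk : j < k := by omega
    have hmn : (m : ℝ) + 1 ≤ n := by
      have : m + 1 ≤ n := by omega
      exact_mod_cast this
    have hm0 : (0 : ℝ) ≤ m := by positivity
    have hB : (n : ℝ) + 13 * σ * m ≤ 14 * n * σ := by nlinarith
    have hnση : (n : ℝ) * (σ * η) * n ≤ 1 / 100 := by nlinarith
    have hnση' : (n : ℝ) * (σ * η) ≤ 1 / 100 := by nlinarith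
    have hση1 : σ * η ≤ 1 / 100 := by nlinarith
    have hηB : η * ‖T (j + 1)‖ ≤ 14 * (n * (σ * η)) := by nlinarith [norm_nonneg (T (j + 1))]
    have hFT : F j * T (j + 1) = T (j + 1) + (F j - 1) * T (j + 1) := by
      rw [Matrix.sub_mul, Matrix.one_mul]; abel
    have hFT1 : ‖(F j - 1) * T (j + 1)‖ ≤ η * ‖T (j + 1)‖ := norm_mul_le_of_le (hF j hjk) le_rfl
    have hT' : ‖F j * T (j + 1)‖ ≤ (1 + η) * (n + 13 * σ * m) := by
      rw [hFT]
      refine (norm_add_le _ _).trans ?_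
      nlinarith
    have hrow : ∀ i, n - (j + 1) ≤ i → i < n → ‖(unitCol n i)ᴴ * (F j * T (j + 1))‖
        ≤ 1 + m * (50 * n * σ * η) + 14 * (n * (σ * η)) := by
      intro i hi hin
      rw [hFT, Matrix.mul_add]
      have := norm_mul_le_of_le (norm_unitCol_conj_le (n := n) i hin) hFT1
      refine (norm_add_le _ _).trans ?_
      linarith [h2 i hi hin]
    have hr2 : ∀ i, n - (j + 1) ≤ i → i < n → ‖(unitCol n i)ᴴ * (F j * T (j + 1))‖ ≤ 2 := by
      intro i hi hin
      refine (hrow i hi hin).trans ?_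
      have : (m : ℝ) * (n * (σ * η)) ≤ n * (n * (σ * η)) :=
        mul_le_mul_of_nonneg_right (by linarith) (by positivity)
      nlinarith
    have hη2 : η ≤ σ * η := by nlinarith
    obtain ⟨s1, s2⟩ := perturbed_step hσ hη (by linarith) (by omega) (hxn j hjk)
      (by simpa [show n - 1 - j + 1 = n - j by omega] using hx j hjk) (hR j hjk) hT'
      (hr2 (n - 1 - j) (by omega) (by omega))
    rw [hT j hjk]
    have hBη : (n + 13 * σ * m) * η ≤ 14 * (n * (σ * η)) := by nlinarith
    constructor
    · have t1 : (1 + 2 * σ * η) * ((1 + η) * (n + 13 * σ * m))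
          ≤ (1 + 4 * (σ * η)) * (n + 13 * σ * m) := by
        have : 0 ≤ (n : ℝ) + 13 * σ * m := by positivity
        have : (1 + 2 * σ * η) * (1 + η) ≤ 1 + 4 * (σ * η) := by nlinarith
        nlinarith
      have t2 : 4 * (σ * η) * (n + 13 * σ * m) ≤ σ := by
        have : σ * ((n + 13 * σ * m) * η) ≤ σ * (14 * (n * (σ * η))) :=
          mul_le_mul_of_nonneg_left hBη (by linarith)
        nlinarith
      push_cast
      nlinarith
    · intro i hi hin
      have t1 := s2 i (by omega) hin
      have t2 := hrow i (by omega) hin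
      have t3 : η * ((1 + η) * (n + 13 * σ * m)) ≤ 2 * (14 * (n * (σ * η))) := by nlinarith
      have t4 : σ * η ≤ n * (σ * η) := by nlinarith
      push_cast
      linarith

/-- The perturbation of a product of spike matrices is of second order in `σ`. The factors to the
left of a perturbed factor are unperturbed and leave its spike `x` fixed; the row of the product of
the factors to its right that meets its column `l` is almost `e_lᵀ`. -/
theorem norm_perturbed_prod_sub_le {σ η : ℝ} (hσ : 1 ≤ σ) (hη : 0 ≤ η) (hn : 0 < n) (hk : k ≤ n)
    (hsmall : 100 * n ^ 2 * σ * η ≤ 1) (hx : ∀ j, j < k → VanishesFrom (n - j) (x j))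
    (hxn : ∀ j, j < k → ‖x j‖ ≤ σ) {R₀ F T : ℕ → Matrix (Fin n) (Fin n) ℂ}
    (hR₀ : ∀ j, j < k → R₀ j = spikeMat n (n - 1 - j) (x j))
    (hR : ∀ j, j < k → IsPerturbedSpike σ η n (n - 1 - j) (x j) (R j))
    (hF : ∀ j, j < k → ‖F j - 1‖ ≤ η) (hTk : T k = 1)
    (hT : ∀ j, j < k → T j = R j * (F j * T (j + 1))) :
    ‖T 0 - prefixProd R₀ k‖ ≤ 200 * n ^ 3 * σ ^ 2 * η ∧ ‖T 0‖ ≤ 14 * n * σ := by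
  have hn1 : (1 : ℝ) ≤ n := by exact_mod_cast hn
  have hb := perturbed_suffix_bounds hσ hη hn hk hsmall hx hxn hR hF hTk hT
  have hση0 : 0 ≤ σ * η := by positivity
  have hkn : (k : ℝ) ≤ n := by exact_mod_cast hk
  have hnorm : ∀ j, j ≤ k → ‖T j‖ ≤ 14 * n * σ := by
    intro j hj
    refine (hb (k - j) j (by omega)).1.trans ?_
    have : ((k - j : ℕ) : ℝ) ≤ n := by
      have : k - j ≤ n := by omega
      exact_mod_cast this
    nlinarith
  have hP : ∀ j, j ≤ k → ‖prefixProd R₀ j‖ ≤ 3 * n * σ := by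
    intro j hj
    refine (norm_prefixProd_le hR₀ hk hn hσ hx hxn j hj).trans ?_
    have : (j : ℝ) ≤ n := by
      have : j ≤ n := by omega
      exact_mod_cast this
    nlinarith
  refine ⟨?_, hnorm 0 (by omega)⟩
  -- The factors are replaced one by one, from the left: the products `prefixProd R₀ j * T j` lead
  -- from `T 0` to `prefixProd R₀ k`.
  have hterm : ∀ j, j < k → ‖prefixProd R₀ j * T j - prefixProd R₀ (j + 1) * T (j + 1)‖
      ≤ 200 * n ^ 2 * σ ^ 2 * η := by
    intro j hj
    have hnση : (n : ℝ) * (σ * η) * n ≤ 1 / 100 := by nlinarith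
    have hnση' : (n : ℝ) * (σ * η) ≤ 1 / 100 := by nlinarith
    have hη1 : η ≤ 1 / 100 := by nlinarith
    have hT1 := hnorm (j + 1) (by omega)
    have hFT : F j * T (j + 1) = T (j + 1) + (F j - 1) * T (j + 1) := by
      rw [Matrix.sub_mul, Matrix.one_mul]; abel
    have hFT1 : ‖(F j - 1) * T (j + 1)‖ ≤ η * (14 * n * σ) := norm_mul_le_of_le (hF j hj) hT1
    have hFTn : ‖F j * T (j + 1)‖ ≤ 15 * n * σ := by
      rw [hFT]
      refine (norm_add_le _ _).trans ?_
      nlinarith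
    have hrow : ‖(unitCol n (n - 1 - j))ᴴ * (F j * T (j + 1))‖ ≤ 2 := by
      rw [hFT, Matrix.mul_add]
      have h1 := norm_mul_le_of_le (norm_unitCol_conj_le (n := n) (n - 1 - j) (by omega)) hFT1
      have h2 := (hb (k - (j + 1)) (j + 1) (by omega)).2 (n - 1 - j) (by omega) (by omega)
      have h3 : ((k - (j + 1) : ℕ) : ℝ) + 1 ≤ n := by
        have : k - (j + 1) + 1 ≤ n := by omega
        exact_mod_cast this
      have h4 : ((k - (j + 1) : ℕ) : ℝ) * (n * (σ * η)) ≤ (n - 1) * (n * (σ * η)) :=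
        mul_le_mul_of_nonneg_right (by linarith) (by positivity)
      refine (norm_add_le _ _).trans ?_
      nlinarith
    obtain ⟨E, g, f, t, hE, hg, hf, ht, hRj⟩ := hR j hj
    have hPx := prefixProd_mul_of_vanishes hR₀ hk j (by omega) _ (hx j hj)
    set e := unitCol n (n - 1 - j) with he
    -- In the last two terms, `prefixProd R₀ j` has been absorbed by the spike `x j`.
    have hexp : prefixProd R₀ j * T j - prefixProd R₀ (j + 1) * T (j + 1)
        = prefixProd R₀ (j + 1) * ((F j - 1) * T (j + 1))
          + prefixProd R₀ j * (E * (F j * T (j + 1)))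
          + prefixProd R₀ j * (g * (eᴴ * (F j * T (j + 1))))
          + x j * (f * (F j * T (j + 1)))
          + x j * (t * (eᴴ * (F j * T (j + 1)))) := by
      rw [hT j hj, hRj]
      conv_rhs => rw [← hPx]
      rw [prefixProd, hR₀ j hj]
      simp only [Matrix.add_mul, Matrix.mul_add, Matrix.sub_mul, Matrix.mul_sub, Matrix.mul_assoc,
        Matrix.one_mul]
      abel
    have q1 := norm_mul_le_of_le (hP (j + 1) (by omega)) hFT1
    have q2 := norm_mul_le_of_le (hP j (by omega)) (norm_mul_le_of_le hE hFTn)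
    have q3 := norm_mul_le_of_le (hP j (by omega)) (norm_mul_le_of_le hg hrow)
    have q4 := norm_mul_le_of_le (hxn j hj) (norm_mul_le_of_le hf hFTn)
    have q5 := norm_mul_le_of_le (hxn j hj) (norm_mul_le_of_le ht hrow)
    rw [hexp]
    have n1 := norm_add_le (prefixProd R₀ (j + 1) * ((F j - 1) * T (j + 1))
          + prefixProd R₀ j * (E * (F j * T (j + 1)))
          + prefixProd R₀ j * (g * (eᴴ * (F j * T (j + 1))))
          + x j * (f * (F j * T (j + 1)))) (x j * (t * (eᴴ * (F j * T (j + 1)))))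
    have n2 := norm_add_le (prefixProd R₀ (j + 1) * ((F j - 1) * T (j + 1))
          + prefixProd R₀ j * (E * (F j * T (j + 1)))
          + prefixProd R₀ j * (g * (eᴴ * (F j * T (j + 1))))) (x j * (f * (F j * T (j + 1))))
    have n3 := norm_add_le (prefixProd R₀ (j + 1) * ((F j - 1) * T (j + 1))
          + prefixProd R₀ j * (E * (F j * T (j + 1))))
          (prefixProd R₀ j * (g * (eᴴ * (F j * T (j + 1)))))
    have n4 := norm_add_le (prefixProd R₀ (j + 1) * ((F j - 1) * T (j + 1)))
          (prefixProd R₀ j * (E * (F j * T (j + 1))))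
    set v := n ^ 2 * (σ ^ 2 * η) with hv
    have hw : 0 ≤ σ ^ 2 * η := by positivity
    have v1 : σ ^ 2 * η ≤ v := by
      rw [hv]; nlinarith [mul_nonneg (sub_nonneg.2 hn1) hw]
    have v2 : n * (σ ^ 2 * η) ≤ v := by
      rw [hv]; nlinarith [mul_nonneg (mul_nonneg (by linarith : (0:ℝ) ≤ n) (sub_nonneg.2 hn1)) hw]
    have r1 : 3 * n * σ * (η * (14 * n * σ)) = 42 * v := by rw [hv]; ring
    have r2 : 3 * n * σ * (η * (15 * n * σ)) = 45 * v := by rw [hv]; ring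
    have r3 : 3 * n * σ * (σ * η * 2) = 6 * (n * (σ ^ 2 * η)) := by ring
    have r4 : σ * (η * (15 * n * σ)) = 15 * (n * (σ ^ 2 * η)) := by ring
    have r5 : σ * (σ * η * 2) = 2 * (σ ^ 2 * η) := by ring
    have r6 : 200 * n ^ 2 * σ ^ 2 * η = 200 * v := by rw [hv]; ring
    have hv0 : 0 ≤ v := hw.trans v1
    rw [r6]
    linarith
  have hsum : ∀ m, m ≤ k → ‖T 0 - prefixProd R₀ m * T m‖ ≤ m * (200 * n ^ 2 * σ ^ 2 * η) := by
    intro m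
    induction m with
    | zero => intro _; simp [prefixProd]
    | succ m ih =>
      intro hm
      have h1 := ih (by omega)
      have h2 := hterm m (by omega)
      have h3 := norm_sub_le_sub_add (T 0) (prefixProd R₀ m * T m)
        (prefixProd R₀ (m + 1) * T (m + 1))
      push_cast
      linarith
  have h := hsum k le_rfl
  rw [hTk, Matrix.mul_one] at h
  refine h.trans ?_
  have : (k : ℝ) * (200 * n ^ 2 * σ ^ 2 * η) ≤ n * (200 * n ^ 2 * σ ^ 2 * η) :=
    mul_le_mul_of_nonneg_right hkn (by positivity)
  linarith

end Perturbation

/-! ### The factor represented by perturbed sequences -/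

section Represented

theorem frobenius_norm_smul {m n : Type*} [Fintype m] [Fintype n] (c : ℂ) (A : Matrix m n ℂ) :
    ‖c • A‖ = ‖c‖ * ‖A‖ := by
  refine (sq_eq_sq₀ (norm_nonneg _) (by positivity)).1 ?_
  rw [mul_pow, frobenius_sq, frobenius_sq, Finset.mul_sum]
  refine Finset.sum_congr rfl fun i _ => ?_
  rw [Finset.mul_sum]
  refine Finset.sum_congr rfl fun j _ => ?_
  rw [Matrix.smul_apply, smul_eq_mul, norm_mul, mul_pow]

theorem norm_incl_conj_mul_le {n i m : ℕ} (h : i + m ≤ n) {a : Type*} [Fintype a]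
    (A : Matrix (Fin n) a ℂ) : ‖(incl n i m)ᴴ * A‖ ≤ ‖A‖ := by
  refine le_of_sq_le_sq ?_ (norm_nonneg _)
  rw [frobenius_sq, frobenius_sq]
  simp only [incl_conj_mul_apply h]
  have hinj : Function.Injective fun p : Fin m => (⟨i + p, by omega⟩ : Fin n) := fun p q hpq => by
    simpa [Fin.ext_iff] using hpq
  rw [← Finset.sum_image (f := fun r : Fin n => ∑ j, ‖A r j‖ ^ 2)
    (s := Finset.univ) (g := fun p : Fin m => (⟨i + p, by omega⟩ : Fin n)) (hinj.injOn)]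
  exact Finset.sum_le_univ_sum_of_nonneg fun r => by positivity

theorem norm_mul_incl_le {n i m : ℕ} (h : i + m ≤ n) {a : Type*} [Fintype a]
    (A : Matrix a (Fin n) ℂ) : ‖A * incl n i m‖ ≤ ‖A‖ := by
  have := norm_incl_conj_mul_le h Aᴴ
  rwa [← Matrix.conjTranspose_conjTranspose (incl n i m), ← Matrix.conjTranspose_conjTranspose A,
    ← Matrix.conjTranspose_mul, Matrix.frobenius_norm_conjTranspose,
    Matrix.frobenius_norm_conjTranspose Aᴴ]

theorem neg_inv_perturb {α e : ℝ} (hα : 1 ≤ α) (h : α * e ≤ 1 / 4) {ρ : ℂ}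
    (hρ : ‖ρ + ((α⁻¹ : ℝ) : ℂ)‖ ≤ e) : ∃ τ : ℂ, ‖τ‖ ≤ 2 * α * e ∧ -ρ⁻¹ = α * (1 + τ) := by
  set ω := ρ + ((α⁻¹ : ℝ) : ℂ) with hω
  have hα0 : (α : ℂ) ≠ 0 := by
    have : α ≠ 0 := by linarith
    exact_mod_cast this
  have h1 : ‖(α : ℂ) * ω‖ ≤ α * e := by
    rw [norm_mul, Complex.norm_real, Real.norm_eq_abs, abs_of_pos (by linarith)]
    exact mul_le_mul_of_nonneg_left hρ (by linarith)
  have h2 : 1 / 2 ≤ ‖1 - (α : ℂ) * ω‖ := by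
    have := norm_sub_norm_le (1 : ℂ) (α * ω)
    rw [norm_one] at this
    linarith
  have h3 : 1 - (α : ℂ) * ω ≠ 0 := by
    intro hc
    rw [hc, norm_zero] at h2
    norm_num at h2
  have hρ' : ρ = -(1 - α * ω) / α := by
    rw [hω]
    push_cast
    field_simp
    ring
  refine ⟨α * ω / (1 - α * ω), ?_, ?_⟩
  · rw [norm_div, div_le_iff₀ (by linarith)]
    have : 0 ≤ α * e := (norm_nonneg _).trans h1
    nlinarith
  · rw [hρ']
    field_simp
    ring

/-- Unstructured perturbations of size `ε` of the stored sequences have a structured effect on the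
factor: the perturbation of `ρ = -1 / α` is multiplied by `α²`, but only affects the spike. -/
theorem repMat_isPerturbedSpike {n l : ℕ} {σ ε α : ℝ} (hα : 1 ≤ α) (hασ : α ≤ 2 * σ)
    (hε0 : 0 ≤ ε) (hε : σ * ε ≤ 1 / 8) {x : Matrix (Fin n) (Fin 1) ℂ}
    {Cs Cs₀ B B₀ : Matrix (Fin (n + 1)) (Fin (n + 1)) ℂ}
    (hCs₀ : Cs₀ ∈ Matrix.unitaryGroup (Fin (n + 1)) ℂ)
    (hB₀ : B₀ ∈ Matrix.unitaryGroup (Fin (n + 1)) ℂ)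
    (hCs : ‖Cs - Cs₀‖ ≤ ε) (hB : ‖B - B₀‖ ≤ ε)
    (hZ : (incl (n + 1) 0 n)ᴴ * (Cs₀ * B₀) * incl (n + 1) 0 n = 1 - unitCol n l * (unitCol n l)ᴴ)
    (hz : (incl (n + 1) n 1)ᴴ * (Cs₀ * B₀) * incl (n + 1) 0 n = (unitCol n l)ᴴ)
    (hc : (incl (n + 1) 0 n)ᴴ * (Cs₀ * incl (n + 1) 0 1) = ((α⁻¹ : ℝ) : ℂ) • x)
    (hρ : ((incl (n + 1) n 1)ᴴ * (Cs₀ * incl (n + 1) 0 1)) 0 0 = -((α⁻¹ : ℝ) : ℂ)) :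
    IsPerturbedSpike σ (6 * ε) n l x (repMat n Cs B) := by
  have hP : 0 + n ≤ n + 1 := by omega
  have hf : n + 1 ≤ n + 1 := le_rfl
  have h1 : 0 + 1 ≤ n + 1 := by omega
  set P := incl (n + 1) 0 n
  set f := incl (n + 1) n 1
  set e₁ := incl (n + 1) 0 1
  set e := unitCol n l with he
  obtain ⟨EZ, hEZ⟩ : ∃ EZ, EZ = Cs * B - Cs₀ * B₀ := ⟨_, rfl⟩
  obtain ⟨Ec, hEc⟩ : ∃ Ec, Ec = (Cs - Cs₀) * e₁ := ⟨_, rfl⟩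
  have nZ : ‖EZ‖ ≤ 3 * ε := by
    rw [hEZ]
    refine (norm_mul_sub_mul_le hCs₀ hB₀ hCs hB).trans ?_
    nlinarith
  have nc : ‖Ec‖ ≤ ε := by
    rw [hEc]
    exact (norm_mul_incl_le h1 _).trans hCs
  have hZ' : Pᴴ * (Cs * B) * P = 1 - e * eᴴ + Pᴴ * EZ * P := by
    rw [← hZ, hEZ, Matrix.mul_sub, Matrix.sub_mul]; abel
  have hz' : fᴴ * (Cs * B) * P = eᴴ + fᴴ * EZ * P := by
    rw [← hz, hEZ, Matrix.mul_sub, Matrix.sub_mul]; abel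
  have hc' : Pᴴ * (Cs * e₁) = ((α⁻¹ : ℝ) : ℂ) • x + Pᴴ * Ec := by
    rw [← hc, hEc, Matrix.sub_mul, Matrix.mul_sub]; abel
  have hρ' : ‖(fᴴ * (Cs * e₁)) 0 0 + ((α⁻¹ : ℝ) : ℂ)‖ ≤ ε := by
    have : (fᴴ * (Cs * e₁)) 0 0 + ((α⁻¹ : ℝ) : ℂ) = (fᴴ * Ec) 0 0 := by
      rw [hEc, Matrix.sub_mul, Matrix.mul_sub, Matrix.sub_apply, hρ]; ring
    rw [this]
    exact (norm_entry_le _ _ _).trans ((norm_incl_conj_mul_le hf _).trans nc)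
  have hαε : α * ε ≤ 1 / 4 := by nlinarith
  obtain ⟨τ, hτ, hτ'⟩ := neg_inv_perturb hα hαε hρ'
  have hα0 : (α : ℂ) ≠ 0 := by
    have : α ≠ 0 := by linarith
    exact_mod_cast this
  have hτ1 : ‖1 + τ‖ ≤ 2 := by
    refine (norm_add_le _ _).trans ?_
    rw [norm_one]
    linarith
  set z := fᴴ * EZ * P with hzdef
  set h := Pᴴ * Ec with hh
  have nz : ‖z‖ ≤ 3 * ε :=
    (norm_mul_incl_le hP _).trans ((norm_incl_conj_mul_le hf _).trans nZ)
  have nE : ‖Pᴴ * EZ * P‖ ≤ 3 * ε :=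
    (norm_mul_incl_le hP _).trans ((norm_incl_conj_mul_le hP _).trans nZ)
  have nh : ‖h‖ ≤ ε := (norm_incl_conj_mul_le hP _).trans nc
  have nαh : ‖((α : ℂ) * (1 + τ)) • h‖ ≤ 2 * α * ε := by
    rw [frobenius_norm_smul, norm_mul, Complex.norm_real, Real.norm_eq_abs,
      abs_of_pos (by linarith)]
    have := mul_le_mul (mul_le_mul_of_nonneg_left hτ1 (by linarith : (0 : ℝ) ≤ α)) nh
      (norm_nonneg _) (by linarith)
    linarith
  -- `α (1 + τ)` is the perturbed `-ρ⁻¹`; the products of it with the perturbed columns and rows are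
  -- sorted by whether they contain `x` and whether they contain `eᴴ`.
  refine ⟨Pᴴ * EZ * P + (((α : ℂ) * (1 + τ)) • h) * z, ((α : ℂ) * (1 + τ)) • h, (1 + τ) • z,
    τ • 1, ?_, by nlinarith, ?_, ?_, ?_⟩
  · refine (norm_add_le _ _).trans ?_
    have := norm_mul_le_of_le nαh nz
    nlinarith
  · rw [frobenius_norm_smul]
    nlinarith [norm_nonneg z, norm_nonneg (1 + τ)]
  · rw [frobenius_norm_smul]
    have := norm_one_le 1 one_pos
    have h0 : ‖τ‖ * ‖(1 : Matrix (Fin 1) (Fin 1) ℂ)‖ ≤ ‖τ‖ * 1 :=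
      mul_le_mul_of_nonneg_left (by simpa using this) (norm_nonneg _)
    nlinarith
  · have hinv : (α : ℂ) * (1 + τ) * ((α⁻¹ : ℝ) : ℂ) = 1 + τ := by
      push_cast; field_simp
    unfold repMat
    rw [hτ', hZ', hz', hc', spikeMat, ← he]
    generalize (α : ℂ) * (1 + τ) = β at hinv ⊢
    simp only [Matrix.add_mul, Matrix.mul_add, Matrix.sub_mul, smul_add, Matrix.smul_mul,
      Matrix.mul_smul, smul_smul, hinv, Matrix.one_mul, add_smul, one_smul]
    abel

end Represented

/-! ### The stored form of a spike matrix in exact arithmetic -/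

section Exact

theorem flGivens_id (a b : ℂ) : flGivens id a b = givens a b := by
  have := norm_flGivens_sub_le isRounding_id le_rfl (by norm_num) a b
  rw [mul_zero] at this
  exact sub_eq_zero.1 (norm_le_zero_iff.1 this)

theorem flip2_unitary : flip2 ∈ Matrix.unitaryGroup (Fin 2) ℂ := by
  rw [Matrix.mem_unitaryGroup_iff]
  ext i j
  fin_cases i <;> fin_cases j <;> simp [flip2, Matrix.mul_apply, Fin.sum_univ_two]

theorem coreAt_mul_unitCol_of_ne {n i q : ℕ} (A : Core) (h : q ≠ i) (h' : q ≠ i + 1) :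
    coreAt n i A * unitCol n q = unitCol n q := by
  rw [coreAt_eq_blockAt, blockAt_mul_incl_of_disjoint (by omega)]

theorem unitCol_apply (n q : ℕ) (p : Fin n) (r : Fin 1) :
    unitCol n q p r = if p.val = q then 1 else 0 := by
  have : r.val = 0 := by omega
  simp [incl]

theorem coreAt_mul_apply_self {n i : ℕ} (hi : i + 1 < n) (A : Core) (v : Matrix (Fin n) (Fin 1) ℂ) :
    coreAt n i A * v = v
      + (A 0 0 * v ⟨i, by omega⟩ 0 + A 0 1 * v ⟨i + 1, hi⟩ 0 - v ⟨i, by omega⟩ 0) • unitCol n i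
      + (A 1 0 * v ⟨i, by omega⟩ 0 + A 1 1 * v ⟨i + 1, hi⟩ 0 - v ⟨i + 1, hi⟩ 0)
          • unitCol n (i + 1) := by
  ext p r
  obtain rfl : r = 0 := Subsingleton.elim _ _
  rw [coreAt_eq_blockAt, blockAt, Matrix.add_mul, Matrix.one_mul, Matrix.mul_assoc,
    Matrix.mul_assoc]
  simp only [Matrix.add_apply, Matrix.smul_apply, smul_eq_mul, unitCol_apply]
  rw [Matrix.mul_apply, Fin.sum_univ_two, Matrix.mul_apply, Matrix.mul_apply, Fin.sum_univ_two,
    Fin.sum_univ_two]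
  simp only [incl_conj_mul_apply (show i + 2 ≤ n by omega), incl, Matrix.sub_apply,
    Matrix.one_apply_eq, Matrix.one_apply_ne (show (0 : Fin 2) ≠ 1 by decide),
    Matrix.one_apply_ne (show (1 : Fin 2) ≠ 0 by decide), Fin.val_zero, Fin.val_one, add_zero]
  split_ifs <;> first | omega | ring

theorem flip_mul_unitCol {n i q : ℕ} (hi : i + 1 < n) : coreAt n i flip2 * unitCol n q =
    unitCol n (if q = i then i + 1 else if q = i + 1 then i else q) := by
  by_cases h1 : q = i
  · subst h1
    rw [coreAt_mul_apply_self hi, if_pos rfl]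
    simp only [unitCol_apply]
    simp [flip2]
  · by_cases h2 : q = i + 1
    · subst h2
      rw [coreAt_mul_apply_self hi, if_neg h1, if_pos rfl]
      simp only [unitCol_apply]
      simp [flip2]
    · rw [if_neg h1, if_neg h2, coreAt_mul_unitCol_of_ne _ h1 h2]

/-- A descending sequence of counteridentities is a cyclic shift. -/
theorem flips_mul_unitCol {n : ℕ} : ∀ {m p q : ℕ}, p + m < n →
    ((List.range' p m).map fun i => coreAt n i flip2).prod * unitCol n q =
      unitCol n (if q < p ∨ p + m < q then q else if q = p + m then p else q + 1) := by
  intro m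
  induction m with
  | zero =>
    intro p q _
    simp only [List.range'_zero, List.map_nil, List.prod_nil, Matrix.one_mul]
    split_ifs <;> first | rfl | omega | congr 1
  | succ m ih =>
    intro p q hp
    rw [List.range'_succ, List.map_cons, List.prod_cons, Matrix.mul_assoc, ih (by omega),
      flip_mul_unitCol (by omega)]
    congr 1
    split_ifs <;> omega

variable {n l : ℕ} (x : ℕ → ℂ)

/-- The spike `(x_0, …, x_l, 0, …, 0)` as a column. -/
noncomputable def spikeCol (n : ℕ) (x : ℕ → ℂ) (l : ℕ) : Matrix (Fin n) (Fin 1) ℂ :=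
  fun p _ => if p.val ≤ l then x p else 0

/-- The extended spike after the multiplication by the core transformations `p, …, n - 1`. -/
noncomputable def spikeStage (n : ℕ) (x : ℕ → ℂ) (l p : ℕ) : Matrix (Fin (n + 1)) (Fin 1) ℂ :=
  fun q _ =>
  if q.val < p then (if q.val ≤ l then x q else 0)
  else if q.val = p then spikeTail id x l (l + 1 - p) else 0

theorem initC_id_unitary (l p : ℕ) : initC id x l p ∈ Matrix.unitaryGroup (Fin 2) ℂ := by
  unfold initC
  split_ifs
  · rw [flGivens_id]
    exact conjTranspose_mem_unitary (givens_unitary _ _)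
  · exact flip2_unitary

theorem coreAt_initC_mul_spikeStage {p : ℕ} (hp : p < n) :
    coreAt (n + 1) p (initC id x l p) * spikeStage n x l (p + 1) = spikeStage n x l p := by
  rw [coreAt_mul_apply_self (by omega)]
  have a1 : spikeStage n x l (p + 1) ⟨p, by omega⟩ 0 = if p ≤ l then x p else 0 := by
    simp [spikeStage]
  have a2 : spikeStage n x l (p + 1) ⟨p + 1, by omega⟩ 0 = spikeTail id x l (l - p) := by
    simp [spikeStage]
  rw [a1, a2]
  have key : initC id x l p 0 0 * (if p ≤ l then x p else 0)
        + initC id x l p 0 1 * spikeTail id x l (l - p) = spikeTail id x l (l + 1 - p) ∧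
      initC id x l p 1 0 * (if p ≤ l then x p else 0)
        + initC id x l p 1 1 * spikeTail id x l (l - p) = 0 := by
    by_cases hpl : p ≤ l
    · have h1 : l + 1 - p = (l - p) + 1 := by omega
      have h2 : l - (l - p) = p := by omega
      simp only [initC, hpl, if_true, flGivens_id]
      rw [h1, spikeTail, h2, flHypot_id]
      exact ⟨givens_conj_zero _ _, givens_conj_one _ _⟩
    · have h1 : l + 1 - p = 0 := by omega
      have h2 : l - p = 0 := by omega
      simp [initC, hpl, h1, h2, spikeTail, flip2]
  rw [key.1, key.2]
  ext q r
  simp only [Matrix.add_apply, Matrix.smul_apply, smul_eq_mul, unitCol_apply, spikeStage]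
  have h3 : l + 1 - (p + 1) = l - p := by omega
  by_cases h1 : q.val = p
  · simp [h1]
  · by_cases h2 : q.val = p + 1
    · simp [h2]
    · have : (q.val < p + 1) = (q.val < p) := by
        apply propext; omega
      simp [h1, h2, this]

theorem seg_mul_spikeStage : ∀ {m p : ℕ}, p + m ≤ n →
    ((List.range' p m).map fun i => coreAt (n + 1) i (initC id x l i)).prod
      * spikeStage n x l (p + m) = spikeStage n x l p := by
  intro m
  induction m with
  | zero => intro p _; simp
  | succ m ih =>
    intro p hp
    rw [List.range'_succ, List.map_cons, List.prod_cons, Matrix.mul_assoc,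
      show p + (m + 1) = p + 1 + m by omega, ih (by omega)]
    exact coreAt_initC_mul_spikeStage x (by omega)

/-- The norm of the extended spike `(x, -1)`. -/
noncomputable def spikeNorm (n : ℕ) (x : ℕ → ℂ) (l : ℕ) : ℝ := ‖spikeStage n x l n‖

theorem spikeStage_last (hl : l < n) :
    spikeStage n x l n = incl (n + 1) 0 n * spikeCol n x l - unitCol (n + 1) n := by
  ext q r
  obtain rfl : r = 0 := Subsingleton.elim _ _
  rw [Matrix.sub_apply, unitCol_apply]
  have h0 : l + 1 - n = 0 := by omega
  rcases Nat.lt_succ_iff_lt_or_eq.1 q.isLt with hq | hq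
  · rw [Matrix.mul_apply, Finset.sum_eq_single ⟨q.val, hq⟩]
    · simp [spikeStage, spikeCol, incl, hq, hq.ne]
    · intro b _ hb
      have : q.val ≠ b.val := fun hc => hb (Fin.ext (by simp [hc]))
      simp [incl, this]
    · simp
  · rw [Matrix.mul_apply, Finset.sum_eq_zero]
    · simp [spikeStage, hq, h0, spikeTail]
    · intro b _
      have : q.val ≠ b.val := by omega
      simp [incl, this]

theorem descending_mul_spikeStage :
    descending n (initC id x l) * spikeStage n x l n = spikeStage n x l 0 := by
  have := seg_mul_spikeStage (n := n) (l := l) x (m := n) (p := 0) (by omega)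
  rw [zero_add, ← List.range_eq_range'] at this
  exact this

theorem spikeStage_zero : spikeStage n x l 0 = (spikeNorm n x l : ℂ) • unitCol (n + 1) 0 := by
  have h1 : spikeStage n x l 0 = (spikeTail id x l (l + 1)) • unitCol (n + 1) 0 := by
    ext q r
    simp [spikeStage, unitCol_apply]
  have h2 : spikeNorm n x l = ‖spikeStage n x l 0‖ := by
    rw [spikeNorm, ← descending_mul_spikeStage,
      norm_unitary_mul (descending_unitary (initC_id_unitary x l))]
  have h3 : ‖unitCol (n + 1) 0‖ = 1 := by
    refine le_antisymm (norm_unitCol_le 0 (by omega)) ?_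
    simpa [unitCol_apply] using norm_entry_le (unitCol (n + 1) 0) 0 0
  rw [h2, h1, frobenius_norm_smul, h3, mul_one]
  congr 1
  rw [spikeTail, flHypot_id, Complex.norm_real, Real.norm_eq_abs, abs_of_nonneg (hypot_nonneg _ _)]

theorem one_le_spikeNorm (hl : l < n) : 1 ≤ spikeNorm n x l := by
  refine le_trans (le_of_eq ?_) (norm_entry_le (spikeStage n x l n) (Fin.last n) 0)
  have h0 : l + 1 - n = 0 := by omega
  simp [spikeStage, h0, spikeTail]

theorem spikeNorm_le (hl : l < n) : spikeNorm n x l ≤ ‖spikeCol n x l‖ + 1 := by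
  rw [spikeNorm, spikeStage_last x hl]
  refine (norm_sub_le _ _).trans ?_
  rw [norm_isometry_mul (incl_conj_mul_incl (by omega))]
  linarith [norm_unitCol_le (n := n + 1) n (by omega)]

theorem descending_conj_mul_unitCol (hl : l < n) :
    (descending n (initC id x l))ᴴ * unitCol (n + 1) 0
      = (((spikeNorm n x l)⁻¹ : ℝ) : ℂ) • spikeStage n x l n := by
  have h1 := descending_mul_spikeStage (n := n) (l := l) x
  have h2 := Matrix.mem_unitaryGroup_iff'.1 (descending_unitary (n := n) (initC_id_unitary x l))
  have hα : (spikeNorm n x l : ℂ) ≠ 0 := by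
    have := one_le_spikeNorm x hl
    have : spikeNorm n x l ≠ 0 := by linarith
    exact_mod_cast this
  rw [spikeStage_zero] at h1
  have h3 : unitCol (n + 1) 0 = (((spikeNorm n x l)⁻¹ : ℝ) : ℂ) •
      (descending n (initC id x l) * spikeStage n x l n) := by
    rw [h1, smul_smul]
    push_cast
    rw [inv_mul_cancel₀ hα, one_smul]
  rw [h3, Matrix.mul_smul, ← Matrix.mul_assoc, ← Matrix.star_eq_conjTranspose, h2, Matrix.one_mul]

theorem descending_eq_mul_core_mul (hl : l < n) (C : ℕ → Core) :
    descending n C = ((List.range l).map fun p => coreAt (n + 1) p (C p)).prod *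
      coreAt (n + 1) l (C l) *
      ((List.range' (l + 1) (n - l - 1)).map fun p => coreAt (n + 1) p (C p)).prod := by
  have h1 : List.range n = List.range l ++ (l :: List.range' (l + 1) (n - l - 1)) := by
    have : n = l + ((n - l - 1) + 1) := by omega
    conv_lhs => rw [this, List.range_eq_range', ← List.range'_append_1, ← List.range_eq_range',
      zero_add, List.range'_succ]
  rw [descending, h1]
  simp [mul_assoc]

theorem coreAt_flip2 {m i : ℕ} (hi : i + 1 < m) : coreAt m i flip2 =
    1 - (unitCol m i - unitCol m (i + 1)) * (unitCol m i - unitCol m (i + 1))ᴴ := by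
  have h : ∀ q : Fin m, ∀ A : Matrix (Fin m) (Fin m) ℂ, ∀ p, A p q = (A * unitCol m q) p 0 := by
    intro q A p
    rw [mul_incl_apply (by omega)]
    simp
  ext p q
  refine (h q _ p).trans (Eq.trans ?_ (h q _ p).symm)
  rw [flip_mul_unitCol hi, Matrix.sub_mul, Matrix.one_mul, Matrix.mul_assoc,
    Matrix.conjTranspose_sub, Matrix.sub_mul ((unitCol m i)ᴴ)]
  have hs : ∀ j, j < m → (unitCol m j)ᴴ * unitCol m q = if q.val = j then 1 else 0 := by
    intro j hj
    split_ifs with hq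
    · rw [hq]; exact incl_conj_mul_incl (by omega)
    · exact unitCol_conj_mul_unitCol (fun hc => hq hc.symm)
  rw [hs i (by omega), hs (i + 1) hi]
  split_ifs with h1 h2 h2
  · omega
  · simp [h1]
  · simp [h2]
  · simp

/-- The unitary part of a spike matrix in exact arithmetic is the transposition of `l` and `n`. -/
theorem initC_conj_mul_initB (hl : l < n) :
    (descending n (initC id x l))ᴴ * descending n (initB id x l)
      = 1 - (unitCol (n + 1) l - unitCol (n + 1) n) * (unitCol (n + 1) l - unitCol (n + 1) n)ᴴ := by
  set pre := ((List.range l).map fun p => coreAt (n + 1) p (initC id x l p)).prod with hpre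
  set post := ((List.range' (l + 1) (n - l - 1)).map fun p => coreAt (n + 1) p flip2).prod
    with hpost
  have hC : descending n (initC id x l)
      = pre * coreAt (n + 1) l (initC id x l l) * post := by
    rw [descending_eq_mul_core_mul hl]
    congr 2
    refine List.map_congr_left fun p hp => ?_
    have := List.mem_range'_1.1 hp
    rw [initC, if_neg (by omega)]
  have hB : descending n (initB id x l)
      = pre * (coreAt (n + 1) l (initC id x l l) * coreAt (n + 1) l flip2) * post := by
    rw [descending_eq_mul_core_mul hl, coreAt_mul (by omega)]
    congr 1
    · congr 1
      · refine congrArg List.prod (List.map_congr_left fun p hp => ?_)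
        have := List.mem_range.1 hp
        rw [initB, if_neg (by omega)]
      · rw [initB, if_pos rfl]
    · refine congrArg List.prod (List.map_congr_left fun p hp => ?_)
      have := List.mem_range'_1.1 hp
      rw [initB, if_neg (by omega), initC, if_neg (by omega)]
  have u1 : preᴴ * pre = (1 : Matrix (Fin (n + 1)) (Fin (n + 1)) ℂ) := by
    refine Matrix.mem_unitaryGroup_iff'.1 (listProd_unitary fun A hA => ?_)
    obtain ⟨p, hp, rfl⟩ := List.mem_map.1 hA
    have := List.mem_range.1 hp
    exact coreAt_unitary (by omega) (initC_id_unitary x l p)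
  have u2 : (coreAt (n + 1) l (initC id x l l))ᴴ * coreAt (n + 1) l (initC id x l l) = 1 :=
    Matrix.mem_unitaryGroup_iff'.1 (coreAt_unitary (by omega) (initC_id_unitary x l l))
  have u3 : postᴴ * post = (1 : Matrix (Fin (n + 1)) (Fin (n + 1)) ℂ) := by
    refine Matrix.mem_unitaryGroup_iff'.1 (listProd_unitary fun A hA => ?_)
    obtain ⟨p, hp, rfl⟩ := List.mem_map.1 hA
    have := List.mem_range'_1.1 hp
    exact coreAt_unitary (by omega) flip2_unitary
  have p1 : post * unitCol (n + 1) l = unitCol (n + 1) l := by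
    rw [hpost, flips_mul_unitCol (by omega), if_pos (by omega)]
  have p2 : post * unitCol (n + 1) n = unitCol (n + 1) (l + 1) := by
    rw [hpost, flips_mul_unitCol (by omega), if_neg (by omega), if_pos (by omega)]
  have p3 : postᴴ * (unitCol (n + 1) l - unitCol (n + 1) (l + 1))
      = unitCol (n + 1) l - unitCol (n + 1) n := by
    rw [← p2]
    conv_lhs => rw [← p1]
    rw [← Matrix.mul_sub, ← Matrix.mul_assoc, u3, Matrix.one_mul]
  have hmul : (descending n (initC id x l))ᴴ * descending n (initB id x l)
      = postᴴ * coreAt (n + 1) l flip2 * post := by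
    rw [hC, hB]
    generalize coreAt (n + 1) l (initC id x l l) = c at *
    generalize coreAt (n + 1) l flip2 = d
    calc (pre * c * post)ᴴ * (pre * (c * d) * post)
        = postᴴ * (cᴴ * ((preᴴ * pre) * (c * (d * post)))) := by
          simp only [Matrix.conjTranspose_mul, Matrix.mul_assoc]
      _ = postᴴ * ((cᴴ * c) * (d * post)) := by
        rw [u1]; simp only [Matrix.mul_assoc, Matrix.one_mul]
      _ = _ := by rw [u2]; simp only [Matrix.mul_assoc, Matrix.one_mul]
  rw [hmul, coreAt_flip2 (by omega), Matrix.mul_sub, Matrix.sub_mul, Matrix.mul_one, u3, ← p3,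
    Matrix.conjTranspose_mul, Matrix.conjTranspose_conjTranspose]
  simp only [Matrix.mul_assoc]

end Exact

/-! ### Products of almost unitary matrices -/

section Products

variable {n : ℕ} {c : ℝ}

theorem norm_listProd_sub_le_of_unitary {L : List ℕ} {A A' : ℕ → Matrix (Fin n) (Fin n) ℂ}
    (hA : ∀ i ∈ L, A i ∈ Matrix.unitaryGroup (Fin n) ℂ)
    (hA' : ∀ i ∈ L, A' i ∈ Matrix.unitaryGroup (Fin n) ℂ) (h : ∀ i ∈ L, ‖A i - A' i‖ ≤ c) :
    ‖(L.map A).prod - (L.map A').prod‖ ≤ L.length * c := by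
  induction L with
  | nil => simp
  | cons a L ih =>
    simp only [List.forall_mem_cons] at hA hA' h
    have h1 := ih hA.2 hA'.2 h.2
    have u : (L.map A).prod ∈ Matrix.unitaryGroup (Fin n) ℂ := by
      refine listProd_unitary fun B hB => ?_
      obtain ⟨p, hp, rfl⟩ := List.mem_map.1 hB
      exact hA.2 p hp
    have h2 := norm_mul_sub_le_of_unitary u h.1
    have h3 := norm_unitary_mul_sub_le hA'.1 h1
    simp only [List.map_cons, List.prod_cons, List.length_cons]
    have := norm_sub_le_sub_add (A a * (L.map A).prod) (A' a * (L.map A).prod)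
      (A' a * (L.map A').prod)
    push_cast
    linarith

theorem norm_listProd_sub_le_of_near {l l' : List (Matrix (Fin n) (Fin n) ℂ)}
    (h : List.Forall₂ (fun A A' => A' ∈ Matrix.unitaryGroup (Fin n) ℂ ∧ ‖A - A'‖ ≤ c) l l') :
    ‖l.prod - l'.prod‖ ≤ (1 + c) ^ l.length - 1 ∧ l'.prod ∈ Matrix.unitaryGroup (Fin n) ℂ := by
  induction h with
  | nil => simp [one_mem]
  | cons h1 _ ih =>
    have := norm_mul_sub_mul_le h1.1 ih.2 h1.2 ih.1
    simp only [List.prod_cons, List.length_cons]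
    refine ⟨this.trans (le_of_eq ?_), mul_mem h1.1 ih.2⟩
    ring

theorem one_add_pow_sub_one_le {m : ℕ} (hc : 0 ≤ c) (h : m * c ≤ 1) :
    (1 + c) ^ m - 1 ≤ 2 * (m * c) := by
  have h0 : 0 ≤ m * c := by positivity
  have h1 : (1 + c) ^ m ≤ Real.exp (m * c) := by
    rw [Real.exp_nat_mul]
    exact pow_le_pow_left₀ (by linarith) (by linarith [Real.add_one_le_exp c]) m
  have h2 := Real.abs_exp_sub_one_le (x := m * c) (by rwa [abs_of_nonneg h0])
  rw [abs_of_nonneg h0] at h2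
  have := (abs_le.1 h2).2
  linarith

theorem ShadowWord.norm_wordMat_sub_le {δ : ℝ} {w w₀ : List (ℕ × Core)}
    (h : ShadowWord δ n w w₀) :
    ‖wordMat n w - wordMat n w₀‖ ≤ (1 + 12 * δ) ^ w.length - 1 := by
  have : List.Forall₂ (fun A A' => A' ∈ Matrix.unitaryGroup (Fin n) ℂ ∧ ‖A - A'‖ ≤ 12 * δ)
      (w.map fun c => coreAt n c.1 c.2) (w₀.map fun c => coreAt n c.1 c.2) := by
    unfold ShadowWord at h
    induction h with
    | nil => exact List.Forall₂.nil
    | cons h1 _ ih =>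
      obtain ⟨h1, h2, h3⟩ := h1
      refine List.Forall₂.cons ⟨coreAt_unitary (h1 ▸ h2) h3.unitary, ?_⟩ ih
      simp only [← h1]
      rw [norm_coreAt_sub h2]
      exact h3.near
  simpa [wordMat] using (norm_listProd_sub_le_of_near this).1

theorem norm_descending_sub_le {δ : ℝ} {C C₀ : ℕ → Core} (h : ∀ i, Shadow δ (C i) (C₀ i)) :
    ‖descending n C - descending n C₀‖ ≤ (1 + 12 * δ) ^ n - 1 := by
  have key : ∀ L : List ℕ, (∀ i ∈ L, i < n) →
      List.Forall₂ (fun A A' => A' ∈ Matrix.unitaryGroup (Fin (n + 1)) ℂ ∧ ‖A - A'‖ ≤ 12 * δ)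
      (L.map fun i => coreAt (n + 1) i (C i)) (L.map fun i => coreAt (n + 1) i (C₀ i)) := by
    intro L
    induction L with
    | nil => exact fun _ => List.Forall₂.nil
    | cons a L ih =>
      intro hL
      simp only [List.forall_mem_cons] at hL
      refine List.Forall₂.cons ⟨coreAt_unitary (by omega) (h a).unitary, ?_⟩ (ih hL.2)
      rw [norm_coreAt_sub (by omega)]
      exact (h a).near
  simpa [descending] using (norm_listProd_sub_le_of_near (key (List.range n) (by simp))).1

end Products

/-! ### The computed initial storage -/

section Initial

variable {u : ℝ} {rd : ℝ → ℝ}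

theorem norm_spikeTail_sub_le (h : IsRounding u rd) (hu : 0 ≤ u) (hu1 : u ≤ 1 / 1000) (x : ℕ → ℂ)
    (l m : ℕ) : ‖spikeTail rd x l m - spikeTail id x l m‖
      ≤ ((1 + 10 * u) ^ m - 1) * ‖spikeTail id x l m‖ := by
  induction m with
  | zero => simp [spikeTail]
  | succ m ih =>
    set η := (1 + 10 * u) ^ m - 1 with hη
    have hη0 : 0 ≤ η := by
      have := one_le_pow₀ (by linarith : 1 ≤ 1 + 10 * u) (n := m)
      linarith
    rw [spikeTail, spikeTail, flHypot_id, ← Complex.ofReal_sub, Complex.norm_real,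
      Complex.norm_real, Real.norm_eq_abs, Real.norm_eq_abs]
    set a := x (l - m)
    set t := spikeTail id x l m
    set t' := spikeTail rd x l m
    have h1 := abs_flHypot_sub_le h hu hu1 a t'
    have h2 := (abs_hypot_sub_le a t t').trans ih
    have h3 := norm_le_hypot_right a t
    have h4 := hypot_nonneg a t
    have h5 : |hypot a t' - hypot a t| ≤ η * hypot a t :=
      h2.trans (mul_le_mul_of_nonneg_left h3 hη0)
    have h6 := (abs_le.1 h5).2
    rw [abs_of_nonneg h4, pow_succ]
    have h7 := abs_sub_le (flHypot rd a t') (hypot a t') (hypot a t)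
    have h8 : 10 * u * hypot a t' ≤ 10 * u * (hypot a t + η * hypot a t) :=
      mul_le_mul_of_nonneg_left (by linarith) (by linarith)
    have h9 : (1 + 10 * u) ^ m = η + 1 := by rw [hη]; ring
    rw [h9]
    nlinarith

theorem one_le_norm_spikeTail (x : ℕ → ℂ) (l m : ℕ) : 1 ≤ ‖spikeTail id x l m‖ := by
  induction m with
  | zero => simp [spikeTail]
  | succ m ih =>
    rw [spikeTail, flHypot_id, Complex.norm_real, Real.norm_eq_abs,
      abs_of_nonneg (hypot_nonneg _ _)]
    exact ih.trans (norm_le_hypot_right _ _)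

/-- Reflectors depend continuously on relative perturbations of the second entry. -/
theorem norm_givens_sub_le {a b b' : ℂ} {η : ℝ} (hb : 0 < ‖b‖) (h : ‖b' - b‖ ≤ η * ‖b‖)
    (hη : η ≤ 1 / 2) : ‖givens a b' - givens a b‖ ≤ 8 * η := by
  have hb' : 0 < ‖b'‖ := by
    have := norm_sub_norm_le b b'
    rw [norm_sub_rev] at this
    nlinarith
  have p : 0 < hypot a b := hb.trans_le (norm_le_hypot_right a b)
  have p' : 0 < hypot a b' := hb'.trans_le (norm_le_hypot_right a b')
  have hη0 : 0 ≤ η := by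
    by_contra hc
    have := (norm_nonneg _).trans h
    nlinarith
  have q : ‖(((hypot a b - hypot a b' : ℝ) : ℂ) / hypot a b)‖ ≤ η := by
    rw [norm_div, Complex.norm_real, Complex.norm_real, Real.norm_eq_abs, Real.norm_eq_abs,
      abs_of_pos p, div_le_iff₀ p, abs_sub_comm]
    exact ((abs_hypot_sub_le a b b').trans h).trans
      (mul_le_mul_of_nonneg_left (norm_le_hypot_right a b) hη0)
  have key : ∀ z : ℂ, ‖z‖ ≤ hypot a b' → ‖z / hypot a b' - z / hypot a b‖ ≤ η := by
    intro z hz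
    have c1 : (hypot a b : ℂ) ≠ 0 := by exact_mod_cast p.ne'
    have c2 : (hypot a b' : ℂ) ≠ 0 := by exact_mod_cast p'.ne'
    have : z / hypot a b' - z / hypot a b
        = (z / hypot a b') * (((hypot a b - hypot a b' : ℝ) : ℂ) / hypot a b) := by
      push_cast; field_simp
    rw [this, norm_mul]
    have hz1 : ‖z / (hypot a b' : ℂ)‖ ≤ 1 := by
      rw [norm_div, Complex.norm_real, Real.norm_eq_abs, abs_of_pos p', div_le_one p']
      exact hz
    nlinarith [norm_nonneg (z / (hypot a b' : ℂ)),
      norm_nonneg ((((hypot a b - hypot a b' : ℝ) : ℂ) / hypot a b))]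
  have e1 := key a (norm_le_hypot_left a b')
  have e2 : ‖b' / hypot a b' - b / hypot a b‖ ≤ 2 * η := by
    have h1 := key b' (norm_le_hypot_right a b')
    have h2 : ‖b' / (hypot a b : ℂ) - b / hypot a b‖ ≤ η := by
      rw [← sub_div, norm_div, Complex.norm_real, Real.norm_eq_abs, abs_of_pos p, div_le_iff₀ p]
      exact h.trans (mul_le_mul_of_nonneg_left (norm_le_hypot_right a b) hη0)
    have := norm_sub_le_sub_add (b' / (hypot a b' : ℂ)) (b' / hypot a b) (b / hypot a b)
    linarith
  unfold givens
  rw [if_neg p'.ne', if_neg p.ne']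
  refine (norm_le_of_entries _ (e := 2 * η) ?_).trans (by norm_num; linarith)
  intro i j
  fin_cases i <;> fin_cases j
  · simpa using e1.trans (by linarith)
  · have : ‖star (b' / (hypot a b' : ℂ)) - star (b / (hypot a b : ℂ))‖ ≤ 2 * η := by
      rw [← star_sub, norm_star]; exact e2
    simpa using this
  · simpa using e2
  · have : ‖-star (a / (hypot a b' : ℂ)) - -star (a / (hypot a b : ℂ))‖ ≤ 2 * η := by
      rw [← star_neg, ← star_neg, ← star_sub, norm_star, neg_sub_neg, norm_sub_rev]; linarith
    simpa using this

/-- The unitary companions of the computed initial core transformations. -/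
noncomputable def initCompanion (rd : ℝ → ℝ) (x : ℕ → ℂ) (l : ℕ) : ℕ → Core := fun p =>
  if p ≤ l then (givens (x p) (spikeTail rd x l (l - p)))ᴴ else flip2

theorem initC_shadow (h : IsRounding u rd) (hu : 0 ≤ u) (hu1 : u ≤ 1 / 1000) {δ : ℝ}
    (hδ : 100 * u ≤ δ) (x : ℕ → ℂ) (l p : ℕ) :
    Shadow δ (initC rd x l p) (initCompanion rd x l p) := by
  unfold initC initCompanion
  split_ifs
  · exact (Shadow.of_near (givens_unitary _ _) (norm_flGivens_sub_le h hu hu1 _ _)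
      hδ).conjTranspose
  · exact .of_near (ε := 0) flip2_unitary (by simp) (by linarith)

theorem initB_shadow (h : IsRounding u rd) (hu : 0 ≤ u) (hu1 : u ≤ 1 / 1000) {δ : ℝ}
    (hδ : 100 * u ≤ δ) (x : ℕ → ℂ) (l p : ℕ) :
    Shadow δ (initB rd x l p)
      (if p = l then initCompanion rd x l p * flip2 else initCompanion rd x l p) := by
  unfold initB
  by_cases hpl : p = l
  · rw [if_pos hpl, if_pos hpl]
    refine .of_near (ε := 100 * u) (mul_mem (initC_shadow h hu hu1 hδ x l p).unitary
      flip2_unitary) ?_ hδ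
    refine norm_mul_sub_le_of_unitary flip2_unitary ?_
    unfold initC initCompanion
    rw [if_pos hpl.le, if_pos hpl.le, norm_conjTranspose_sub]
    exact norm_flGivens_sub_le h hu hu1 _ _
  · rw [if_neg hpl, if_neg hpl]
    exact initC_shadow h hu hu1 hδ x l p

theorem norm_initCompanion_sub_le (h : IsRounding u rd) (hu : 0 ≤ u) (hu1 : u ≤ 1 / 1000) {n l : ℕ}
    (hl : l < n) (hn : n * (10 * u) ≤ 1 / 4) (x : ℕ → ℂ) (p : ℕ) :
    ‖initCompanion rd x l p - initC id x l p‖ ≤ 160 * n * u := by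
  unfold initC initCompanion
  split_ifs
  · rw [norm_conjTranspose_sub, flGivens_id]
    have h1 := norm_spikeTail_sub_le h hu hu1 x l (l - p)
    have h2 : ((l - p : ℕ) : ℝ) ≤ n := by
      have : l - p ≤ n := by omega
      exact_mod_cast this
    have h3 : ((l - p : ℕ) : ℝ) * (10 * u) ≤ n * (10 * u) :=
      mul_le_mul_of_nonneg_right h2 (by linarith)
    have h4 := one_add_pow_sub_one_le (c := 10 * u) (m := l - p) (by linarith) (by linarith)
    have h5 := norm_givens_sub_le (a := x p)
      (lt_of_lt_of_le one_pos (one_le_norm_spikeTail x l (l - p))) h1 (by linarith)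
    linarith
  · simp only [sub_self, norm_zero]
    positivity

theorem initB_id_unitary (x : ℕ → ℂ) (l p : ℕ) :
    initB id x l p ∈ Matrix.unitaryGroup (Fin 2) ℂ := by
  unfold initB
  split_ifs
  · exact mul_mem (initC_id_unitary x l p) flip2_unitary
  · exact initC_id_unitary x l p

theorem norm_descending_sub_le_of_unitary {n : ℕ} {C C' : ℕ → Core} {c : ℝ}
    (hC : ∀ p, C p ∈ Matrix.unitaryGroup (Fin 2) ℂ)
    (hC' : ∀ p, C' p ∈ Matrix.unitaryGroup (Fin 2) ℂ) (h : ∀ p, ‖C p - C' p‖ ≤ c) :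
    ‖descending n C - descending n C'‖ ≤ n * c := by
  have key := norm_listProd_sub_le_of_unitary (n := n + 1) (L := List.range n) (c := c)
    (A := fun i => coreAt (n + 1) i (C i)) (A' := fun i => coreAt (n + 1) i (C' i))
    (fun i hi => coreAt_unitary (by simpa using hi) (hC i))
    (fun i hi => coreAt_unitary (by simpa using hi) (hC' i))
    (fun i hi => (norm_coreAt_sub (by simpa using hi) _ _).trans_le (h i))
  simpa [descending] using key

/-- The computed initial storage is tracked with trivial gauges. The computed core transformations
are close to exactly unitary ones, and these, since the computed tail norms have a small relative
error, to those of exact arithmetic. -/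
theorem initConf_tracks {n k : ℕ} (h : IsRounding u rd) (hu : 0 ≤ u) (hu1 : u ≤ 1 / 1000)
    (hn0 : 0 < n) (hn : n * (10 * u) ≤ 1 / 4) {δ : ℝ} (hδ : 100 * u ≤ δ)
    (R : Fin k → Matrix (Fin n) (Fin n) ℂ) :
    ∃ X, Tracks δ 0 (160 * n ^ 2 * u) 0 (fun j => wordMat n ((initConf rd R).word j))
      (fun j => descending n (initC id (spikeOf (R j) (n - 1 - j.val)) (n - 1 - j.val)))
      (fun j => descending n (initB id (spikeOf (R j) (n - 1 - j.val)) (n - 1 - j.val)))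
      (initConf rd R) X := by
  have hδ0 : 0 ≤ δ := by linarith
  refine ⟨{
    word := (initConf rd R).word
    C := fun j => initCompanion rd (spikeOf (R j) (n - 1 - j.val)) (n - 1 - j.val)
    B := fun j p => if p = n - 1 - j.val
      then initCompanion rd (spikeOf (R j) (n - 1 - j.val)) (n - 1 - j.val) p * flip2
      else initCompanion rd (spikeOf (R j) (n - 1 - j.val)) (n - 1 - j.val) p
    T := fun _ => 1
    L := fun _ => 1
    W := fun _ => 1 }, ?_⟩
  refine {
    word := fun j => ?_
    C := fun j i => initC_shadow h hu hu1 hδ _ _ i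
    B := fun j i => initB_shadow h hu hu1 hδ _ _ i
    T_unitary := fun _ => one_mem _
    L_unitary := fun _ => one_mem _
    W_unitary := fun _ => one_mem _
    W_fix := fun _ => Matrix.one_mul _
    word_err := fun j => by simp
    C_err := fun j => ?_
    B_err := fun j => ?_
    U_err := by simp [initConf]
    V_err := by simp [initConf] }
  · have key : ∀ c ∈ (initConf rd R).word j, c.1 + 1 < n ∧ Shadow δ c.2 c.2 := by
      intro c hc
      simp only [initConf] at hc
      split_ifs at hc
      · obtain ⟨l, hl, hc⟩ := List.mem_flatten.1 hc
        rw [List.eq_of_mem_replicate hl] at hc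
        obtain ⟨i, hi, rfl⟩ := List.mem_map.1 hc
        have := List.mem_range.1 hi
        exact ⟨by simp only; omega, .of_near flip2_unitary (by simp) hδ0⟩
      · simp at hc
    exact List.forall₂_same.2 fun c hc => ⟨rfl, key c hc⟩
  · simp only [blockAt_one, Matrix.conjTranspose_one, Matrix.one_mul, Matrix.mul_one]
    refine (norm_descending_sub_le_of_unitary (c := 160 * n * u)
      (fun p => (initC_shadow h hu hu1 hδ _ _ p).unitary) (initC_id_unitary _ _)
      (norm_initCompanion_sub_le h hu hu1 (by omega) hn _)).trans (le_of_eq ?_)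
    ring
  · simp only [blockAt_one, Matrix.conjTranspose_one, Matrix.one_mul, Matrix.mul_one]
    refine (norm_descending_sub_le_of_unitary (c := 160 * n * u)
      (fun p => (initB_shadow h hu hu1 hδ _ _ p).unitary) (initB_id_unitary _ _)
      (fun p => ?_)).trans (le_of_eq ?_)
    · unfold initB
      split_ifs
      · exact norm_mul_sub_le_of_unitary flip2_unitary
          (norm_initCompanion_sub_le h hu hu1 (by omega) hn _ _)
      · exact norm_initCompanion_sub_le h hu hu1 (by omega) hn _ _
    · ring

/-- A descending sequence of counteridentities is the cyclic downshift. -/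
theorem wordMat_flips (n : ℕ) :
    wordMat n ((List.range (n - 1)).map fun i => (i, flip2)) = cyclicShift n := by
  ext p q
  have h : ∀ A : Matrix (Fin n) (Fin n) ℂ, A p q = (A * unitCol n q) p 0 := by
    intro A
    rw [mul_incl_apply (by omega)]
    simp
  have hp := p.isLt
  have hq := q.isLt
  refine (h _).trans ?_
  rw [wordMat, List.map_map, List.range_eq_range']
  have := flips_mul_unitCol (n := n) (m := n - 1) (p := 0) (q := q) (by omega)
  refine (congrFun (congrFun this p) 0).trans ?_
  rw [unitCol_apply, cyclicShift]
  congr 1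
  apply propext
  by_cases hc : q.val + 1 = n
  · rw [hc, Nat.mod_self, if_neg (by omega), if_pos (by omega)]
  · rw [Nat.mod_eq_of_lt (by omega), if_neg (by omega), if_neg (by omega)]

theorem wordMat_flatten_replicate (n k : ℕ) (w : List (ℕ × Core)) :
    wordMat n (List.replicate k w).flatten = wordMat n w ^ k := by
  induction k with
  | zero => simp [wordMat_nil]
  | succ k ih => rw [List.replicate_succ, List.flatten_cons, wordMat_append, ih, pow_succ']

theorem wordMat_initConf_zero {n k : ℕ} (R : Fin k → Matrix (Fin n) (Fin n) ℂ) :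
    wordMat n ((initConf rd R).word 0) = cyclicShift n ^ k := by
  simp only [initConf, if_true]
  rw [wordMat_flatten_replicate, wordMat_flips]

theorem wordMat_initConf_succ {n k : ℕ} (R : Fin k → Matrix (Fin n) (Fin n) ℂ) (j : Fin k) :
    wordMat n ((initConf rd R).word j.succ) = 1 := by
  simp [initConf, wordMat_nil]

theorem length_initConf_word_le {n k : ℕ} (R : Fin k → Matrix (Fin n) (Fin n) ℂ)
    (j : Fin (k + 1)) : ((initConf rd R).word j).length ≤ k * (n - 1) := by
  simp only [initConf]
  split_ifs <;> simp

theorem cyclicShift_pow_unitary (n k : ℕ) : cyclicShift n ^ k ∈ Matrix.unitaryGroup (Fin n) ℂ := by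
  refine pow_mem ?_ k
  rw [← wordMat_flips]
  refine listProd_unitary fun A hA => ?_
  simp only [List.map_map, List.mem_map, List.mem_range, Function.comp] at hA
  obtain ⟨i, hi, rfl⟩ := hA
  exact coreAt_unitary (by omega) flip2_unitary

end Initial

/-! ### The spikes of the Gaussian factorization -/

section Spikes

variable {n : ℕ}

theorem IsSpike.eq_spikeMat {l : ℕ} {R : Matrix (Fin n) (Fin n) ℂ} (h : IsSpike l R) (hl : l < n) :
    R = spikeMat n l (spikeCol n (spikeOf R l) l) := by
  ext p q
  rw [spikeMat, Matrix.add_apply, mul_apply_fin_one, Matrix.sub_apply, Matrix.conjTranspose_apply,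
    unitCol_apply, unitCol_apply]
  by_cases hq : q.val = l
  · obtain rfl : q = ⟨l, hl⟩ := Fin.ext hq
    rw [if_pos rfl, star_one, mul_one, Matrix.one_apply]
    by_cases hp : p.val ≤ l
    · simp [spikeCol, spikeOf, hp, hl, Fin.ext_iff]
    · have h0 : R p ⟨l, hl⟩ = 0 := h.1 (show (⟨l, hl⟩ : Fin n) < p from not_le.1 hp)
      have hpl : p.val ≠ l := fun hc => hp hc.le
      rw [h0]
      simp [spikeCol, hp, hpl, Fin.ext_iff]
  · rw [h.2 p q hq, if_neg hq, star_zero, mul_zero, add_zero]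

theorem spikeCol_vanishesFrom (x : ℕ → ℂ) (l : ℕ) : VanishesFrom (l + 1) (spikeCol n x l) := by
  intro i hi hin
  ext p q
  have hp : p.val = 0 := by omega
  rw [incl_conj_mul_apply (by omega), spikeCol, if_neg (by simp only; omega)]
  rfl

variable {k : ℕ} {x : ℕ → Matrix (Fin n) (Fin 1) ℂ} {R : ℕ → Matrix (Fin n) (Fin n) ℂ}

/-- The spikes are columns of the product: the factors to the left of a factor fix its spike, and
those to its right fix the corresponding unit vector. -/
theorem prefixProd_mul_unitCol (hR : ∀ j, j < k → R j = spikeMat n (n - 1 - j) (x j))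
    (hk : k ≤ n) (hx : ∀ j, j < k → VanishesFrom (n - j) (x j)) {j : ℕ} (hj : j < k) :
    prefixProd R k * unitCol n (n - 1 - j) = x j := by
  have key : ∀ m, j + 1 ≤ m → m ≤ k → prefixProd R m * unitCol n (n - 1 - j) = x j := by
    intro m hm
    induction m, hm using Nat.le_induction with
    | base =>
      intro _
      rw [prefixProd, Matrix.mul_assoc, hR j hj, spikeMat, Matrix.add_mul, Matrix.mul_assoc,
        incl_conj_mul_incl (by omega), Matrix.one_mul, Matrix.mul_one, add_sub_cancel]
      exact prefixProd_mul_of_vanishes hR hk j hj.le _ (hx j hj)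
    | succ m hm ih =>
      intro hmk
      rw [prefixProd, Matrix.mul_assoc, hR m (by omega),
        spikeMat_mul_of_vanishes (unitCol_conj_mul_unitCol (by omega))]
      exact ih (by omega)
  exact key k hj le_rfl

theorem prefixProd_eq_listProd (R : ℕ → Matrix (Fin n) (Fin n) ℂ) (k : ℕ) :
    prefixProd R k = ((List.range k).map R).prod := by
  induction k with
  | zero => rfl
  | succ k ih => rw [prefixProd, ih, List.range_succ, List.map_append, List.prod_append]; simp

/-- A nearby pair of sequences represents a structured perturbation of the spike matrix. -/
theorem repMat_isPerturbedSpike_of_near {l : ℕ} (hl : l < n) (x : ℕ → ℂ) {σ ε : ℝ} (hσ : 1 ≤ σ)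
    (hx : ‖spikeCol n x l‖ ≤ σ) (hε0 : 0 ≤ ε) (hε : σ * ε ≤ 1 / 8)
    {C B : Matrix (Fin (n + 1)) (Fin (n + 1)) ℂ}
    (hC : ‖C - descending n (initC id x l)‖ ≤ ε) (hB : ‖B - descending n (initB id x l)‖ ≤ ε) :
    IsPerturbedSpike σ (6 * ε) n l (spikeCol n x l) (repMat n Cᴴ B) := by
  have hCu := descending_unitary (n := n) (initC_id_unitary x l)
  have hBu := descending_unitary (n := n) (initB_id_unitary x l)
  have hE : incl (n + 1) 0 n * unitCol n l = unitCol (n + 1) l := by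
    rw [incl_mul_incl (by omega), Nat.zero_add]
  have hPE : (incl (n + 1) 0 n)ᴴ * unitCol (n + 1) l = unitCol n l := by
    rw [← hE, ← Matrix.mul_assoc, incl_conj_mul_incl (by omega), Matrix.one_mul]
  have hPF : (incl (n + 1) 0 n)ᴴ * unitCol (n + 1) n = 0 :=
    incl_conj_mul_incl_of_disjoint (by omega)
  have hFP : (unitCol (n + 1) n)ᴴ * incl (n + 1) 0 n = 0 :=
    incl_conj_mul_incl_of_disjoint (by omega)
  have hFF : (unitCol (n + 1) n)ᴴ * unitCol (n + 1) n = 1 := incl_conj_mul_incl (by omega)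
  have hFE : (unitCol (n + 1) n)ᴴ * unitCol (n + 1) l = 0 := unitCol_conj_mul_unitCol (by omega)
  have hPP : (incl (n + 1) 0 n)ᴴ * incl (n + 1) 0 n = 1 := incl_conj_mul_incl (by omega)
  have hdP : (unitCol (n + 1) l - unitCol (n + 1) n)ᴴ * incl (n + 1) 0 n = (unitCol n l)ᴴ := by
    rw [Matrix.conjTranspose_sub, Matrix.sub_mul, hFP, sub_zero, ← hPE, Matrix.conjTranspose_mul,
      Matrix.conjTranspose_conjTranspose]
  have hα := one_le_spikeNorm (n := n) x hl
  refine repMat_isPerturbedSpike (α := spikeNorm n x l) hα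
    ((spikeNorm_le x hl).trans (by linarith)) hε0 hε
    (conjTranspose_mem_unitary hCu) hBu (by rwa [norm_conjTranspose_sub]) hB ?_ ?_ ?_ ?_
  · rw [initC_conj_mul_initB x hl, Matrix.mul_assoc, Matrix.sub_mul, Matrix.one_mul,
      Matrix.mul_assoc, hdP, Matrix.mul_sub, hPP, ← Matrix.mul_assoc, Matrix.mul_sub, hPE, hPF,
      sub_zero]
  · rw [initC_conj_mul_initB x hl, Matrix.mul_assoc, Matrix.sub_mul, Matrix.one_mul,
      Matrix.mul_assoc, hdP, Matrix.mul_sub, hFP, ← Matrix.mul_assoc, Matrix.mul_sub, hFE, hFF]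
    simp
  · rw [descending_conj_mul_unitCol x hl, spikeStage_last x hl, Matrix.mul_smul, Matrix.mul_sub,
      hPF, ← Matrix.mul_assoc, hPP, Matrix.one_mul, sub_zero]
  · rw [descending_conj_mul_unitCol x hl, spikeStage_last x hl, Matrix.mul_smul, Matrix.mul_sub,
      hFF, ← Matrix.mul_assoc, hFP, Matrix.zero_mul, zero_sub]
    simp

end Spikes

/-! ### The represented product -/

section Value

variable {n k : ℕ}

theorem norm_gauge_sub {m : ℕ} {T L : Matrix (Fin m) (Fin m) ℂ}
    (hT : T ∈ Matrix.unitaryGroup (Fin m) ℂ) (hL : L ∈ Matrix.unitaryGroup (Fin m) ℂ)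
    (A Q : Matrix (Fin m) (Fin m) ℂ) : ‖T * A * Lᴴ - Q‖ = ‖A - Tᴴ * Q * L‖ := by
  have h1 := Matrix.mem_unitaryGroup_iff.1 hT
  have h2 := Matrix.mem_unitaryGroup_iff.1 hL
  rw [Matrix.star_eq_conjTranspose] at h1 h2
  have : T * (A - Tᴴ * Q * L) * Lᴴ = T * A * Lᴴ - Q := by
    rw [Matrix.mul_sub, Matrix.sub_mul]
    congr 1
    calc T * (Tᴴ * Q * L) * Lᴴ = (T * Tᴴ) * Q * (L * Lᴴ) := by simp only [Matrix.mul_assoc]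
      _ = Q := by rw [h1, h2, Matrix.one_mul, Matrix.mul_one]
  rw [← this, norm_mul_unitary (conjTranspose_mem_unitary hL), norm_unitary_mul hT]

theorem listProd_ofFn_telescope {L : Fin (k + 1) → Matrix (Fin n) (Fin n) ℂ}
    (hL : ∀ j, L j * (L j)ᴴ = 1) (G : Fin k → Matrix (Fin n) (Fin n) ℂ) :
    L 0 * (List.ofFn fun j => (L j.castSucc)ᴴ * G j * L j.succ).prod
      = (List.ofFn G).prod * L (Fin.last k) := by
  induction k with
  | zero => simp
  | succ k ih =>
    have := ih (L := fun j => L j.succ) (fun j => hL _) fun j => G j.succ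
    rw [List.ofFn_succ, List.ofFn_succ, List.prod_cons, List.prod_cons, Matrix.mul_assoc (G 0)]
    simp only [Fin.succ_last] at this
    rw [← this]
    simp only [Fin.castSucc_zero, ← Matrix.mul_assoc, hL, Matrix.one_mul, ← Fin.succ_castSucc]

theorem listProd_ofFn_eq (g : ℕ → Matrix (Fin n) (Fin n) ℂ) {G : Fin k → Matrix (Fin n) (Fin n) ℂ}
    (h : ∀ j : Fin k, G j = g j) : (List.ofFn G).prod = ((List.range k).map g).prod := by
  congr 1
  refine List.ext_getElem (by simp) fun i h1 h2 => ?_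
  simp [h]

end Value

section Value

variable {n k : ℕ} {δ e f p : ℝ} {Q : Fin (k + 1) → Matrix (Fin n) (Fin n) ℂ}
  {C₀ B₀ : Fin k → Matrix (Fin (n + 1)) (Fin (n + 1)) ℂ} {s : Conf n k} {X : Companion n k}

/-- The represented product with the companions' gauges removed: up to the outer unitary factors,
it is a product of perturbations of the initial factors. -/
theorem Tracks.exists_value_eq (h : Tracks δ e f p Q C₀ B₀ s X) {ε : ℝ}
    (he : ∀ j, (1 + 12 * δ) ^ (s.word j).length - 1 + e ≤ ε) (hf : (1 + 12 * δ) ^ n - 1 + f ≤ ε) :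
    ∃ (F : Fin (k + 1) → Matrix (Fin n) (Fin n) ℂ)
      (C B : Fin k → Matrix (Fin (n + 1)) (Fin (n + 1)) ℂ),
      (∀ j, ‖F j - Q j‖ ≤ ε) ∧ (∀ j, ‖C j - C₀ j‖ ≤ ε) ∧ (∀ j, ‖B j - B₀ j‖ ≤ ε) ∧
      s.value = (X.T 0)ᴴ *
        (F 0 * (List.ofFn fun j : Fin k => repMat n (C j)ᴴ (B j) * F j.succ).prod) *
          X.L (Fin.last k) := by
  have hT := fun j => Matrix.mem_unitaryGroup_iff.1 (h.T_unitary j)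
  have hT' := fun j => Matrix.mem_unitaryGroup_iff'.1 (h.T_unitary j)
  have hL := fun j => Matrix.mem_unitaryGroup_iff.1 (h.L_unitary j)
  have hL' := fun j => Matrix.mem_unitaryGroup_iff'.1 (h.L_unitary j)
  have hW := fun j => Matrix.mem_unitaryGroup_iff.1 (h.W_unitary j)
  have hW' := fun j => Matrix.mem_unitaryGroup_iff'.1 (h.W_unitary j)
  have hb : ∀ {Y : Matrix (Fin n) (Fin n) ℂ}, Y ∈ Matrix.unitaryGroup (Fin n) ℂ →
      blockAt (n + 1) 0 Y ∈ Matrix.unitaryGroup (Fin (n + 1)) ℂ :=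
    fun hY => blockAt_unitary (by omega) hY
  have hbL := fun j => Matrix.mem_unitaryGroup_iff'.1 (hb (h.L_unitary j))
  have hbT := fun j => Matrix.mem_unitaryGroup_iff'.1 (hb (h.T_unitary j))
  simp only [Matrix.star_eq_conjTranspose] at hT hT' hL hL' hW hW' hbL hbT
  refine ⟨fun j => X.T j * wordMat n (s.word j) * (X.L j)ᴴ,
    fun j => X.W j * descending n (s.C j) * (blockAt (n + 1) 0 (X.L j.castSucc))ᴴ,
    fun j => X.W j * descending n (s.B j) * (blockAt (n + 1) 0 (X.T j.succ))ᴴ,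
    fun j => ?_, fun j => ?_, fun j => ?_, ?_⟩
  · rw [norm_gauge_sub (h.T_unitary j) (h.L_unitary j)]
    have h1 := (h.word j).norm_wordMat_sub_le
    have h2 := h.word_err j
    exact ((norm_sub_le_sub_add _ _ _).trans (add_le_add h1 h2)).trans (he j)
  · rw [norm_gauge_sub (h.W_unitary j) (hb (h.L_unitary _))]
    have h1 := norm_descending_sub_le (n := n) (h.C j)
    have h2 := h.C_err j
    exact ((norm_sub_le_sub_add _ _ _).trans (add_le_add h1 h2)).trans hf
  · rw [norm_gauge_sub (h.W_unitary j) (hb (h.T_unitary _))]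
    have h1 := norm_descending_sub_le (n := n) (h.B j)
    have h2 := h.B_err j
    exact ((norm_sub_le_sub_add _ _ _).trans (add_le_add h1 h2)).trans hf
  have hword : ∀ j, wordMat n (s.word j)
      = (X.T j)ᴴ * (X.T j * wordMat n (s.word j) * (X.L j)ᴴ) * X.L j := by
    intro j
    calc wordMat n (s.word j)
        = ((X.T j)ᴴ * X.T j) * wordMat n (s.word j) * ((X.L j)ᴴ * X.L j) := by
          rw [hT', hL', Matrix.one_mul, Matrix.mul_one]
      _ = _ := by simp only [Matrix.mul_assoc]
  have hrep : ∀ j, represented n (s.C j) (s.B j) = (X.L j.castSucc)ᴴ *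
      repMat n (X.W j * descending n (s.C j) * (blockAt (n + 1) 0 (X.L j.castSucc))ᴴ)ᴴ
        (X.W j * descending n (s.B j) * (blockAt (n + 1) 0 (X.T j.succ))ᴴ) * X.T j.succ := by
    intro j
    rw [represented_eq_repMat, ← repMat_gauge _ _ (hW j) (h.W_fix j)]
    congr 1
    · rw [← Matrix.conjTranspose_conjTranspose (X.W j), ← Matrix.conjTranspose_mul,
        ← Matrix.conjTranspose_mul, Matrix.conjTranspose_conjTranspose]
      congr 1
      calc descending n (s.C j) = ((X.W j)ᴴ * X.W j) * descending n (s.C j) *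
            ((blockAt (n + 1) 0 (X.L j.castSucc))ᴴ * blockAt (n + 1) 0 (X.L j.castSucc)) := by
            rw [hW', hbL, Matrix.one_mul, Matrix.mul_one]
        _ = _ := by simp only [Matrix.mul_assoc]
    · calc descending n (s.B j) = ((X.W j)ᴴ * X.W j) * descending n (s.B j) *
            ((blockAt (n + 1) 0 (X.T j.succ))ᴴ * blockAt (n + 1) 0 (X.T j.succ)) := by
            rw [hW', hbT, Matrix.one_mul, Matrix.mul_one]
        _ = _ := by simp only [Matrix.mul_assoc]
  set F : Fin (k + 1) → Matrix (Fin n) (Fin n) ℂ :=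
    fun j => X.T j * wordMat n (s.word j) * (X.L j)ᴴ with hF
  set G : Fin k → Matrix (Fin n) (Fin n) ℂ := fun j =>
    repMat n (X.W j * descending n (s.C j) * (blockAt (n + 1) 0 (X.L j.castSucc))ᴴ)ᴴ
        (X.W j * descending n (s.B j) * (blockAt (n + 1) 0 (X.T j.succ))ᴴ) * F j.succ with hG
  have hfac : ∀ j, represented n (s.C j) (s.B j) * wordMat n (s.word j.succ)
      = (X.L j.castSucc)ᴴ * G j * X.L j.succ := by
    intro j
    rw [hword j.succ, hrep j, Matrix.mul_assoc _ (X.T j.succ), ← Matrix.mul_assoc (X.T j.succ),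
      ← Matrix.mul_assoc (X.T j.succ), hT, Matrix.one_mul]
    simp only [hG, hF, Matrix.mul_assoc]
  rw [Conf.value]
  simp only [hfac]
  rw [hword 0, Matrix.mul_assoc, listProd_ofFn_telescope hL]
  simp only [hF, Matrix.mul_assoc]

end Value

section Perturbation

variable {n k : ℕ}

/-- The norm of the product bounds the spikes, and slight perturbations of the stored factors change
the product by a multiple of `‖S‖ ^ 2` only. -/
theorem norm_perturbed_factorization_sub_le {S : Matrix (Fin n) (Fin n) ℂ}
    {R : Fin k → Matrix (Fin n) (Fin n) ℂ} (hS : IsGaussianFactorization S R) (hS1 : 1 ≤ ‖S‖)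
    (hn : 0 < n) (hk : k ≤ n) {ε : ℝ} (hε : 0 ≤ ε) (hsmall : 600 * n ^ 2 * ‖S‖ * ε ≤ 1)
    {F : Fin (k + 1) → Matrix (Fin n) (Fin n) ℂ}
    {C B : Fin k → Matrix (Fin (n + 1)) (Fin (n + 1)) ℂ}
    (hF0 : ‖F 0 - cyclicShift n ^ k‖ ≤ ε) (hF : ∀ j : Fin k, ‖F j.succ - 1‖ ≤ ε)
    (hC : ∀ j : Fin k,
      ‖C j - descending n (initC id (spikeOf (R j) (n - 1 - j.val)) (n - 1 - j.val))‖ ≤ ε)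
    (hB : ∀ j : Fin k,
      ‖B j - descending n (initB id (spikeOf (R j) (n - 1 - j.val)) (n - 1 - j.val))‖ ≤ ε) :
    ‖F 0 * (List.ofFn fun j : Fin k => repMat n (C j)ᴴ (B j) * F j.succ).prod - S‖
      ≤ 1300 * n ^ 3 * ‖S‖ ^ 2 * ε := by
  have hn1 : (1 : ℝ) ≤ n := by exact_mod_cast hn
  set σ := ‖S‖
  -- All families are continued to all natural numbers, with irrelevant values from `k` on.
  set R₀ : ℕ → Matrix (Fin n) (Fin n) ℂ := fun j => if h : j < k then R ⟨j, h⟩ else 1 with hR₀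
  set x : ℕ → Matrix (Fin n) (Fin 1) ℂ :=
    fun j => spikeCol n (spikeOf (R₀ j) (n - 1 - j)) (n - 1 - j) with hx
  set Rt : ℕ → Matrix (Fin n) (Fin n) ℂ :=
    fun j => if h : j < k then repMat n (C ⟨j, h⟩)ᴴ (B ⟨j, h⟩) else 1 with hRt
  set Ft : ℕ → Matrix (Fin n) (Fin n) ℂ :=
    fun j => if h : j < k then F (Fin.succ ⟨j, h⟩) else 1 with hFt
  set T : ℕ → Matrix (Fin n) (Fin n) ℂ :=
    fun j => ((List.range' j (k - j)).map fun i => Rt i * Ft i).prod with hT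
  have hsp : ∀ j, j < k → R₀ j = spikeMat n (n - 1 - j) (x j) := by
    intro j hj
    simp only [hR₀, hx, dif_pos hj]
    exact (hS.spike ⟨j, hj⟩).eq_spikeMat (by simp only; omega)
  have hvan : ∀ j, j < k → VanishesFrom (n - j) (x j) := by
    intro j hj
    have := spikeCol_vanishesFrom (n := n) (spikeOf (R₀ j) (n - 1 - j)) (n - 1 - j)
    rwa [show n - 1 - j + 1 = n - j by omega] at this
  have hP : S = cyclicShift n ^ k * prefixProd R₀ k := by
    rw [hS.eq_prod, prefixProd_eq_listProd, listProd_ofFn_eq R₀ fun j => ?_]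
    simp [hR₀]
  have hQu := cyclicShift_pow_unitary n k
  have hPn : ‖prefixProd R₀ k‖ = σ := by
    rw [← norm_unitary_mul hQu, ← hP]
  have hxn : ∀ j, j < k → ‖x j‖ ≤ σ := by
    intro j hj
    rw [← prefixProd_mul_unitCol hsp hk hvan hj, ← hPn]
    exact norm_mul_incl_le (by omega) _
  have hσε : σ * ε ≤ 1 / 8 := by
    have h0 : 0 ≤ σ * ε := by positivity
    have : 1 * (σ * ε) ≤ n ^ 2 * (σ * ε) :=
      mul_le_mul_of_nonneg_right (one_le_pow₀ hn1) h0
    nlinarith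
  obtain ⟨h1, h2⟩ := norm_perturbed_prod_sub_le (η := 6 * ε) (F := Ft) (R := Rt) (T := T) hS1
    (by linarith) hn hk (by nlinarith) hvan hxn hsp
    (fun j hj => by
      have hC' := hC ⟨j, hj⟩
      have hB' := hB ⟨j, hj⟩
      have hxj := hxn j hj
      simp only [hRt, hx, hR₀, dif_pos hj] at hxj ⊢
      exact repMat_isPerturbedSpike_of_near (by omega) _ hS1 hxj hε hσε hC' hB')
    (fun j hj => by
      simp only [hFt, dif_pos hj]
      exact (hF _).trans (by linarith))
    (by simp [hT])
    (fun j hj => by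
      simp only [hT]
      rw [show k - j = (k - (j + 1)) + 1 by omega, List.range'_succ, List.map_cons, List.prod_cons,
        Matrix.mul_assoc])
  have hT0 : (List.ofFn fun j : Fin k => repMat n (C j)ᴴ (B j) * F j.succ).prod = T 0 := by
    rw [listProd_ofFn_eq (fun i => Rt i * Ft i) fun j => by
      simp only [hRt, hFt, dif_pos j.isLt, Fin.eta], List.range_eq_range']
    simp [hT]
  rw [hT0]
  nth_rewrite 1 [hP]
  have : F 0 * T 0 - cyclicShift n ^ k * prefixProd R₀ k
      = (F 0 - cyclicShift n ^ k) * T 0 + cyclicShift n ^ k * (T 0 - prefixProd R₀ k) := by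
    rw [Matrix.sub_mul, Matrix.mul_sub]; abel
  rw [this]
  refine (norm_add_le _ _).trans ?_
  rw [norm_unitary_mul hQu]
  have h3 := norm_mul_le_of_le hF0 h2
  have h4 : n * σ * ε ≤ n ^ 3 * σ ^ 2 * ε := by
    have h5 : (n : ℝ) ≤ n ^ 3 := le_self_pow₀ hn1 (by norm_num)
    have h6 : σ ≤ σ ^ 2 := le_self_pow₀ hS1 (by norm_num)
    gcongr
  have h7 : 0 ≤ n ^ 3 * σ ^ 2 * ε := by positivity
  linarith

end Perturbation

/-! ### The backward error -/

section BackwardError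

/-- As `d ≥ 2`, the matrix contains an identity block. -/
theorem one_le_norm_blockCompanion {d k : ℕ} (hd : 2 ≤ d) (hk : 1 ≤ k)
    (M : Fin d → Matrix (Fin k) (Fin k) ℂ) : 1 ≤ ‖blockCompanion M‖ := by
  have h := norm_entry_le (blockCompanion M) (finProdFinEquiv (⟨1, hd⟩, ⟨0, hk⟩))
    (finProdFinEquiv (⟨0, by omega⟩, ⟨0, hk⟩))
  have h1 : blockCompanion M (finProdFinEquiv (⟨1, hd⟩, ⟨0, hk⟩))
      (finProdFinEquiv (⟨0, by omega⟩, ⟨0, hk⟩)) = 1 := by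
    simp only [blockCompanion, Equiv.symm_apply_apply]
    rw [if_neg (by omega), if_pos (by simp)]
  rwa [h1, norm_one] at h

/-- The backward error of a computation on the factored form, in terms of the error `δ` of a single
operation on core transformations. -/
theorem FlRun.backward_error {n k N : ℕ} {u κ δ : ℝ} {rd : ℝ → ℝ} (hrd : IsRounding u rd)
    (hu : 0 ≤ u) (hδu : 600 * u ≤ δ) (hκ : κ * u ≤ δ) {S : Matrix (Fin n) (Fin n) ℂ}
    {R : Fin k → Matrix (Fin n) (Fin n) ℂ} (hS : IsGaussianFactorization S R) (hS1 : 1 ≤ ‖S‖)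
    (hn : 0 < n) (hk : k ≤ n) (hsmall : 10 ^ 13 * n ^ 5 * (N + 1) * δ * ‖S‖ ≤ 1) {s : Conf n k}
    (hs : FlRun rd u κ N (initConf rd R) s) :
    ∃ U ∈ Matrix.unitaryGroup (Fin n) ℂ, ∃ V ∈ Matrix.unitaryGroup (Fin n) ℂ,
      ‖U - s.U‖ ≤ 10 ^ 13 * n ^ 5 * (N + 1) * δ ∧ ‖V - s.V‖ ≤ 10 ^ 13 * n ^ 5 * (N + 1) * δ ∧
      ∃ δS : Matrix (Fin n) (Fin n) ℂ, s.value = Uᴴ * (S + δS) * V ∧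
        ‖δS‖ ≤ 10 ^ 13 * n ^ 5 * (N + 1) * δ * ‖S‖ ^ 2 := by
  have hn1 : (1 : ℝ) ≤ n := by exact_mod_cast hn
  have hδ : 0 ≤ δ := by linarith
  -- `w` bounds the accumulated errors, up to numerical constants: a word has at most
  -- `k (n - 1) + N ≤ n ^ 2 (N + 1)` core transformations, each of them computed with error `O(δ)`.
  obtain ⟨w, hw⟩ : ∃ w : ℝ, w = n ^ 2 * (N + 1) * δ := ⟨_, rfl⟩
  have hN : (0 : ℝ) ≤ N := N.cast_nonneg
  have hw0 : 0 ≤ w := by rw [hw]; positivity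
  have hn2 : (1 : ℝ) ≤ n ^ 2 := one_le_pow₀ hn1
  have hn3 : (n : ℝ) ^ 2 ≤ n ^ 3 := pow_le_pow_right₀ hn1 (by norm_num)
  have hδw : δ ≤ w := by
    have : 1 * (1 * δ) ≤ n ^ 2 * ((N + 1) * δ) := by gcongr; linarith
    linarith
  have hNw : N * δ ≤ w := by
    have : 1 * (N * δ) ≤ n ^ 2 * ((N + 1) * δ) := by gcongr; linarith
    linarith
  have hn2w : n ^ 2 * δ ≤ w := by
    have : n ^ 2 * (1 * δ) ≤ n ^ 2 * ((N + 1) * δ) := by gcongr; linarith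
    linarith
  have hnw : n * δ ≤ w := by
    refine le_trans ?_ hn2w
    gcongr
    exact le_self_pow₀ hn1 (by norm_num)
  have hγ : 10 ^ 13 * n ^ 5 * (N + 1) * δ = 10 ^ 13 * (n ^ 3 * w) := by rw [hw]; ring
  rw [hγ] at hsmall ⊢
  have hn3w : n ^ 2 * w ≤ n ^ 3 * w := by gcongr
  have hw3 : w ≤ n ^ 3 * w := by nlinarith
  have hwS : 10 ^ 13 * (n ^ 2 * w) * ‖S‖ ≤ 1 := by
    refine le_trans ?_ hsmall
    gcongr
  have hw1 : 10 ^ 13 * w ≤ 1 := by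
    have : 10 ^ 13 * w * 1 ≤ 10 ^ 13 * (n ^ 3 * w) * ‖S‖ := by gcongr
    linarith
  have hu1 : u ≤ 1 / 1000 := by linarith
  have hnu : n * (10 * u) ≤ 1 / 4 := by
    have : n * (600 * u) ≤ n * δ := by gcongr
    linarith
  obtain ⟨X₀, hX₀⟩ := initConf_tracks hrd hu hu1 hn hnu (by linarith : 100 * u ≤ δ) R
  obtain ⟨X, hX⟩ := FlRun.tracks hrd hu hδu hκ (by linarith) hs hX₀
  have hlen : ∀ j, ((s.word j).length : ℝ) * δ ≤ w := by
    intro j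
    have h1 := (hs.length_le j).trans
      (Nat.add_le_add_right (length_initConf_word_le (rd := rd) R j) N)
    have h2 : k * (n - 1) ≤ n * n := Nat.mul_le_mul hk (by omega)
    have h3 : ((s.word j).length : ℝ) ≤ n * n + N := by exact_mod_cast h1.trans (by omega)
    rw [hw]
    refine mul_le_mul_of_nonneg_right (h3.trans ?_) hδ
    nlinarith
  have hpow : ∀ m : ℕ, m * δ ≤ w → (1 + 12 * δ) ^ m - 1 ≤ 24 * w := fun m hm =>
    (one_add_pow_sub_one_le (by linarith) (by linarith)).trans (by linarith)
  have hn2u : 160 * n ^ 2 * u ≤ w := by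
    have : n ^ 2 * (600 * u) ≤ n ^ 2 * δ := by gcongr
    have : 0 ≤ n ^ 2 * u := by positivity
    linarith
  -- `2 * 10 ^ 9` dominates the constant `12 * 10 ^ 8` of a single operation in `FlRun.tracks`, plus
  -- the constants of the initial storage and of the distance to the unitary companions.
  obtain ⟨F, C, B, hF, hC, hB, hv⟩ := hX.exists_value_eq (ε := 2 * 10 ^ 9 * w)
    (fun j => by linarith [hpow _ (hlen j)]) (by linarith [hpow _ hnw])
  have hmain := norm_perturbed_factorization_sub_le hS hS1 hn hk (by positivity)
    (by linarith) (F := F)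
    (by simpa only [wordMat_initConf_zero] using hF 0)
    (fun j => by simpa only [wordMat_initConf_succ] using hF j.succ) hC hB
  refine ⟨X.T 0, hX.T_unitary 0, X.L (Fin.last k), hX.L_unitary _, ?_, ?_,
    F 0 * (List.ofFn fun j : Fin k => repMat n (C j)ᴴ (B j) * F j.succ).prod - S, ?_, ?_⟩
  · rw [norm_sub_rev]
    linarith [hX.U_err, hpow N hNw]
  · rw [norm_sub_rev]
    linarith [hX.V_err, hpow N hNw]
  · rw [add_sub_cancel, hv]
  · have : 0 ≤ n ^ 3 * w * ‖S‖ ^ 2 := by positivity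
    linarith

end BackwardError

end CoreChasing

theorem mainTheorem4 (κ : ℝ) :
    ∃ (K : ℝ) (a : ℕ), 0 < K ∧
      ∀ (d k N : ℕ), 2 ≤ d → 1 ≤ k →
      ∀ (u : ℝ) (rd : ℝ → ℝ), 0 < u → CoreChasing.IsRounding u rd →
      ∀ (M : Fin d → Matrix (Fin k) (Fin k) ℂ),
        (∀ i : Fin d, i.val = 0 → (M i).BlockTriangular id) →
      ∀ (S : Matrix (Fin (d * k)) (Fin (d * k)) ℂ), S = CoreChasing.blockCompanion M →
      ∀ (R : Fin k → Matrix (Fin (d * k)) (Fin (d * k)) ℂ),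
        CoreChasing.IsGaussianFactorization S R →
      ∀ (γ : ℝ), γ = K * ((d : ℝ) * (k : ℝ)) ^ a * ((N : ℝ) + 1) → γ * ‖S‖ * u ≤ 1 →
      ∀ (s : CoreChasing.Conf (d * k) k),
        CoreChasing.FlRun rd u κ N (CoreChasing.initConf rd R) s →
      ∃ U ∈ Matrix.unitaryGroup (Fin (d * k)) ℂ, ∃ V ∈ Matrix.unitaryGroup (Fin (d * k)) ℂ,
        ‖U - s.U‖ ≤ γ * u ∧ ‖V - s.V‖ ≤ γ * u ∧
        ∃ δS : Matrix (Fin (d * k)) (Fin (d * k)) ℂ,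
          s.value = Uᴴ * (S + δS) * V ∧ ‖δS‖ ≤ γ * ‖S‖ ^ 2 * u := by
  -- `δ = max 600 κ * u` bounds both the error of a computed core (`600 * u`) and that of a core
  -- transformation brought in from outside (`κ * u`).
  refine ⟨10 ^ 13 * max 600 κ, 5, by positivity, ?_⟩
  intro d k N hd hk u rd hu hrd M _ S hS R hR γ hγ hsmall s hs
  subst hS
  have hγu : γ * u = 10 ^ 13 * ((d * k : ℕ) : ℝ) ^ 5 * (N + 1) * (max 600 κ * u) := by
    rw [hγ]; push_cast; ring
  have hS1 := CoreChasing.one_le_norm_blockCompanion hd hk M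
  have hkn : k ≤ d * k := Nat.le_mul_of_pos_left k (by omega)
  have := CoreChasing.FlRun.backward_error hrd hu.le
    (mul_le_mul_of_nonneg_right (le_max_left 600 κ) hu.le)
    (mul_le_mul_of_nonneg_right (le_max_right 600 κ) hu.le) hR hS1 (by omega) hkn
    (by rw [← hγu]; linarith) hs
  rw [← hγu] at this
  rwa [mul_right_comm γ _ u]
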